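/- **Setting.** Let $\nu\ge 1$, let $G$ be an undirected weighted graph without self-loops on $\{1,\dots,\nu\}$ with (real symmetric, zero-diagonal) adjacency matrix $W$, let $0<t_1<\dots<t_m$ be integers, and let $L_1,\dots,L_m\in\mathbb R^{\nu\times\nu}$ be arbitrary nonzero matrices (linking operators); all of these are fixed, independent of $n$. The diamond Toeplitz graph has the nodes $(i,r)$, $1\le i\le n$, $1\le r\le\nu$, and the weights $$w\big((i,r),(j,s)\big)=\begin{cases}W(r,s)& i=j,\\ L_k(r,s)& i-j=t_k,\\ L_k(s,r)& i-j=-t_k,\\ 0&\text{otherwise.}\end{cases}$$ Place the node $(j,r)$ at the point $\frac{(j-1)\nu+r}{\nu n+1}\in(0,1)$. Let $\Omega\subseteq[0,1]$ be a regular domain, i.e. a Lebesgue measurable set of positive measure with boundary of measure zero, and let $p\equiv c$ be a real constant. The grid graph immersed in $\Omega$ keeps the nodes lying in $\Omega$; its weights are $w^{p}(x,y)=p\left(\frac{x+y}{2}\right)w(x,y)=c\,w(x,y)$. Let $d_n$ be the number of its nodes (so $d_n=\nu n$ if $\Omega=[0,1]$) and $\lambda^{(n)}_1\le\dots\le\lambda^{(n)}_{d_n}$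 the eigenvalues of its adjacency matrix. Let $$f(\theta)=W+\sum_{k=1}^m\Big[(L_k+L_k^T)\cos(t_k\theta)+(L_k-L_k^T)\,\mathrm i\sin(t_k\theta)\Big],\qquad \theta\in\mathbb R,$$ with eigenvalues $\lambda_1(f(\theta))\le\dots\le\lambda_\nu(f(\theta))$. Split $[-\pi,\pi]$ into the cells $I_k$ with endpoints $\frac{(2(k-1)-\nu)\pi}{\nu}$ and $\frac{(2k-\nu)\pi}{\nu}$, $k=1,\dots,\nu$ (a common endpoint of two cells belongs to the right one), and put $$\hat g(x,\theta)=p(x)\,\lambda_k\big(f(\nu\theta-(2k-1-\nu)\pi)\big)\quad\text{for }\theta\in I_k .$$ Let $R$ be the image of $\overline\Omega\times[-\pi,\pi]$ under $\hat g$, let $\phi(t)$ be the normalized Lebesgue measure of $\{(x,\theta)\in\Omega\times[-\pi,\pi]:\hat g(x,\theta)\le t\}$, and let $$\tilde g(x)=\inf\{t\in[\min R,\max R]:\phi(t)\ge x\},\qquad x\in[0,1],$$ be the monotone rearrangement of the symbol. **Corollary 5.3.** For every choice of $m$, $W$, $t_1,\dots,t_m$, $L_1,\dots,L_m$, $\Omega$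 and $c$ as above, $\tilde g:[0,1]\to\mathbb R$ is differentiable at $x=1$ (one-sidedly). Moreover, let $N_n$ denote either $\nu n$ or $d_n$ (the two agree for $\Omega=[0,1]$) and put $x_n=1-\frac1{N_n}$. Then, as $n\to\infty$, $\tilde g$ is differentiable at $x_n$ for all large $n$, $$\tilde g'(x_n)\to 0\qquad\text{and}\qquad N_n\big[\lambda^{(n)}_{d_n}-\lambda^{(n)}_{d_n-1}\big]\to 0 .$$ In particular, for $\Omega=[0,1]$, $\ \nu n\big[\lambda^{(n)}_{\nu n}-\lambda^{(n)}_{\nu n-1}\big]\to0$. The case $\nu=1$, $W=0$, $L_k=w_{t_k}\ne0$ is that of Toeplitz graphs. -/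

import Mathlib

open Set Filter Topology MeasureTheory

namespace DiamondToeplitz

/-- A finite weighted undirected graph without self-loops on the node set `V`, given by its weight
function (the edges are the pairs of nonzero weight; the potential term is zero throughout). -/
structure WeightedGraph (V : Type) where
  weight : V → V → ℝ
  symm : ∀ u v, weight u v = weight v u
  loopless : ∀ v, weight v v = 0

/-- The adjacency matrix of a weighted graph. -/
def WeightedGraph.adjMatrix {V : Type} (G : WeightedGraph V) : Matrix V V ℝ :=
  Matrix.of G.weight

theorem WeightedGraph.adjMatrix_isHermitian {V : Type} (G : WeightedGraph V) :
    G.adjMatrix.IsHermitian := by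
  ext u v
  simp [WeightedGraph.adjMatrix, G.symm v u]

/-- `m` connections `(t₁, L₁), …, (tₘ, Lₘ)`: positive integers `t₁ < ⋯ < tₘ` and, for each of them,
a linking-graph operator on `ν` nodes, that is, a nonzero real `ν × ν` matrix. -/
structure Links (ν m : ℕ) where
  t : Fin m → ℕ
  t_pos : ∀ k, 0 < t k
  t_strictMono : StrictMono t
  L : Fin m → Matrix (Fin ν) (Fin ν) ℝ
  L_ne_zero : ∀ k, L k ≠ 0

/-- The (one-level) diamond Toeplitz graph: `n` copies of the mold graph `G`. The weight between the
node `r` of the copy `i` and the node `s` of the copy `j` is `w(r,s)` if `i = j`, it is `L_k(r,s)` if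
`i - j = t_k`, it is `L_k(s,r)` if `i - j = -t_k`, and it is `0` otherwise. (The `t_k` are distinct
and positive, so at most one summand below is nonzero.) -/
def diamondGraph {ν m : ℕ} (G : WeightedGraph (Fin ν)) (K : Links ν m) (n : ℕ) :
    WeightedGraph (Fin n × Fin ν) where
  weight u v :=
    (if u.1 = v.1 then G.weight u.2 v.2 else 0) +
      ∑ k, ((if (u.1 : ℤ) - (v.1 : ℤ) = (K.t k : ℤ) then K.L k u.2 v.2 else 0) +
        (if (u.1 : ℤ) - (v.1 : ℤ) = -(K.t k : ℤ) then K.L k v.2 u.2 else 0))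
  symm u v := by
    congr 1
    · simp only [eq_comm (a := u.1), G.symm u.2]
    · refine Finset.sum_congr rfl fun k _ => ?_
      rw [add_comm]
      congr 1
      · refine if_congr ?_ rfl rfl
        omega
      · refine if_congr ?_ rfl rfl
        omega
  loopless v := by
    have h : ∀ k, K.t k ≠ 0 := fun k => (K.t_pos k).ne'
    have h2 : ∀ k, ¬ ((0 : ℤ) = (K.t k : ℤ)) := fun k h' => h k (by omega)
    simp [G.loopless, h, h2]

/-- The immersion of the nodes into `(0,1)`: the `ν n` nodes are lined up, one diamond after the
other, on the uniform grid of step `h = 1/(ν n + 1)`. With one-based indices `j`, `r` the point is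
`((j - 1) ν + r) h`; here the indices are zero-based. -/
noncomputable def immersion (ν n : ℕ) (v : Fin n × Fin ν) : ℝ :=
  ((v.1 : ℝ) * ν + ((v.2 : ℝ) + 1)) / ((ν : ℝ) * n + 1)

/-- A regular domain in `[0,1]`: a Lebesgue measurable set of positive measure whose boundary is a
null set. -/
structure IsRegularDomain (Ω : Set ℝ) : Prop where
  subset : Ω ⊆ Icc 0 1
  measurable : NullMeasurableSet Ω volume
  frontier_null : volume (frontier Ω) = 0
  pos : 0 < volume Ω

/-- The nodes of the diamond Toeplitz grid graph that lie in `Ω`. -/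
def Node (ν n : ℕ) (Ω : Set ℝ) : Type :=
  {v : Fin n × Fin ν // immersion ν n v ∈ Ω}

noncomputable instance (ν n : ℕ) (Ω : Set ℝ) : Fintype (Node ν n Ω) :=
  @Fintype.ofFinite _ (inferInstanceAs (Finite {v : Fin n × Fin ν // immersion ν n v ∈ Ω}))

instance (ν n : ℕ) (Ω : Set ℝ) : DecidableEq (Node ν n Ω) :=
  inferInstanceAs (DecidableEq {v : Fin n × Fin ν // immersion ν n v ∈ Ω})

/-- The number of nodes in `Ω`, which is the size of the adjacency matrix. -/
noncomputable def numNodes (ν n : ℕ) (Ω : Set ℝ) : ℕ :=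
  Fintype.card (Node ν n Ω)

/-- The diamond Toeplitz grid graph immersed in `Ω`, with weight function
`w^p(x, y) = p ((x + y) / 2) w(x, y)`. -/
noncomputable def gridGraph {ν m : ℕ} (G : WeightedGraph (Fin ν)) (K : Links ν m)
    (p : ℝ → ℝ) (Ω : Set ℝ) (n : ℕ) : WeightedGraph (Node ν n Ω) where
  weight u v :=
    p ((immersion ν n u.1 + immersion ν n v.1) / 2) * (diamondGraph G K n).weight u.1 v.1
  symm u v := by
    rw [add_comm, (diamondGraph G K n).symm]
  loopless v := by
    rw [(diamondGraph G K n).loopless, mul_zero]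

/-- `sortedEigenvalue hA k` is the `k`-th eigenvalue `λ_k` of the Hermitian matrix `A` of size `N`,
where `λ_1 ≤ ⋯ ≤ λ_N` are listed with multiplicity. (It is `0` if `k` is not in `{1, …, N}`.
Mathlib lists the eigenvalues in non-increasing order.) -/
noncomputable def sortedEigenvalue {𝕜 V : Type} [RCLike 𝕜] [Fintype V] [DecidableEq V]
    {A : Matrix V V 𝕜} (hA : A.IsHermitian) (k : ℕ) : ℝ :=
  if h : 1 ≤ k ∧ k ≤ Fintype.card V then
    hA.eigenvalues₀ ⟨Fintype.card V - k, by omega⟩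
  else 0

/-- The eigenvalues `λ_1 ≤ ⋯ ≤ λ_N` of the adjacency matrix of the grid graph immersed in `Ω`. -/
noncomputable def gridEigenvalue {ν m : ℕ} (G : WeightedGraph (Fin ν)) (K : Links ν m)
    (p : ℝ → ℝ) (Ω : Set ℝ) (n k : ℕ) : ℝ :=
  sortedEigenvalue (gridGraph G K p Ω n).adjMatrix_isHermitian k

/-- The symbol
`f(θ) = W + ∑ (L_k + L_kᵀ) cos(t_k θ) + ∑ (L_k - L_kᵀ) i sin(t_k θ)`
of the sequence of diamond Toeplitz graphs. -/
noncomputable def symbol {ν m : ℕ} (G : WeightedGraph (Fin ν)) (K : Links ν m) (θ : ℝ) :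
    Matrix (Fin ν) (Fin ν) ℂ :=
  Matrix.of fun r s =>
    (G.weight r s : ℂ) +
      ∑ k, (((K.L k r s + K.L k s r : ℝ) : ℂ) * (Real.cos (K.t k * θ) : ℂ) +
        ((K.L k r s - K.L k s r : ℝ) : ℂ) * (Complex.I * (Real.sin (K.t k * θ) : ℂ)))

theorem symbol_isHermitian {ν m : ℕ} (G : WeightedGraph (Fin ν)) (K : Links ν m) (θ : ℝ) :
    (symbol G K θ).IsHermitian := by
  ext r s
  simp only [symbol, Matrix.conjTranspose_apply, Matrix.of_apply, star_add, star_sum, star_mul',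
    RCLike.star_def, Complex.conj_ofReal, Complex.conj_I, G.symm s r]
  congr 1
  refine Finset.sum_congr rfl fun k _ => ?_
  push_cast
  ring

/-- The cells `I_1, …, I_ν` (here with zero-based index) of the subdivision of `[-π, π]` into `ν`
intervals of length `2π/ν`; a common endpoint of two cells is assigned to the right one. -/
noncomputable def cell (ν : ℕ) (k : Fin ν) : Set ℝ :=
  if (k : ℕ) + 1 = ν then
    Icc ((2 * (k : ℝ) - ν) * Real.pi / ν) ((2 * ((k : ℝ) + 1) - ν) * Real.pi / ν)
  else
    Ico ((2 * (k : ℝ) - ν) * Real.pi / ν) ((2 * ((k : ℝ) + 1) - ν) * Real.pi / ν)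

/-- The scalar function `p(x) ∑_k λ_k(f_k(θ))` on `Ω × [-π, π]`, where
`f_k(θ) = f(ν θ - (2 k - 1 - ν) π)` on the cell `I_k` (one-based `k`) and `f_k = 0` off `I_k`. -/
noncomputable def scalarSymbol {ν m : ℕ} (G : WeightedGraph (Fin ν)) (K : Links ν m)
    (p : ℝ → ℝ) (z : ℝ × ℝ) : ℝ :=
  p z.1 * ∑ k : Fin ν, (cell ν k).indicator
    (fun θ => sortedEigenvalue
      (symbol_isHermitian G K (ν * θ - (2 * ((k : ℝ) + 1) - 1 - ν) * Real.pi)) ((k : ℕ) + 1)) z.2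

/-- The image set `R_g` of the symbol `g(x, θ) = p(x) f(θ)`. -/
noncomputable def symbolRange {ν m : ℕ} (G : WeightedGraph (Fin ν)) (K : Links ν m)
    (p : ℝ → ℝ) (Ω : Set ℝ) : Set ℝ :=
  scalarSymbol G K p '' (closure Ω ×ˢ Icc (-Real.pi) Real.pi)

/-- The distribution function `φ(t)`: the normalized Lebesgue measure of the set of points of
`Ω × [-π, π]` at which `p(x) ∑_k λ_k(f_k(θ)) ≤ t`. -/
noncomputable def distribution {ν m : ℕ} (G : WeightedGraph (Fin ν)) (K : Links ν m)
    (p : ℝ → ℝ) (Ω : Set ℝ) (t : ℝ) : ℝ :=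
  (volume {z : ℝ × ℝ | z ∈ Ω ×ˢ Icc (-Real.pi) Real.pi ∧ scalarSymbol G K p z ≤ t}).toReal /
    (volume (Ω ×ˢ Icc (-Real.pi) Real.pi)).toReal

/-- The monotone rearrangement
`g̃(x) = inf {t ∈ [min R_g, max R_g] : φ(t) ≥ x}` of the symbol `g(x, θ) = p(x) f(θ)`,
meaningful for `x` in `[0,1]`. -/
noncomputable def rearrangement {ν m : ℕ} (G : WeightedGraph (Fin ν)) (K : Links ν m)
    (p : ℝ → ℝ) (Ω : Set ℝ) (x : ℝ) : ℝ :=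
  sInf {t : ℝ | t ∈ Icc (sInf (symbolRange G K p Ω)) (sSup (symbolRange G K p Ω)) ∧
    x ≤ distribution G K p Ω t}

end DiamondToeplitz

/-! Let ψ = `topBranch` be the largest eigenvalue of c f(θ) and M its maximum. Since p is constant,
the factor Ω cancels from the distribution φ, which becomes the average over the eigenvalue
functions of the normalized measures of their sublevel sets (`distribution_eq`). The rearrangement
is the generalized inverse of φ with right end value M.

Regularity at 1 is a dichotomy (`rearrangement_regular`). If φ stays below 1 - κ to the left of M,
the rearrangement equals M near 1 (`genInverse_of_gap`). Otherwise two facts about φ just below M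
suffice (`genInverse_of_sqrt_le`). First, φ is differentiable there: the eigenvalue functions
satisfy a polynomial equation in e^{iθ} and the value, and apart from finitely many levels the zeros
in e^{iθ} may be taken simple. Each level set is then finite modulo the period, with differentiable
local inverses (`exists_finite_differentiableAt_volume_branch`). Second, φ increases at least as
fast as -K √(M - t): the square root of M - ψ is Lipschitz, by Landau's inequality applied to
Rayleigh quotients (`exists_lipschitz_sqrt_sub_topBranch`), and a Lipschitz function needs room to
run through its values (`sqrt_sub_sqrt_le_volume`). Hence φ' ≥ K / (2 √(M - t)), so the derivative
of the inverse at x is at most 2 (1 - x) / K², and M minus the inverse is at most ((1 - x) / K)².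

For the eigenvalues, M bounds the spectrum from above, because the adjacency matrix is a finite
section of a block Toeplitz operator with symbol c f ≤ M (`toeplitz_form_nonneg`,
`quadForm_gridGraph_le`). From below, Ω contains an interval, which has room for two tent-shaped
wave packets of width of order n, separated by more than the bandwidth. Their Rayleigh quotients are
at least M - O(n⁻²) (`exists_test_vector`), so by min-max both top eigenvalues lie within O(n⁻²) of
M (`exists_gap_le`). As N_n ≤ ν n, the scaled gap is O(1/n). -/

namespace DiamondToeplitz

/-! ### Min-max and Weyl monotonicity for symmetric operators. -/

section MinMax

variable {𝕜 E : Type*} [RCLike 𝕜] [NormedAddCommGroup E] [InnerProductSpace 𝕜 E]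
  [FiniteDimensional 𝕜 E]

/-- The quadratic form of a symmetric operator in an orthonormal basis of eigenvectors. -/
theorem re_inner_apply_self_eq_sum {n : ℕ} (hn : Module.finrank 𝕜 E = n) {T : E →ₗ[𝕜] E}
    (hT : T.IsSymmetric) (x : E) :
    RCLike.re (inner 𝕜 x (T x)) =
      ∑ i, hT.eigenvalues hn i * ‖inner 𝕜 (hT.eigenvectorBasis hn i) x‖ ^ 2 := by
  rw [← (hT.eigenvectorBasis hn).sum_inner_mul_inner x (T x), map_sum]
  refine Finset.sum_congr rfl fun i _ => ?_
  rw [← hT, hT.apply_eigenvectorBasis, inner_smul_left, ← inner_conj_symm x]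
  rw [RCLike.conj_ofReal, mul_left_comm, RCLike.conj_mul]
  rw [← RCLike.ofReal_pow, ← RCLike.ofReal_mul, RCLike.ofReal_re]

/-- One half of the min-max principle: a lower bound for the quadratic form on a space of dimension
greater than `j` is a lower bound for the `j`-th largest eigenvalue. -/
theorem le_eigenvalues_of_le_on_range {F : Type*} [AddCommGroup F] [Module 𝕜 F]
    [FiniteDimensional 𝕜 F] {n : ℕ} (hn : Module.finrank 𝕜 E = n) {T : E →ₗ[𝕜] E}
    (hT : T.IsSymmetric) (j : Fin n) (l : F →ₗ[𝕜] E) (hl : Function.Injective l)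
    (hF : (j : ℕ) < Module.finrank 𝕜 F) (a : ℝ)
    (h : ∀ y, a * ‖l y‖ ^ 2 ≤ RCLike.re (inner 𝕜 (l y) (T (l y)))) :
    a ≤ hT.eigenvalues hn j := by
  -- Orthogonality to the first `j` eigenvectors imposes only `j` conditions, so some nonzero vector
  -- of the range sees only the eigenvalues from position `j` on; these are at most the `j`-th, the
  -- list being non-increasing.
  let g : F →ₗ[𝕜] (Fin j → 𝕜) := LinearMap.pi fun i : Fin j =>
    (innerₛₗ 𝕜 (hT.eigenvectorBasis hn ⟨i, i.2.trans j.2⟩)).comp l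
  have hg : LinearMap.ker g ≠ ⊥ := LinearMap.ker_ne_bot_of_finrank_lt (by simpa using hF)
  obtain ⟨y, hy, hy0⟩ := (Submodule.ne_bot_iff _).1 hg
  have hx0 : l y ≠ 0 := fun h0 => hy0 (hl (by rw [h0, map_zero]))
  have hz : ∀ i : Fin n, i < j → inner 𝕜 (hT.eigenvectorBasis hn i) (l y) = 0 := by
    intro i hi
    have := congrFun (LinearMap.mem_ker.1 hy) ⟨i, hi⟩
    simpa [g] using this
  have h1 := h y
  rw [re_inner_apply_self_eq_sum hn hT] at h1
  have h2 : ∑ i, hT.eigenvalues hn i * ‖inner 𝕜 (hT.eigenvectorBasis hn i) (l y)‖ ^ 2 ≤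
      ∑ i, hT.eigenvalues hn j * ‖inner 𝕜 (hT.eigenvectorBasis hn i) (l y)‖ ^ 2 := by
    refine Finset.sum_le_sum fun i _ => ?_
    rcases lt_or_ge i j with hij | hij
    · simp [hz i hij]
    · exact mul_le_mul_of_nonneg_right (hT.eigenvalues_antitone hn hij) (by positivity)
  rw [← Finset.mul_sum, OrthonormalBasis.sum_sq_norm_inner_right] at h2
  have h3 : 0 < ‖l y‖ ^ 2 := by positivity
  exact le_of_mul_le_mul_right (h1.trans h2) h3

/-- Weyl's monotonicity principle. -/
theorem eigenvalues_le_add_of_form_le {n : ℕ} (hn : Module.finrank 𝕜 E = n) {T T' : E →ₗ[𝕜] E}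
    (hT : T.IsSymmetric) (hT' : T'.IsSymmetric) (ε : ℝ)
    (h : ∀ x, RCLike.re (inner 𝕜 x (T x)) ≤ RCLike.re (inner 𝕜 x (T' x)) + ε * ‖x‖ ^ 2)
    (j : Fin n) : hT.eigenvalues hn j ≤ hT'.eigenvalues hn j + ε := by
  set b := hT.eigenvectorBasis hn
  -- On the span of the first `j + 1` eigenvectors of `T` the form of `T` is at least its `j`-th
  -- eigenvalue, hence the form of `T'` is at least that minus `ε`.
  let e : Fin ((j : ℕ) + 1) → Fin n := fun i => ⟨i, by omega⟩
  have he : Function.Injective e := fun i i' hi => Fin.ext (by simpa [e] using hi)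
  have hli : LinearIndependent 𝕜 (fun i => b (e i)) :=
    (b.orthonormal.comp e he).linearIndependent
  let l : (Fin ((j : ℕ) + 1) → 𝕜) →ₗ[𝕜] E := Fintype.linearCombination 𝕜 (fun i => b (e i))
  have hl : Function.Injective l := by
    exact hli.fintypeLinearCombination_injective
  have := le_eigenvalues_of_le_on_range hn hT' j l hl (by simp) (hT.eigenvalues hn j - ε) ?_
  · linarith
  intro y
  have h1 := h (l y)
  have h2 : hT.eigenvalues hn j * ‖l y‖ ^ 2 ≤ RCLike.re (inner 𝕜 (l y) (T (l y))) := by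
    rw [re_inner_apply_self_eq_sum hn hT, ← b.sum_sq_norm_inner_right, Finset.mul_sum]
    refine Finset.sum_le_sum fun i _ => ?_
    rcases le_or_gt i j with hij | hij
    · exact mul_le_mul_of_nonneg_right (hT.eigenvalues_antitone hn hij) (by positivity)
    · have : inner 𝕜 (b i) (l y) = 0 := by
        simp only [l, Fintype.linearCombination_apply, inner_sum, inner_smul_right]
        refine Finset.sum_eq_zero fun k _ => ?_
        rw [b.inner_eq_zero (i := i) (j := e k) ?_, mul_zero]
        rintro rfl
        have := k.2
        simp only [e, Fin.lt_def] at hij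
        omega
      simp [b, this]
  linarith

end MinMax

/-! ### Quadratic forms of Hermitian matrices. -/

section Matrix

variable {𝕜 V : Type} [RCLike 𝕜] [Fintype V] [DecidableEq V]

/-- The quadratic form of a Hermitian matrix. -/
noncomputable def quadForm (A : Matrix V V 𝕜) (x : V → 𝕜) : ℝ :=
  RCLike.re (star x ⬝ᵥ A.mulVec x)

/-- The square of the Euclidean norm. -/
noncomputable def normSq (x : V → 𝕜) : ℝ := ∑ i, ‖x i‖ ^ 2

theorem normSq_eq_norm_sq (x : EuclideanSpace 𝕜 V) : normSq x.ofLp = ‖x‖ ^ 2 := by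
  rw [EuclideanSpace.norm_sq_eq]; rfl

theorem quadForm_eq_inner (A : Matrix V V 𝕜) (x : EuclideanSpace 𝕜 V) :
    quadForm A x.ofLp = RCLike.re (inner 𝕜 x (Matrix.toEuclideanLin A x)) := by
  rw [EuclideanSpace.inner_eq_star_dotProduct, dotProduct_comm]
  rfl

theorem le_eigenvalues₀_of_le_on_range {A : Matrix V V 𝕜} (hA : A.IsHermitian)
    {F : Type*} [AddCommGroup F] [Module 𝕜 F] [FiniteDimensional 𝕜 F]
    (j : Fin (Fintype.card V)) (l : F →ₗ[𝕜] V → 𝕜) (hl : Function.Injective l)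
    (hF : (j : ℕ) < Module.finrank 𝕜 F) (a : ℝ)
    (h : ∀ y, a * normSq (l y) ≤ quadForm A (l y)) : a ≤ hA.eigenvalues₀ j := by
  refine le_eigenvalues_of_le_on_range finrank_euclideanSpace
    (Matrix.isSymmetric_toEuclideanLin_iff.mpr hA) j
    ((WithLp.linearEquiv 2 𝕜 (V → 𝕜)).symm.toLinearMap.comp l)
    (by simpa using hl) hF a fun y => ?_
  rw [← normSq_eq_norm_sq, ← quadForm_eq_inner]
  exact h y

theorem eigenvalues₀_le_add_of_quadForm_le {A B : Matrix V V 𝕜} (hA : A.IsHermitian)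
    (hB : B.IsHermitian) (ε : ℝ) (h : ∀ x, quadForm A x ≤ quadForm B x + ε * normSq x)
    (j : Fin (Fintype.card V)) : hA.eigenvalues₀ j ≤ hB.eigenvalues₀ j + ε := by
  refine eigenvalues_le_add_of_form_le finrank_euclideanSpace
    (Matrix.isSymmetric_toEuclideanLin_iff.mpr hA)
    (Matrix.isSymmetric_toEuclideanLin_iff.mpr hB) ε (fun x => ?_) j
  rw [← normSq_eq_norm_sq, ← quadForm_eq_inner, ← quadForm_eq_inner]
  exact h _

/-- The spectral expansion of the quadratic form. -/
theorem exists_quadForm_eq_sum {A : Matrix V V 𝕜} (hA : A.IsHermitian) (x : V → 𝕜) :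
    ∃ w : Fin (Fintype.card V) → ℝ, (∀ i, 0 ≤ w i) ∧ ∑ i, w i = normSq x ∧
      quadForm A x = ∑ i, hA.eigenvalues₀ i * w i := by
  have hT := Matrix.isSymmetric_toEuclideanLin_iff.mpr hA
  refine ⟨fun i => ‖inner 𝕜 (hT.eigenvectorBasis finrank_euclideanSpace i)
    (WithLp.toLp 2 x)‖ ^ 2, fun i => by positivity, ?_, ?_⟩
  · rw [OrthonormalBasis.sum_sq_norm_inner_right, ← normSq_eq_norm_sq]
  · have := re_inner_apply_self_eq_sum finrank_euclideanSpace hT (WithLp.toLp 2 x)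
    rw [← quadForm_eq_inner] at this
    exact this

theorem exists_unit_mulVec_eq {A : Matrix V V 𝕜} (hA : A.IsHermitian)
    (j : Fin (Fintype.card V)) :
    ∃ x : V → 𝕜, normSq x = 1 ∧ A.mulVec x = ((hA.eigenvalues₀ j : ℝ) : 𝕜) • x := by
  have hT := Matrix.isSymmetric_toEuclideanLin_iff.mpr hA
  refine ⟨(hT.eigenvectorBasis finrank_euclideanSpace j).ofLp, ?_, ?_⟩
  · rw [normSq_eq_norm_sq]; simp
  · have := hT.apply_eigenvectorBasis finrank_euclideanSpace j
    exact congrArg WithLp.ofLp this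

theorem quadForm_of_mulVec_eq {A : Matrix V V 𝕜} {x : V → 𝕜} {μ : ℝ} (hx : normSq x = 1)
    (h : A.mulVec x = (μ : 𝕜) • x) : quadForm A x = μ := by
  rw [quadForm, h, dotProduct_smul, smul_eq_mul, RCLike.re_ofReal_mul]
  have : star x ⬝ᵥ x = ((normSq x : ℝ) : 𝕜) := by
    simp [dotProduct, normSq, RCLike.conj_mul]
  rw [this, hx]; simp

end Matrix

/-! ### Separable replacement of a polynomial in two variables. -/

open Polynomial in
/-- A polynomial over the fraction field has a common denominator. -/
theorem exists_clear_denominators (p : (FractionRing ℂ[X])[X]) :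
    ∃ s : ℂ[X], s ≠ 0 ∧ ∃ P : ℂ[X][X],
      P.map (algebraMap ℂ[X] (FractionRing ℂ[X])) = C (algebraMap ℂ[X] (FractionRing ℂ[X]) s) * p := by
  obtain ⟨s, hs0, hs⟩ := IsLocalization.integerNormalization_spec (nonZeroDivisors ℂ[X]) p
  refine ⟨s, nonZeroDivisors.ne_zero hs0, _, hs.trans ?_⟩
  ext i : 1
  simp [Algebra.smul_def]

open Polynomial in
/-- A bivariate polynomial can be replaced by a separable one with the same zeros, away from
finitely many values of the second variable. -/
theorem exists_separable_bivariate (D : ℂ[X][X]) (hD : D ≠ 0) :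
    ∃ (Q : ℂ[X][X]) (r : ℂ[X]), r ≠ 0 ∧ ∀ t, r.eval t ≠ 0 → ∀ z,
      ((D.map (evalRingHom t)).eval z = 0 → (Q.map (evalRingHom t)).eval z = 0) ∧
      ((Q.map (evalRingHom t)).eval z = 0 →
        (derivative (Q.map (evalRingHom t))).eval z ≠ 0) := by
  classical
  let ι := algebraMap ℂ[X] (FractionRing ℂ[X])
  have hι : Function.Injective ι := IsFractionRing.injective _ _
  have hm : Function.Injective (Polynomial.map ι) := Polynomial.map_injective ι hι
  have hD' : D.map ι ≠ 0 := (Polynomial.map_ne_zero_iff hι).2 hD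
  -- Over the field ℂ(t), the radical is squarefree, hence separable in characteristic zero: it
  -- satisfies a Bézout identity with its derivative, and the original polynomial divides one of its
  -- powers. Both identities survive specialization of t once denominators are cleared.
  let q := UniqueFactorizationMonoid.radical (D.map ι)
  have hq : q.Separable :=
    PerfectField.separable_iff_squarefree.2 UniqueFactorizationMonoid.squarefree_radical
  obtain ⟨a, b, hab⟩ := hq
  obtain ⟨n, e, he⟩ := UniqueFactorizationMonoid.exists_dvd_radical_self_pow hD'
  obtain ⟨sq, hsq, Q, hQ⟩ := exists_clear_denominators q
  obtain ⟨sa, hsa, A, hA⟩ := exists_clear_denominators a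
  obtain ⟨sb, hsb, B, hB⟩ := exists_clear_denominators b
  obtain ⟨se, hse, E, hE⟩ := exists_clear_denominators e
  have h1 : C sb * A * Q + C sa * B * derivative Q = C (sq * sa * sb) := by
    apply hm
    simp only [Polynomial.map_add, Polynomial.map_mul, Polynomial.map_C, ← derivative_map, ι, hQ, hA,
      hB, derivative_mul, derivative_C, map_mul]
    linear_combination (C (ι sq) * C (ι sa) * C (ι sb)) * hab
  have h2 : C se * Q ^ n = C (sq ^ n) * D * E := by
    apply hm
    simp only [Polynomial.map_mul, Polynomial.map_pow, Polynomial.map_C, ι, hQ, hE, map_pow, mul_pow]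
    change q ^ n = D.map ι * e at he
    linear_combination (C (ι se) * C (ι sq) ^ n) * he
  -- Where `sq * sa * sb` does not vanish, `h1` forbids a common zero of `Q` and its derivative;
  -- where `se` does not vanish, `h2` passes the zeros of `D` on to `Q`.
  refine ⟨Q, sq * sa * sb * se, by simp [hsq, hsa, hsb, hse], fun t ht z => ?_⟩
  simp only [eval_mul, mul_ne_zero_iff] at ht
  constructor
  · intro h0
    have := congrArg (fun p => (p.map (evalRingHom t)).eval z) h2
    simp only [Polynomial.map_mul, Polynomial.map_pow, Polynomial.map_C, eval_mul, eval_pow, eval_C,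
      h0, coe_evalRingHom, mul_zero, zero_mul] at this
    exact eq_zero_of_pow_eq_zero ((mul_eq_zero.1 this).resolve_left ht.2)
  · intro h0 h0'
    have := congrArg (fun p => (p.map (evalRingHom t)).eval z) h1
    rw [derivative_map] at h0'
    simp only [Polynomial.map_add, Polynomial.map_mul, Polynomial.map_C, eval_mul, eval_add, eval_C,
      h0, h0', coe_evalRingHom, mul_zero, add_zero] at this
    exact absurd this.symm (by simp [ht])

/-! ### Local inverses of implicitly given functions. -/

/-- If the graph of `f` lies near `(x₀, f x₀)` in the zero set of a function with nonzero derivative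
in the first variable, then `f` is injective near `x₀` and its inverse is differentiable. -/
theorem exists_injOn_isLittleO_of_implicit {f : ℝ → ℝ} (hf : Continuous f) {x₀ : ℝ}
    {F : ℝ × ℝ → ℝ} {F' : ℝ × ℝ →L[ℝ] ℝ} (hF : HasStrictFDerivAt F F' (x₀, f x₀))
    (h1 : F' (1, 0) = 1) (h0 : ∀ᶠ x in 𝓝 x₀, F (x, f x) = 0) :
    ∃ (g : ℝ), (∀ᶠ δ in 𝓝[>] (0 : ℝ), InjOn f (Icc (x₀ - δ) (x₀ + δ))) ∧
      (fun x => x - x₀ - g * (f x - f x₀)) =o[𝓝 x₀] fun x => f x - f x₀ := by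
  set b := F' (0, 1) with hb
  have hF' : ∀ u v : ℝ, F' (u, v) = u + b * v := by
    intro u v
    have : ((u, v) : ℝ × ℝ) = u • (1, 0) + v • (0, 1) := by simp
    rw [this, map_add, map_smul, map_smul, h1, ← hb]
    simp [mul_comm]
  have hgraph : Tendsto (fun x => (x, f x)) (𝓝 x₀) (𝓝 (x₀, f x₀)) :=
    (continuous_id.prodMk hf).tendsto x₀
  -- comparison of two points of the graph
  have hO : ∀ c > 0, ∀ᶠ p : ℝ × ℝ in 𝓝 x₀ ×ˢ 𝓝 x₀,
      |(p.1 - p.2) + b * (f p.1 - f p.2)| ≤ c * (|p.1 - p.2| + |f p.1 - f p.2|) := by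
    intro c hc
    have hlo := hF.isLittleO
    have h2 : Tendsto (fun p : ℝ × ℝ => ((p.1, f p.1), (p.2, f p.2))) (𝓝 x₀ ×ˢ 𝓝 x₀)
        (𝓝 ((x₀, f x₀), (x₀, f x₀))) := by
      rw [nhds_prod_eq (x := ((x₀, f x₀) : ℝ × ℝ))]
      exact (hgraph.comp tendsto_fst).prodMk (hgraph.comp tendsto_snd)
    have h3 := h2.eventually (hlo.def hc)
    -- `F` vanishes at both points of the graph, so strict differentiability bounds the linear part
    -- u + b v alone.
    filter_upwards [h3, tendsto_fst.eventually h0, tendsto_snd.eventually h0] with p h3 h4 h5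
    rw [h4, h5] at h3
    simp only [sub_self, zero_sub, norm_neg, Prod.mk_sub_mk, hF', Real.norm_eq_abs] at h3
    refine h3.trans (mul_le_mul_of_nonneg_left ?_ hc.le)
    rw [Prod.norm_mk]
    exact max_le (by simp) (by simp)
  have hinj : ∀ᶠ p : ℝ × ℝ in 𝓝 x₀ ×ˢ 𝓝 x₀, f p.1 = f p.2 → p.1 = p.2 := by
    filter_upwards [hO (1 / 2) (by norm_num)] with p hp heq
    rw [heq] at hp
    simp only [sub_self, mul_zero, add_zero, abs_zero] at hp
    have : |p.1 - p.2| ≤ 0 := by linarith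
    exact sub_eq_zero.1 (abs_nonpos_iff.1 this)
  -- The inverse has slope `-b`. It may be zero, and then `f` itself is not differentiable at `x₀`;
  -- therefore the expansion is measured against `f x - f x₀`.
  refine ⟨-b, ?_, ?_⟩
  · obtain ⟨s, hs, hs'⟩ := Filter.eventually_prod_self_iff (r := fun x y => f x = f y → x = y).1 hinj
    obtain ⟨ε, hε, hball⟩ := Metric.eventually_nhds_iff.1 hs
    filter_upwards [Ioo_mem_nhdsGT hε] with δ hδ x hx y hy hxy
    refine hs' x (hball ?_) y (hball ?_) hxy
    · rw [Real.dist_eq, abs_lt]; constructor <;> linarith [hx.1, hx.2, hδ.2]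
    · rw [Real.dist_eq, abs_lt]; constructor <;> linarith [hy.1, hy.2, hδ.2]
  · have hone : ∀ c > 0, ∀ᶠ x in 𝓝 x₀,
        |(x - x₀) + b * (f x - f x₀)| ≤ c * (|x - x₀| + |f x - f x₀|) := fun c hc =>
      (tendsto_id.prodMk tendsto_const_pure).eventually
        ((hO c hc).filter_mono (Filter.prod_mono le_rfl (pure_le_nhds x₀)))
    refine Asymptotics.IsLittleO.of_bound fun c hc => ?_
    -- The estimate with constant 1/2 absorbs half of |x - x₀|, which leaves |x - x₀| ≤ (2|b| + 1)
    -- |f x - f x₀|; `C` also covers the additional term |f x - f x₀|.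
    set C := 2 * (|b| + 1) + 1 with hC
    have hCpos : 0 < C := by positivity
    filter_upwards [hone (1 / 2) (by norm_num), hone (c / C) (by positivity)] with x h3 h4
    have h5 : |x - x₀| ≤ (C - 1) * |f x - f x₀| := by
      have h6 : |x - x₀| ≤ |(x - x₀) + b * (f x - f x₀)| + |b| * |f x - f x₀| := by
        have := abs_sub ((x - x₀) + b * (f x - f x₀)) (b * (f x - f x₀))
        rwa [add_sub_cancel_right, abs_mul] at this
      rw [hC]
      nlinarith [abs_nonneg (f x - f x₀)]
    rw [Real.norm_eq_abs, Real.norm_eq_abs, neg_mul, sub_neg_eq_add]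
    refine h4.trans ?_
    calc c / C * (|x - x₀| + |f x - f x₀|) ≤ c / C * (C * |f x - f x₀|) := by
          gcongr; linarith
      _ = c * |f x - f x₀| := by field_simp

/-! ### Differentiability of the measure of sublevel sets. -/

/-- Differentiability of the measure of the sublevel sets near a point where the function is
increasing with differentiable inverse. -/
theorem differentiableAt_volume_sublevel_of_strictMonoOn {f : ℝ → ℝ} (hf : Continuous f)
    {x₀ δ g : ℝ} (hδ : 0 < δ) (hmono : StrictMonoOn f (Icc (x₀ - δ) (x₀ + δ)))
    (ho : (fun x => x - x₀ - g * (f x - f x₀)) =o[𝓝 x₀] fun x => f x - f x₀) :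
    DifferentiableAt ℝ (fun t => volume.real (Ioo (x₀ - δ) (x₀ + δ) ∩ {x | f x ≤ t})) (f x₀) := by
  have hlt : ∀ ε, 0 < ε → ε ≤ δ → f (x₀ - ε) < f x₀ ∧ f x₀ < f (x₀ + ε) := fun ε h h' =>
    ⟨hmono ⟨by linarith, by linarith⟩ ⟨by linarith, by linarith⟩ (by linarith),
      hmono ⟨by linarith, by linarith⟩ ⟨by linarith, by linarith⟩ (by linarith)⟩
  -- the local inverse
  have hinv : ∀ t, ∃ x, t ∈ Ioo (f (x₀ - δ)) (f (x₀ + δ)) →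
      x ∈ Ioo (x₀ - δ) (x₀ + δ) ∧ f x = t := by
    intro t
    by_cases ht : t ∈ Ioo (f (x₀ - δ)) (f (x₀ + δ))
    · obtain ⟨x, hx, hxt⟩ := intermediate_value_Ioo (by linarith) hf.continuousOn ht
      exact ⟨x, fun _ => ⟨hx, hxt⟩⟩
    · exact ⟨0, fun h => absurd h ht⟩
  choose τ hτ using hinv
  have hnhds : ∀ᶠ t in 𝓝 (f x₀), t ∈ Ioo (f (x₀ - δ)) (f (x₀ + δ)) :=
    Ioo_mem_nhds (hlt δ hδ le_rfl).1 (hlt δ hδ le_rfl).2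
  have hτ0 : τ (f x₀) = x₀ := by
    have := hτ (f x₀) hnhds.self_of_nhds
    exact hmono.injOn (Ioo_subset_Icc_self this.1) ⟨by linarith, by linarith⟩ this.2
  have hτt : Tendsto τ (𝓝 (f x₀)) (𝓝 x₀) := by
    rw [Metric.tendsto_nhds]
    intro ε hε
    have hm : 0 < min ε δ := lt_min hε hδ
    have h := hlt (min ε δ) hm (min_le_right _ _)
    filter_upwards [hnhds, Ioo_mem_nhds h.1 h.2] with t ht ht'
    obtain ⟨h1, h2⟩ := hτ t ht
    have h3 := min_le_left ε δ
    have h4 := min_le_right ε δ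
    rw [Real.dist_eq, abs_lt]
    have hI := Ioo_subset_Icc_self h1
    constructor
    · have := (hmono.lt_iff_lt (a := x₀ - min ε δ) ⟨by linarith, by linarith⟩ hI).1
        (by rw [h2]; exact ht'.1)
      linarith
    · have := (hmono.lt_iff_lt (b := x₀ + min ε δ) hI ⟨by linarith, by linarith⟩).1
        (by rw [h2]; exact ht'.2)
      linarith
  have hval : ∀ᶠ t in 𝓝 (f x₀),
      volume.real (Ioo (x₀ - δ) (x₀ + δ) ∩ {x | f x ≤ t}) = τ t - (x₀ - δ) := by
    filter_upwards [hnhds] with t ht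
    obtain ⟨h1, h2⟩ := hτ t ht
    have : Ioo (x₀ - δ) (x₀ + δ) ∩ {x | f x ≤ t} = Ioc (x₀ - δ) (τ t) := by
      ext x
      constructor
      · rintro ⟨hx, hxt⟩
        refine ⟨hx.1, ?_⟩
        rw [mem_ofPred_eq, ← h2] at hxt
        exact (hmono.le_iff_le (Ioo_subset_Icc_self hx) (Ioo_subset_Icc_self h1)).1 hxt
      · rintro ⟨hx, hxt⟩
        have hx' : x ∈ Ioo (x₀ - δ) (x₀ + δ) := ⟨hx, hxt.trans_lt h1.2⟩
        refine ⟨hx', ?_⟩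
        rw [mem_ofPred_eq, ← h2]
        exact (hmono.le_iff_le (Ioo_subset_Icc_self hx') (Ioo_subset_Icc_self h1)).2 hxt
    rw [this, Real.volume_real_Ioc_of_le h1.1.le]
  have hd : HasDerivAt τ g (f x₀) := by
    rw [hasDerivAt_iff_isLittleO, hτ0]
    refine (ho.comp_tendsto hτt).congr' ?_ ?_
    · filter_upwards [hnhds] with t ht
      simp [(hτ t ht).2, mul_comm]
    · filter_upwards [hnhds] with t ht
      simp [(hτ t ht).2]
  exact ((hd.sub_const (x₀ - δ)).congr_of_eventuallyEq hval).differentiableAt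

/-- Continuity and injectivity on an interval give strict monotonicity. The decreasing case is
carried to the increasing one by the reflection in `x₀`, which preserves volume and changes the sign
of `g`. -/
theorem differentiableAt_volume_sublevel_of_injOn {f : ℝ → ℝ} (hf : Continuous f)
    {x₀ δ g : ℝ} (hδ : 0 < δ) (hinj : InjOn f (Icc (x₀ - δ) (x₀ + δ)))
    (ho : (fun x => x - x₀ - g * (f x - f x₀)) =o[𝓝 x₀] fun x => f x - f x₀) :
    DifferentiableAt ℝ (fun t => volume.real (Ioo (x₀ - δ) (x₀ + δ) ∩ {x | f x ≤ t})) (f x₀) := by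
  rcases hf.continuousOn.strictMonoOn_of_injOn_Icc' (by linarith) hinj with h | h
  · exact differentiableAt_volume_sublevel_of_strictMonoOn hf hδ h ho
  · let r : ℝ → ℝ := fun x => 2 * x₀ - x
    have hr : Continuous r := by fun_prop
    have hr0 : r x₀ = x₀ := by simp only [r]; ring
    have hrt : Tendsto r (𝓝 x₀) (𝓝 x₀) := by simpa [hr0] using hr.tendsto x₀
    have hmono : StrictMonoOn (f ∘ r) (Icc (x₀ - δ) (x₀ + δ)) := by
      intro x hx y hy hxy
      refine h ?_ ?_ ?_
      · constructor <;> simp only [r] <;> linarith [hy.1, hy.2]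
      · constructor <;> simp only [r] <;> linarith [hx.1, hx.2]
      · simp only [r]; linarith
    have := differentiableAt_volume_sublevel_of_strictMonoOn (hf.comp hr) (g := -g) hδ hmono ?_
    · rw [Function.comp_apply, hr0] at this
      refine this.congr_of_eventuallyEq (Eventually.of_forall fun t => ?_)
      have hmp : MeasurePreserving r volume volume := Measure.measurePreserving_sub_left volume _
      have hms : MeasurableSet (Ioo (x₀ - δ) (x₀ + δ) ∩ {x | f x ≤ t}) :=
        measurableSet_Ioo.inter (measurableSet_le hf.measurable measurable_const)
      simp only [measureReal_def]
      rw [← hmp.measure_preimage hms.nullMeasurableSet]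
      congr 2
      ext x
      simp only [r, mem_preimage, mem_inter_iff, mem_Ioo, mem_ofPred_eq, Function.comp_apply]
      constructor <;> rintro ⟨⟨h1, h2⟩, h3⟩ <;> exact ⟨⟨by linarith, by linarith⟩, h3⟩
    · have h2 := (ho.comp_tendsto hrt).neg_left
      refine h2.congr ?_ ?_
      · intro x
        simp only [Function.comp_apply, hr0, r]; ring
      · intro x
        simp only [Function.comp_apply, hr0]

/-- Up to an endpoint both intervals are fundamental domains of the translations by `T`, under which
the sublevel set is invariant. The window can thus be moved so that its ends avoid a given level
set. -/
theorem volume_sublevel_inter_Icc_eq {f : ℝ → ℝ} (hf : Continuous f) {T : ℝ} (hT : 0 < T)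
    (hper : Function.Periodic f T) (a b t : ℝ) :
    volume.real (Icc a (a + T) ∩ {x | f x ≤ t}) = volume.real (Icc b (b + T) ∩ {x | f x ≤ t}) := by
  have hms : MeasurableSet {x | f x ≤ t} := measurableSet_le hf.measurable measurable_const
  have h1 : ∀ a, volume (Icc a (a + T) ∩ {x | f x ≤ t}) =
      volume ({x | f x ≤ t} ∩ Ioc a (a + T)) := fun a => by
    rw [inter_comm]
    exact measure_congr (EventuallyEq.inter (ae_eq_refl _) Ioc_ae_eq_Icc.symm)
  simp only [measureReal_def, h1]
  congr 1
  refine (isAddFundamentalDomain_Ioc hT a).measure_set_eq (isAddFundamentalDomain_Ioc hT b) hms ?_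
  rintro ⟨g, hg⟩
  obtain ⟨k, rfl⟩ := AddSubgroup.mem_zmultiples_iff.1 hg
  ext x
  have := hper.zsmul k x
  simp only [mem_preimage, mem_ofPred_eq, AddSubgroup.vadd_def, vadd_eq_add]
  rw [add_comm, this]

/-- If every point of a level set of a continuous periodic function has a neighbourhood on which the
function is injective with differentiable inverse, then the measure of the sublevel sets is
differentiable at this level. -/
theorem differentiableAt_volume_sublevel {f : ℝ → ℝ} (hf : Continuous f) {T : ℝ} (hT : 0 < T)
    (hper : Function.Periodic f T) (c t₀ : ℝ)
    (hloc : ∀ x₀, f x₀ = t₀ → ∃ (g : ℝ),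
      (∀ᶠ δ in 𝓝[>] (0 : ℝ), InjOn f (Icc (x₀ - δ) (x₀ + δ))) ∧
      (fun x => x - x₀ - g * (f x - f x₀)) =o[𝓝 x₀] fun x => f x - f x₀) :
    DifferentiableAt ℝ (fun t => volume.real (Icc c (c + T) ∩ {x | f x ≤ t})) t₀ := by
  have hiso : ∀ x₀, f x₀ = t₀ → ∀ᶠ x in 𝓝[≠] x₀, f x ≠ t₀ := by
    intro x₀ hx₀
    obtain ⟨g, hg, -⟩ := hloc x₀ hx₀
    obtain ⟨δ, hδ, hδ0⟩ := (hg.and self_mem_nhdsWithin).exists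
    rw [eventually_nhdsWithin_iff]
    filter_upwards [Icc_mem_nhds (show x₀ - δ < x₀ by linarith) (show x₀ < x₀ + δ by linarith)]
      with x hx hne heq
    exact hne (hδ hx ⟨by linarith, by linarith⟩ (heq.trans hx₀.symm))
  -- a base point off the level set
  obtain ⟨a, ha⟩ : ∃ a, f a ≠ t₀ := by
    by_contra! hall
    obtain ⟨x, hx⟩ := (hiso 0 (hall 0)).exists
    exact hx (hall x)
  have haT : f (a + T) ≠ t₀ := by rwa [hper]
  simp_rw [volume_sublevel_inter_Icc_eq hf hT hper c a]
  set Z := Icc a (a + T) ∩ {x | f x = t₀} with hZ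
  -- Local injectivity isolates the points of the level set, and compactness leaves only finitely
  -- many of them in one period.
  have hZfin : Z.Finite := by
    have hcomp : IsCompact Z := isCompact_Icc.inter_right (isClosed_eq hf continuous_const)
    by_contra hinf
    obtain ⟨x, hx, hacc⟩ := Set.Infinite.exists_accPt_of_subset_isCompact hinf hcomp Subset.rfl
    rw [accPt_iff_frequently_nhdsNE] at hacc
    obtain ⟨y, hy, hy'⟩ := (hacc.and_eventually (hiso x hx.2)).exists
    exact hy' hy.2
  set S := hZfin.toFinset with hS
  have hSmem : ∀ z ∈ S, z ∈ Ioo a (a + T) ∧ f z = t₀ := by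
    intro z hz
    rw [hS, hZfin.mem_toFinset] at hz
    obtain ⟨⟨h1, h2⟩, h3⟩ := hz
    have h3 : f z = t₀ := h3
    exact ⟨⟨lt_of_le_of_ne h1 (by rintro rfl; exact ha h3),
      lt_of_le_of_ne h2 (by rintro rfl; exact haT h3)⟩, h3⟩
  have hsmall : ∀ ε : ℝ, 0 < ε → ∀ᶠ δ in 𝓝[>] (0 : ℝ), δ < ε := fun ε hε => by
    filter_upwards [Ioo_mem_nhdsGT hε] with δ hδ using hδ.2
  obtain ⟨δ, ⟨⟨⟨hδ1, hδ2⟩, hδ3⟩, hδ0⟩⟩ : ∃ δ : ℝ,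
      (((∀ z ∈ S, DifferentiableAt ℝ
          (fun t => volume.real (Ioo (z - δ) (z + δ) ∩ {x | f x ≤ t})) t₀) ∧
        (∀ z ∈ S, ∀ w ∈ S, z ≠ w → Disjoint (Ioo (z - δ) (z + δ)) (Ioo (w - δ) (w + δ)))) ∧
        (∀ z ∈ S, Ioo (z - δ) (z + δ) ⊆ Icc a (a + T))) ∧ 0 < δ := by
    refine Filter.Eventually.exists (f := 𝓝[>] (0 : ℝ)) (((Filter.Eventually.and ?_ ?_).and ?_).and
      self_mem_nhdsWithin)
    · rw [Filter.eventually_all_finset]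
      intro z hz
      obtain ⟨g, hg, ho⟩ := hloc z (hSmem z hz).2
      filter_upwards [hg, self_mem_nhdsWithin] with δ hδ hδ0
      have := differentiableAt_volume_sublevel_of_injOn hf hδ0 hδ ho
      rwa [(hSmem z hz).2] at this
    · rw [Filter.eventually_all_finset]
      intro z hz
      rw [Filter.eventually_all_finset]
      intro w hw
      by_cases hzw : z = w
      · simp [hzw]
      filter_upwards [hsmall (|z - w| / 2) (by have := sub_ne_zero.2 hzw; positivity)] with δ hδ _
      rw [Set.disjoint_left]
      rintro x ⟨h1, h2⟩ ⟨h3, h4⟩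
      have : |z - w| < 2 * δ := by rw [abs_lt]; constructor <;> linarith
      linarith
    · rw [Filter.eventually_all_finset]
      intro z hz
      obtain ⟨⟨h1, h2⟩, -⟩ := hSmem z hz
      filter_upwards [hsmall _ (sub_pos.2 h1), hsmall _ (sub_pos.2 h2)] with δ h3 h4 x hx
      exact ⟨by linarith [hx.1], by linarith [hx.2]⟩
  -- Off `U` the function keeps a positive distance from `t₀` by compactness, so for `t` near `t₀`
  -- that part of the sublevel set does not change; all variation comes from the finitely many
  -- disjoint intervals.
  set U := ⋃ z ∈ S, Ioo (z - δ) (z + δ) with hU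
  set C := Icc a (a + T) \ U with hC
  have hCcomp : IsCompact C :=
    isCompact_Icc.diff (isOpen_biUnion fun _ _ => isOpen_Ioo)
  have hCne : t₀ ∉ f '' C := by
    rintro ⟨x, ⟨hx, hxU⟩, hxt⟩
    refine hxU (mem_biUnion (x := x) ?_ ⟨by linarith, by linarith⟩)
    simp only [hS, Finset.mem_coe, hZfin.mem_toFinset]
    exact ⟨hx, hxt⟩
  obtain ⟨η, hη, hball⟩ := Metric.mem_nhds_iff.1
    ((hCcomp.image hf).isClosed.isOpen_compl.mem_nhds hCne)
  have hconst : ∀ᶠ t in 𝓝 t₀, C ∩ {x | f x ≤ t} = C ∩ {x | f x ≤ t₀} := by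
    filter_upwards [Metric.ball_mem_nhds t₀ hη] with t ht
    rw [Metric.mem_ball, Real.dist_eq, abs_lt] at ht
    ext x
    refine and_congr_right fun hx => ?_
    have hxb : f x ∉ Metric.ball t₀ η := fun h => hball h (mem_image_of_mem f hx)
    rw [Metric.mem_ball, Real.dist_eq, abs_lt, not_and_or] at hxb
    simp only [mem_ofPred_eq]
    constructor <;> intro h <;> rcases hxb with hb | hb <;> linarith
  have hsplit : ∀ t, volume.real (Icc a (a + T) ∩ {x | f x ≤ t}) =
      volume.real (C ∩ {x | f x ≤ t}) +
        ∑ z ∈ S, volume.real (Ioo (z - δ) (z + δ) ∩ {x | f x ≤ t}) := by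
    intro t
    have hms : MeasurableSet {x | f x ≤ t} := measurableSet_le hf.measurable measurable_const
    have hsub : U ⊆ Icc a (a + T) := iUnion₂_subset hδ3
    have hfinC : volume (C ∩ {x | f x ≤ t}) ≠ ⊤ :=
      measure_ne_top_of_subset (inter_subset_left.trans sdiff_subset) (by simp)
    have hfinU : volume (U ∩ {x | f x ≤ t}) ≠ ⊤ :=
      measure_ne_top_of_subset (inter_subset_left.trans hsub) (by simp)
    have hUms : MeasurableSet U := S.measurableSet_biUnion fun _ _ => measurableSet_Ioo
    have h1 : Icc a (a + T) ∩ {x | f x ≤ t} = (C ∩ {x | f x ≤ t}) ∪ (U ∩ {x | f x ≤ t}) := by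
      rw [← union_inter_distrib_right, hC, sdiff_union_of_subset hsub]
    rw [h1, measureReal_union ((disjoint_sdiff_left (s := U) (t := Icc a (a + T))).mono
      inter_subset_left inter_subset_left) (hUms.inter hms) hfinC hfinU]
    congr 1
    rw [hU, iUnion₂_inter]
    refine measureReal_biUnion_finset ?_ (fun z _ => measurableSet_Ioo.inter hms) ?_
    · intro z hz w hw hzw
      exact (hδ2 z hz w hw hzw).mono inter_subset_left inter_subset_left
    · exact fun z _ => measure_ne_top_of_subset inter_subset_left (by simp)
  have hdC : DifferentiableAt ℝ (fun t => volume.real (C ∩ {x | f x ≤ t})) t₀ :=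
    (differentiableAt_const (volume.real (C ∩ {x | f x ≤ t₀}))).congr_of_eventuallyEq
      (hconst.mono fun t ht => by simp only [ht])
  simp_rw [hsplit]
  exact hdC.add (DifferentiableAt.fun_sum hδ1)

/-! ### Graphs inside the zero set of a polynomial in e^{ix} and the value. -/

open Polynomial in
theorem contDiff_eval_exp (Q : ℂ[X][X]) :
    ContDiff ℝ 1 (fun p : ℝ × ℝ => (Q.map (evalRingHom (p.2 : ℂ))).eval
      (Complex.exp (p.1 * Complex.I))) := by
  induction Q using Polynomial.induction_on' with
  | add p q hp hq => simpa using hp.add hq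
  | monomial n a =>
    have ha : ContDiff ℂ 1 fun x : ℂ => a.eval x := by
      simpa using a.contDiff_aeval (𝕜 := ℂ) 1
    have h1 : ContDiff ℝ 1 fun p : ℝ × ℝ => a.eval (p.2 : ℂ) :=
      (ha.restrict_scalars ℝ).comp (Complex.ofRealCLM.contDiff.comp contDiff_snd)
    have h2 : ContDiff ℝ 1 fun p : ℝ × ℝ => Complex.exp (p.1 * Complex.I) :=
      ((Complex.ofRealCLM.contDiff.comp contDiff_fst).mul contDiff_const).cexp
    simpa [Polynomial.map_monomial, eval_monomial] using h1.mul (h2.pow n)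

open Polynomial in
/-- A continuous function whose graph lies in the zero set of a bivariate polynomial in `e^{ix}` and
the value, at a simple zero in the first variable, has a differentiable local inverse. -/
theorem exists_injOn_isLittleO_of_polynomial {f : ℝ → ℝ} (hf : Continuous f) {x₀ : ℝ} (Q : ℂ[X][X])
    (h0 : ∀ᶠ x in 𝓝 x₀, (Q.map (evalRingHom (f x : ℂ))).eval (Complex.exp (x * Complex.I)) = 0)
    (h1 : (derivative (Q.map (evalRingHom (f x₀ : ℂ)))).eval (Complex.exp (x₀ * Complex.I)) ≠ 0) :
    ∃ (g : ℝ), (∀ᶠ δ in 𝓝[>] (0 : ℝ), InjOn f (Icc (x₀ - δ) (x₀ + δ))) ∧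
      (fun x => x - x₀ - g * (f x - f x₀)) =o[𝓝 x₀] fun x => f x - f x₀ := by
  set H : ℝ × ℝ → ℂ := fun p => (Q.map (evalRingHom (p.2 : ℂ))).eval (Complex.exp (p.1 * Complex.I))
    with hH
  obtain ⟨H', hH'⟩ : ∃ H', HasStrictFDerivAt H H' (x₀, f x₀) :=
    ⟨_, (contDiff_eval_exp Q).contDiffAt.hasStrictFDerivAt one_ne_zero⟩
  set w := H' (1, 0) with hw
  -- By the chain rule `w` is the derivative of the polynomial at z = e^{i x₀}, times i z.
  have hw0 : w ≠ 0 := by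
    have e1 : HasDerivAt (fun x : ℝ => H (x, f x₀)) w x₀ := by
      have := hH'.hasFDerivAt.comp_hasDerivAt x₀
        ((hasDerivAt_id x₀).prodMk (hasDerivAt_const x₀ (f x₀)))
      exact this
    have e2 : HasDerivAt (fun x : ℝ => Complex.exp (x * Complex.I))
        (Complex.exp (x₀ * Complex.I) * Complex.I) x₀ := by
      have := ((Complex.ofRealCLM.hasDerivAt (x := x₀)).mul_const Complex.I).cexp
      simpa using this
    have e3 : HasDerivAt (fun x : ℝ => H (x, f x₀)) _ x₀ :=
      (Polynomial.hasDerivAt (Q.map (evalRingHom (f x₀ : ℂ))) _).comp x₀ e2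
    rw [e1.unique e3]
    exact mul_ne_zero h1 (mul_ne_zero (Complex.exp_ne_zero _) Complex.I_ne_zero)
  -- Division by `w` makes the derivative in the first variable equal to 1, and passing to the real
  -- part gives one real equation; that the graph satisfies it is all that is needed.
  have hF : HasStrictFDerivAt (fun p => (w⁻¹ * H p).re)
      (Complex.reCLM.comp (w⁻¹ • H')) (x₀, f x₀) :=
    Complex.reCLM.hasStrictFDerivAt.comp (x₀, f x₀) (hH'.const_mul w⁻¹)
  refine exists_injOn_isLittleO_of_implicit hf hF ?_ ?_
  · simp [← hw, hw0]
  · filter_upwards [h0] with x hx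
    simp only [hH, hx, mul_zero, Complex.zero_re]

/-! ### The generalized inverse of a distribution function at 1. -/

/-- The generalized inverse of `φ` with values in `[m, M]`. -/
noncomputable def genInverse (φ : ℝ → ℝ) (m M x : ℝ) : ℝ :=
  sInf {t : ℝ | t ∈ Icc m M ∧ x ≤ φ t}

theorem genInverse_eq {φ : ℝ → ℝ} {m M x t : ℝ} (ht : t ∈ Icc m M) (hx : x ≤ φ t)
    (hlt : ∀ s < t, φ s < x) : genInverse φ m M x = t := by
  refine IsLeast.csInf_eq ⟨⟨ht, hx⟩, ?_⟩
  rintro s ⟨-, hs⟩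
  by_contra! h
  exact absurd hs (not_le.2 (hlt s h))

/-- Regularity of the generalized inverse at `1` if the distribution has an atom at `M`. -/
theorem genInverse_of_gap {φ : ℝ → ℝ} {m M κ : ℝ} (hmM : m ≤ M) (hM : φ M = 1) (hκ : 0 < κ)
    (hgap : ∀ t < M, φ t ≤ 1 - κ) :
    DifferentiableWithinAt ℝ (genInverse φ m M) (Icc 0 1) 1 ∧
      (∀ᶠ x in 𝓝[<] (1 : ℝ), DifferentiableAt ℝ (genInverse φ m M) x) ∧
      Tendsto (deriv (genInverse φ m M)) (𝓝[<] 1) (𝓝 0) := by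
  have hconst : ∀ x ∈ Ioc (1 - κ) 1, genInverse φ m M x = M := fun x hx =>
    genInverse_eq ⟨hmM, le_rfl⟩ (hM ▸ hx.2) fun s hs => (hgap s hs).trans_lt hx.1
  have hnear : ∀ᶠ x in 𝓝[<] (1 : ℝ), genInverse φ m M =ᶠ[𝓝 x] fun _ => M := by
    filter_upwards [Ioo_mem_nhdsLT (show 1 - κ < 1 by linarith)] with x hx
    filter_upwards [Ioo_mem_nhds hx.1 hx.2] with y hy using hconst y (Ioo_subset_Ioc_self hy)
  refine ⟨?_, ?_, ?_⟩
  · refine (differentiableWithinAt_const M).congr_of_eventuallyEq ?_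
      (hconst 1 ⟨by linarith, le_rfl⟩)
    filter_upwards [mem_nhdsWithin_of_mem_nhds (Ioi_mem_nhds (show 1 - κ < 1 by linarith)),
      self_mem_nhdsWithin] with x h1 h2 using hconst x ⟨h1, h2.2⟩
  · filter_upwards [hnear] with x hx using (differentiableAt_const M).congr_of_eventuallyEq hx
  · refine tendsto_const_nhds.congr' ?_
    filter_upwards [hnear] with x hx
    rw [hx.deriv_eq, deriv_const]

/-- Regularity of the generalized inverse at `1` if near `M` the distribution is differentiable and
increases at least as fast as a square root. -/
theorem genInverse_of_sqrt_le {φ : ℝ → ℝ} {m M ε K : ℝ} (hmono : Monotone φ)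
    (hM : φ M = 1) (hK : 0 < K) (hε : 0 < ε) (hεm : m ≤ M - ε)
    (hd : ∀ t ∈ Ioo (M - ε) M, DifferentiableAt ℝ φ t)
    (hsq : ∀ s ∈ Icc (M - ε) M, ∀ t ∈ Icc (M - ε) M, s ≤ t →
      K * (√(M - s) - √(M - t)) ≤ φ t - φ s)
    (hsup : ∀ x < 1, ∃ t < M, x < φ t) :
    DifferentiableWithinAt ℝ (genInverse φ m M) (Icc 0 1) 1 ∧
      (∀ᶠ x in 𝓝[<] (1 : ℝ), DifferentiableAt ℝ (genInverse φ m M) x) ∧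
      Tendsto (deriv (genInverse φ m M)) (𝓝[<] 1) (𝓝 0) := by
  set R := genInverse φ m M with hR
  have hstrict : ∀ s ∈ Icc (M - ε) M, ∀ t ∈ Icc (M - ε) M, s < t → φ s < φ t := by
    intro s hs t ht hst
    have h1 := hsq s hs t ht hst.le
    have h2 : √(M - t) < √(M - s) := Real.sqrt_lt_sqrt (by linarith [ht.2]) (by linarith)
    nlinarith
  have hleft : ∀ t ∈ Ioc (M - ε) M, R (φ t) = t := by
    intro t ht
    refine genInverse_eq ⟨by linarith [ht.1], ht.2⟩ le_rfl fun s hs => ?_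
    have h1 : max s (M - ε) < t := max_lt hs ht.1
    exact (hmono (le_max_left s (M - ε))).trans_lt
      (hstrict _ ⟨le_max_right _ _, (h1.trans_le ht.2).le⟩ t ⟨ht.1.le, ht.2⟩ h1)
  -- Half of `ε` is given up because differentiability, hence continuity, is not available at `M -
  -- ε` itself.
  set x₁ := φ (M - ε / 2) with hx₁
  have hx₁1 : x₁ < 1 := hM ▸ hstrict _ ⟨by linarith, by linarith⟩ M ⟨by linarith, le_rfl⟩ (by linarith)
  -- Continuity of `φ` at `M` is not assumed; `hsup` takes its place by providing values above `x`
  -- strictly to the left of `M`.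
  have hex : ∀ x ∈ Ioo x₁ 1, ∃ t ∈ Ioo (M - ε / 2) M, φ t = x := by
    intro x hx
    obtain ⟨t₂, h2, hxt⟩ := hsup x hx.2
    have h3 : M - ε / 2 < t₂ := by
      by_contra! h
      linarith [hmono h, hx.1]
    obtain ⟨t, ht, rfl⟩ := intermediate_value_Ioo h3.le
      (fun t ht => (hd t ⟨by linarith [ht.1], by linarith [ht.2]⟩).continuousAt.continuousWithinAt)
      (show x ∈ Ioo _ _ from ⟨hx.1, hxt⟩)
    exact ⟨t, ⟨ht.1, ht.2.trans h2⟩, rfl⟩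
  have hRmem : ∀ x ∈ Ioo x₁ 1, R x ∈ Ioo (M - ε / 2) M ∧ φ (R x) = x := by
    intro x hx
    obtain ⟨t, ht, rfl⟩ := hex x hx
    rw [hleft t ⟨by linarith [ht.1], ht.2.le⟩]
    exact ⟨ht, rfl⟩
  have hsqR : ∀ x ∈ Ioo x₁ 1, √(M - R x) ≤ (1 - x) / K := by
    intro x hx
    obtain ⟨h1, h2⟩ := hRmem x hx
    have h3 := hsq (R x) ⟨by linarith [h1.1], h1.2.le⟩ M ⟨by linarith, le_rfl⟩ h1.2.le
    rw [h2, hM, sub_self, Real.sqrt_zero, sub_zero] at h3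
    rw [le_div_iff₀ hK]; linarith
  have hR1 : R 1 = M := by rw [← hM]; exact hleft M ⟨by linarith, le_rfl⟩
  have hderiv : ∀ x ∈ Ioo x₁ 1, ∃ d, HasDerivAt R d x ∧ |d| ≤ 2 * (1 - x) / K ^ 2 := by
    intro x hx
    obtain ⟨hRx, hφR⟩ := hRmem x hx
    set t := R x with ht
    have hcont : ContinuousAt R x := by
      rw [ContinuousAt, Metric.tendsto_nhds, ← ht]
      intro e he
      set a := max (t - e) ((t + (M - ε / 2)) / 2) with ha
      set b := min (t + e) ((t + M) / 2) with hb
      have ha1 : a < t := max_lt (by linarith) (by linarith [hRx.1])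
      have ha2 : M - ε / 2 < a := lt_max_of_lt_right (by linarith [hRx.1])
      have hb1 : t < b := lt_min (by linarith) (by linarith [hRx.2])
      have hb2 : b < M := min_lt_of_right_lt (by linarith [hRx.2])
      have hI : ∀ s ∈ Ioo (M - ε / 2) M, s ∈ Icc (M - ε) M := fun s hs =>
        ⟨by linarith [hs.1], hs.2.le⟩
      have haI := hI a ⟨ha2, ha1.trans hRx.2⟩
      have hbI := hI b ⟨hRx.1.trans hb1, hb2⟩
      have h1 : φ a < x := hφR ▸ hstrict a haI t (hI t hRx) ha1
      have h2 : x < φ b := hφR ▸ hstrict t (hI t hRx) b hbI hb1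
      filter_upwards [Ioo_mem_nhds h1 h2, Ioo_mem_nhds hx.1 hx.2] with y hy hy'
      obtain ⟨h3, h4⟩ := hRmem y hy'
      have h5 : a < R y := by
        by_contra! h
        linarith [hmono h, hy.1]
      have h6 : R y < b := by
        by_contra! h
        linarith [hmono h, hy.2]
      rw [Real.dist_eq, abs_lt]
      constructor
      · linarith [le_max_left (t - e) ((t + (M - ε / 2)) / 2)]
      · linarith [min_le_left (t + e) ((t + M) / 2)]
    have htI : t ∈ Ioo (M - ε) M := ⟨by linarith [hRx.1], hRx.2⟩
    have hφd := (hd t htI).hasDerivAt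
    set q := √(M - t) with hq
    have hq0 : 0 < q := Real.sqrt_pos.2 (by linarith [hRx.2])
    -- With p = √(M - s) ≤ q and s - t = (q - p)(q + p), the slope from `t` to `s` is at least K /
    -- (q + p), hence at least K / (2 q).
    have hlow : K / (2 * q) ≤ deriv φ t := by
      have h1 := (hasDerivAt_iff_tendsto_slope.1 hφd).mono_left
        (nhdsWithin_mono t (show Ioi t ⊆ {t}ᶜ from fun s hs => ne_of_gt hs))
      refine ge_of_tendsto h1 ?_
      filter_upwards [Ioo_mem_nhdsGT htI.2] with s hs
      have h2 := hsq t (Ioo_subset_Icc_self htI) s ⟨by linarith [htI.1, hs.1], hs.2.le⟩ hs.1.le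
      rw [slope_def_field, le_div_iff₀ (by linarith [hs.1])]
      refine le_trans ?_ h2
      rw [← hq]
      set p := √(M - s) with hp
      have hp0 : 0 ≤ p := Real.sqrt_nonneg _
      have hpq : p ≤ q := Real.sqrt_le_sqrt (by linarith [hs.1])
      have h3 : s - t = (q - p) * (q + p) := by
        have e1 : q ^ 2 = M - t := Real.sq_sqrt (by linarith [hRx.2])
        have e2 : p ^ 2 = M - s := Real.sq_sqrt (by linarith [hs.2])
        linarith [show (q - p) * (q + p) = q ^ 2 - p ^ 2 by ring]
      rw [h3, div_mul_eq_mul_div, div_le_iff₀ (by positivity)]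
      have : 0 ≤ K * (q - p) * (q - p) := by
        have := sub_nonneg.2 hpq
        positivity
      nlinarith
    have hpos : 0 < deriv φ t := lt_of_lt_of_le (by positivity) hlow
    refine ⟨(deriv φ t)⁻¹, HasDerivAt.of_local_left_inverse hcont hφd hpos.ne' ?_, ?_⟩
    · filter_upwards [Ioo_mem_nhds hx.1 hx.2] with y hy using (hRmem y hy).2
    · rw [abs_of_pos (inv_pos.2 hpos)]
      have h1 : (deriv φ t)⁻¹ ≤ 2 * q / K := by
        rw [← inv_div]
        exact inv_anti₀ (by positivity) hlow
      refine h1.trans ?_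
      have h2 : q ≤ (1 - x) / K := hsqR x hx
      calc 2 * q / K ≤ 2 * ((1 - x) / K) / K := by gcongr
        _ = 2 * (1 - x) / K ^ 2 := by field_simp
  refine ⟨?_, ?_, ?_⟩
  -- Squaring `hsqR` shows that `R` deviates from its end value only quadratically in 1 - x, so the
  -- one-sided derivative is 0.
  · have : HasDerivWithinAt R 0 (Icc 0 1) 1 := by
      rw [hasDerivWithinAt_iff_isLittleO]
      have hO : (fun x => R x - R 1 - (x - 1) • (0 : ℝ)) =O[𝓝[Icc 0 1] 1]
          fun x => (x - 1) ^ 2 := by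
        refine Asymptotics.IsBigO.of_bound (1 / K ^ 2) ?_
        filter_upwards [mem_nhdsWithin_of_mem_nhds (Ioi_mem_nhds hx₁1), self_mem_nhdsWithin]
          with x h1 h2
        rcases eq_or_lt_of_le h2.2 with h3 | h3
        · simp [h3]
        have h4 := hsqR x ⟨h1, h3⟩
        have h5 := (hRmem x ⟨h1, h3⟩).1.2
        have h6 : M - R x ≤ ((1 - x) / K) ^ 2 := (Real.sqrt_le_left (by
          have : 0 < 1 - x := by linarith
          positivity)).1 h4
        rw [hR1, smul_zero, sub_zero, Real.norm_eq_abs, abs_of_neg (by linarith), Real.norm_eq_abs,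
          abs_of_nonneg (by positivity)]
        calc -(R x - M) = M - R x := by ring
          _ ≤ _ := h6
          _ = _ := by ring
      refine hO.trans_isLittleO ?_
      have h7 : (fun x : ℝ => (x - 1) ^ 2) =o[𝓝 1] fun x => x - 1 := by
        have h8 : Tendsto (fun x : ℝ => x - 1) (𝓝 1) (𝓝 0) := by
          have : Continuous fun x : ℝ => x - 1 := by fun_prop
          simpa using this.tendsto 1
        simpa [Function.comp_def] using
          (Asymptotics.isLittleO_pow_id (𝕜 := ℝ) (n := 2) one_lt_two).comp_tendsto h8
      exact h7.mono nhdsWithin_le_nhds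
    exact this.differentiableWithinAt
  · filter_upwards [Ioo_mem_nhdsLT hx₁1] with x hx
    obtain ⟨d, hd, -⟩ := hderiv x hx
    exact hd.differentiableAt
  · have hlim : Tendsto (fun x : ℝ => 2 * (1 - x) / K ^ 2) (𝓝[<] 1) (𝓝 0) := by
      have : Continuous fun x : ℝ => 2 * (1 - x) / K ^ 2 := by fun_prop
      simpa using (this.tendsto 1).mono_left nhdsWithin_le_nhds
    refine squeeze_zero_norm' ?_ hlim
    filter_upwards [Ioo_mem_nhdsLT hx₁1] with x hx
    obtain ⟨d, hd, hd'⟩ := hderiv x hx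
    rw [hd.deriv]
    exact hd'
-- Continuity of ordered eigenvalues.
section SortedEigenvalue

variable {𝕜 V : Type} [RCLike 𝕜] [Fintype V] [DecidableEq V]

theorem sortedEigenvalue_congr {A B : Matrix V V 𝕜} (h : A = B) (hA : A.IsHermitian)
    (hB : B.IsHermitian) (k : ℕ) : sortedEigenvalue hA k = sortedEigenvalue hB k := by
  subst h; rfl

/-- Each product ‖x i‖ ‖x j‖ is at most the squared norm. The entrywise constant is crude, but
through Weyl's principle it makes the eigenvalues Lipschitz in the entries. -/
theorem abs_quadForm_sub_le (A B : Matrix V V 𝕜) (x : V → 𝕜) :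
    |quadForm A x - quadForm B x| ≤ (∑ i, ∑ j, ‖A i j - B i j‖) * normSq x := by
  have hx : ∀ i, ‖x i‖ ^ 2 ≤ normSq x := fun i =>
    Finset.single_le_sum (f := fun i => ‖x i‖ ^ 2) (fun j _ => by positivity) (Finset.mem_univ i)
  have h1 : quadForm A x - quadForm B x =
      RCLike.re (∑ i, ∑ j, star (x i) * ((A i j - B i j) * x j)) := by
    rw [quadForm, quadForm, ← map_sub, ← dotProduct_sub, ← Matrix.sub_mulVec]
    simp [dotProduct, Matrix.mulVec, Finset.mul_sum]
  rw [h1, Finset.sum_mul]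
  refine (RCLike.abs_re_le_norm _).trans ((norm_sum_le _ _).trans (Finset.sum_le_sum fun i _ => ?_))
  rw [Finset.sum_mul]
  refine (norm_sum_le _ _).trans (Finset.sum_le_sum fun j _ => ?_)
  rw [norm_mul, norm_mul, norm_star]
  have h2 : ‖x i‖ * ‖x j‖ ≤ normSq x := by nlinarith [hx i, hx j, sq_nonneg (‖x i‖ - ‖x j‖)]
  calc ‖x i‖ * (‖A i j - B i j‖ * ‖x j‖) = ‖A i j - B i j‖ * (‖x i‖ * ‖x j‖) := by ring
    _ ≤ _ := by gcongr

theorem abs_sortedEigenvalue_sub_le {A B : Matrix V V 𝕜} (hA : A.IsHermitian) (hB : B.IsHermitian)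
    (k : ℕ) : |sortedEigenvalue hA k - sortedEigenvalue hB k| ≤ ∑ i, ∑ j, ‖A i j - B i j‖ := by
  unfold sortedEigenvalue
  split_ifs with h
  · rw [abs_sub_le_iff]
    have h1 := eigenvalues₀_le_add_of_quadForm_le hA hB (∑ i, ∑ j, ‖A i j - B i j‖) (fun x => by
      linarith [(abs_sub_le_iff.1 (abs_quadForm_sub_le A B x)).1]) ⟨Fintype.card V - k, by omega⟩
    have h2 := eigenvalues₀_le_add_of_quadForm_le hB hA (∑ i, ∑ j, ‖A i j - B i j‖) (fun x => by
      linarith [(abs_sub_le_iff.1 (abs_quadForm_sub_le A B x)).2]) ⟨Fintype.card V - k, by omega⟩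
    constructor <;> linarith
  · rw [sub_self, abs_zero]
    exact Finset.sum_nonneg fun i _ => Finset.sum_nonneg fun j _ => norm_nonneg _

theorem continuous_sortedEigenvalue {X : Type*} [TopologicalSpace X] {A : X → Matrix V V 𝕜}
    (hA : ∀ x, (A x).IsHermitian) (hc : ∀ i j, Continuous fun x => A x i j) (k : ℕ) :
    Continuous fun x => sortedEigenvalue (hA x) k := by
  rw [continuous_iff_continuousAt]
  intro x
  rw [ContinuousAt, tendsto_iff_dist_tendsto_zero]
  refine squeeze_zero (fun _ => dist_nonneg)
    (fun y => abs_sortedEigenvalue_sub_le (hA y) (hA x) k) ?_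
  have : Continuous fun y => ∑ i, ∑ j, ‖A y i j - A x i j‖ := by fun_prop
  simpa using this.tendsto x

theorem quadForm_smul (c : ℝ) (A : Matrix V V 𝕜) (x : V → 𝕜) :
    quadForm (c • A) x = c * quadForm A x := by
  rw [quadForm, Matrix.smul_mulVec, dotProduct_smul, quadForm, RCLike.smul_re]

end SortedEigenvalue

/-! ### Uniform quadratic remainders and Landau's inequality. -/

section Smooth

/-- A function with a first-order expansion whose remainder is uniformly quadratic. -/
def HasQuadraticRemainder (g : ℝ → ℂ) : Prop :=
  ∃ (C : ℝ) (D : ℝ → ℂ), ∀ x y : ℝ, ‖g y - g x - D x * (y - x : ℝ)‖ ≤ C * (y - x) ^ 2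

theorem HasQuadraticRemainder.add {g h : ℝ → ℂ} (hg : HasQuadraticRemainder g)
    (hh : HasQuadraticRemainder h) : HasQuadraticRemainder fun x => g x + h x := by
  obtain ⟨C, D, h1⟩ := hg
  obtain ⟨C', D', h2⟩ := hh
  refine ⟨C + C', fun x => D x + D' x, fun x y => ?_⟩
  calc ‖g y + h y - (g x + h x) - (D x + D' x) * (y - x : ℝ)‖
      = ‖(g y - g x - D x * (y - x : ℝ)) + (h y - h x - D' x * (y - x : ℝ))‖ := by ring_nf
    _ ≤ _ := norm_add_le _ _
    _ ≤ _ := by linarith [h1 x y, h2 x y]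

theorem HasQuadraticRemainder.const_mul {g : ℝ → ℂ} (hg : HasQuadraticRemainder g) (a : ℂ) :
    HasQuadraticRemainder fun x => a * g x := by
  obtain ⟨C, D, h1⟩ := hg
  refine ⟨‖a‖ * C, fun x => a * D x, fun x y => ?_⟩
  calc ‖a * g y - a * g x - a * D x * (y - x : ℝ)‖
      = ‖a‖ * ‖g y - g x - D x * (y - x : ℝ)‖ := by rw [← norm_mul]; ring_nf
    _ ≤ _ := by rw [mul_assoc]; exact mul_le_mul_of_nonneg_left (h1 x y) (norm_nonneg _)

theorem hasQuadraticRemainder_const (a : ℂ) : HasQuadraticRemainder fun _ => a :=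
  ⟨0, fun _ => 0, fun x y => by simp⟩

theorem HasQuadraticRemainder.sum {ι : Type*} (s : Finset ι) {g : ι → ℝ → ℂ}
    (hg : ∀ i ∈ s, HasQuadraticRemainder (g i)) : HasQuadraticRemainder fun x => ∑ i ∈ s, g i x := by
  classical
  induction s using Finset.induction_on with
  | empty => simpa using hasQuadraticRemainder_const 0
  | insert a s ha ih =>
    simp_rw [Finset.sum_insert ha]
    exact (hg a (Finset.mem_insert_self a s)).add
      (ih fun i hi => hg i (Finset.mem_insert_of_mem hi))

/-- Taylor's bound covers |s| ≤ 1 and the triangle inequality the rest; an estimate on the whole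
line is needed because `HasQuadraticRemainder` is a global condition. -/
theorem abs_sin_sub_self_le (s : ℝ) : |Real.sin s - s| ≤ 2 * s ^ 2 := by
  rcases le_or_gt |s| 1 with h | h
  · have h1 := Real.sin_bound h
    have h2 : |Real.sin s - s| ≤ |Real.sin s - (s - s ^ 3 / 6)| + |s ^ 3 / 6| := by
      have := abs_sub (Real.sin s - (s - s ^ 3 / 6)) (s ^ 3 / 6)
      rwa [show Real.sin s - (s - s ^ 3 / 6) - s ^ 3 / 6 = Real.sin s - s by ring] at this
    rw [abs_div, abs_pow, abs_of_pos (show (0 : ℝ) < 6 by norm_num)] at h2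
    rw [← sq_abs s]
    have h3 : |s| ^ 3 ≤ |s| ^ 2 := pow_le_pow_of_le_one (abs_nonneg s) h (by norm_num)
    have h4 : |s| ^ 4 ≤ |s| ^ 2 := pow_le_pow_of_le_one (abs_nonneg s) h (by norm_num)
    nlinarith [abs_nonneg s]
  · have h1 : |Real.sin s - s| ≤ |Real.sin s| + |s| := abs_sub _ _
    rw [← sq_abs s]
    nlinarith [Real.abs_sin_le_one s]

/-- Factoring out the unimodular value at x leaves e^{is} - 1 - is with s = a (y - x), of norm at
most s²/2 + 2 s². -/
theorem hasQuadraticRemainder_cexp (a : ℝ) :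
    HasQuadraticRemainder fun x : ℝ => Complex.exp ((a * x : ℝ) * Complex.I) := by
  refine ⟨3 * a ^ 2, fun x => Complex.exp ((a * x : ℝ) * Complex.I) * (a * Complex.I),
    fun x y => ?_⟩
  set s := a * (y - x) with hs
  have h1 : Complex.exp ((a * y : ℝ) * Complex.I) =
      Complex.exp ((a * x : ℝ) * Complex.I) * Complex.exp (s * Complex.I) := by
    rw [← Complex.exp_add]; congr 1; rw [hs]; push_cast; ring
  have h2 : Complex.exp (s * Complex.I) - 1 - s * Complex.I =
      ((Real.cos s - 1 : ℝ) : ℂ) + ((Real.sin s - s : ℝ) : ℂ) * Complex.I := by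
    rw [Complex.exp_mul_I, ← Complex.ofReal_cos, ← Complex.ofReal_sin]; push_cast; ring
  have h3 : Complex.exp ((a * y : ℝ) * Complex.I) - Complex.exp ((a * x : ℝ) * Complex.I) -
      Complex.exp ((a * x : ℝ) * Complex.I) * (a * Complex.I) * (y - x : ℝ) =
      Complex.exp ((a * x : ℝ) * Complex.I) * (Complex.exp (s * Complex.I) - 1 - s * Complex.I) := by
    rw [h1, hs]; push_cast; ring
  rw [h3, norm_mul, Complex.norm_exp_ofReal_mul_I, one_mul, h2]
  refine (norm_add_le _ _).trans ?_
  rw [norm_mul, Complex.norm_I, mul_one, Complex.norm_real, Complex.norm_real, Real.norm_eq_abs,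
    Real.norm_eq_abs]
  have h4 := abs_sin_sub_self_le s
  have h5 : |Real.cos s - 1| ≤ s ^ 2 / 2 := by
    rw [abs_le]
    constructor <;> nlinarith [Real.one_sub_sq_div_two_le_cos (x := s), Real.cos_le_one s]
  have h6 : s ^ 2 = a ^ 2 * (y - x) ^ 2 := by rw [hs]; ring
  nlinarith [sq_nonneg s]

/-- Landau's inequality in integrated form. -/
theorem sqrt_le_sqrt_add_of_quadratic {h : ℝ → ℝ} {K : ℝ} (hK : 0 < K) (h0 : ∀ x, 0 ≤ h x)
    {x D : ℝ} (hD : ∀ y, h y ≤ h x + D * (y - x) + K ^ 2 * (y - x) ^ 2) (y : ℝ) :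
    √(h y) ≤ √(h x) + K * |y - x| := by
  -- The quadratic majorant is nonnegative at its minimizer x - D / (2 K²), which is a bound for its
  -- discriminant. The majorant is then at most (√(h x) + K |y - x|)².
  have h1 : D ^ 2 ≤ (2 * K * √(h x)) ^ 2 := by
    have h2 := (h0 _).trans (hD (x - D / (2 * K ^ 2)))
    rw [mul_pow, Real.sq_sqrt (h0 x)]
    have h3 : h x + D * (x - D / (2 * K ^ 2) - x) + K ^ 2 * (x - D / (2 * K ^ 2) - x) ^ 2 =
        h x - D ^ 2 / (4 * K ^ 2) := by field_simp; ring
    rw [h3, sub_nonneg, div_le_iff₀ (by positivity)] at h2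
    linarith
  have h4 : |D| ≤ 2 * K * √(h x) := abs_le_of_sq_le_sq h1 (by positivity)
  rw [Real.sqrt_le_left (by positivity)]
  refine (hD y).trans ?_
  have h5 : D * (y - x) ≤ 2 * K * √(h x) * |y - x| := by
    refine (le_abs_self _).trans ?_
    rw [abs_mul]
    gcongr
  have h6 := Real.sq_sqrt (h0 x)
  have h7 := sq_abs (y - x)
  nlinarith

/-- The Rayleigh quotients of a family of matrices with uniformly quadratic remainders have
uniformly quadratic remainders. -/
theorem exists_quadForm_remainder {V : Type} [Fintype V] [DecidableEq V] {A : ℝ → Matrix V V ℂ}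
    (hA : ∀ i j, HasQuadraticRemainder fun x => A x i j) :
    ∃ C, ∀ v : V → ℂ, normSq v = 1 → ∀ x, ∃ D : ℝ, ∀ y,
      |quadForm (A y) v - quadForm (A x) v - D * (y - x)| ≤ C * (y - x) ^ 2 := by
  choose C D h using hA
  refine ⟨∑ i, ∑ j, C i j, fun v hv x => ⟨(∑ i, ∑ j, star (v i) * (D i j x * v j)).re, fun y => ?_⟩⟩
  have hx : ∀ i, ‖v i‖ ^ 2 ≤ 1 := fun i => hv ▸
    Finset.single_le_sum (f := fun i => ‖v i‖ ^ 2) (fun j _ => by positivity) (Finset.mem_univ i)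
  have h1 : quadForm (A y) v - quadForm (A x) v -
        (∑ i, ∑ j, star (v i) * (D i j x * v j)).re * (y - x) =
      (∑ i, ∑ j, star (v i) * ((A y i j - A x i j - D i j x * (y - x : ℝ)) * v j)).re := by
    have e1 : (∑ i, ∑ j, star (v i) * (D i j x * v j)).re * (y - x) =
        (∑ i, ∑ j, star (v i) * (D i j x * (y - x : ℝ) * v j)).re := by
      rw [← Complex.re_mul_ofReal, Finset.sum_mul]
      simp_rw [Finset.sum_mul]
      congr 1
      exact Finset.sum_congr rfl fun i _ => Finset.sum_congr rfl fun j _ => by ring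
    have e2 : ∀ B : Matrix V V ℂ, quadForm B v = (∑ i, ∑ j, star (v i) * (B i j * v j)).re := by
      intro B
      simp [quadForm, dotProduct, Matrix.mulVec, Finset.mul_sum]
    rw [e1, e2, e2, ← Complex.sub_re, ← Complex.sub_re, ← Finset.sum_sub_distrib,
      ← Finset.sum_sub_distrib]
    congr 1
    refine Finset.sum_congr rfl fun i _ => ?_
    rw [← Finset.sum_sub_distrib, ← Finset.sum_sub_distrib]
    exact Finset.sum_congr rfl fun j _ => by ring
  rw [h1, Finset.sum_mul]
  refine (Complex.abs_re_le_norm _).trans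
    ((norm_sum_le _ _).trans (Finset.sum_le_sum fun i _ => ?_))
  rw [Finset.sum_mul]
  refine (norm_sum_le _ _).trans (Finset.sum_le_sum fun j _ => ?_)
  rw [norm_mul, norm_mul, norm_star]
  -- This removes `v` from the bound, so that one constant serves all unit vectors.
  have h2 : ‖v i‖ * ‖v j‖ ≤ 1 := by nlinarith [hx i, hx j, sq_nonneg (‖v i‖ - ‖v j‖)]
  calc ‖v i‖ * (‖A y i j - A x i j - D i j x * (y - x : ℝ)‖ * ‖v j‖)
      = (‖v i‖ * ‖v j‖) * ‖A y i j - A x i j - D i j x * (y - x : ℝ)‖ := by ring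
    _ ≤ 1 * ‖A y i j - A x i j - D i j x * (y - x : ℝ)‖ := by gcongr
    _ ≤ _ := by rw [one_mul]; exact h i j x y

end Smooth

/-! ### The eigenvalue functions of the symbol. -/

section Symbol

variable {ν m : ℕ} (G : WeightedGraph (Fin ν)) (K : Links ν m)

theorem symbol_apply_eq_exp (θ : ℝ) (r s : Fin ν) :
    symbol G K θ r s = (G.weight r s : ℂ) + ∑ k,
      ((K.L k r s : ℂ) * Complex.exp ((K.t k * θ : ℝ) * Complex.I) +
        (K.L k s r : ℂ) * Complex.exp (((-K.t k : ℝ) * θ : ℝ) * Complex.I)) := by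
  simp only [symbol, Matrix.of_apply]
  congr 1
  refine Finset.sum_congr rfl fun k _ => ?_
  rw [Complex.exp_mul_I, Complex.exp_mul_I, ← Complex.ofReal_cos, ← Complex.ofReal_sin,
    ← Complex.ofReal_cos, ← Complex.ofReal_sin, neg_mul, Real.cos_neg, Real.sin_neg]
  push_cast
  ring

theorem symbol_periodic : Function.Periodic (symbol G K) (2 * Real.pi) := by
  intro θ
  ext r s
  simp only [symbol, Matrix.of_apply]
  congr 1
  refine Finset.sum_congr rfl fun k _ => ?_
  rw [mul_add, Real.cos_add_nat_mul_two_pi, Real.sin_add_nat_mul_two_pi]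

theorem continuous_symbol_apply (r s : Fin ν) : Continuous fun θ => symbol G K θ r s := by
  simp only [symbol, Matrix.of_apply]
  fun_prop

theorem hasQuadraticRemainder_symbol (r s : Fin ν) :
    HasQuadraticRemainder fun θ => symbol G K θ r s := by
  simp_rw [symbol_apply_eq_exp]
  refine (hasQuadraticRemainder_const _).add (HasQuadraticRemainder.sum _ fun k _ => ?_)
  exact ((hasQuadraticRemainder_cexp _).const_mul _).add ((hasQuadraticRemainder_cexp _).const_mul _)

/-- The eigenvalue functions of `c f`, indexed by the order of the eigenvalues of `f`. -/
noncomputable def branch (c : ℝ) (k : Fin ν) (θ : ℝ) : ℝ :=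
  c * sortedEigenvalue (symbol_isHermitian G K θ) ((k : ℕ) + 1)

theorem continuous_branch (c : ℝ) (k : Fin ν) : Continuous (branch G K c k) :=
  continuous_const.mul (continuous_sortedEigenvalue (symbol_isHermitian G K)
    (continuous_symbol_apply G K) _)

theorem branch_periodic (c : ℝ) (k : Fin ν) : Function.Periodic (branch G K c k) (2 * Real.pi) :=
  fun θ => by rw [branch, branch, sortedEigenvalue_congr (symbol_periodic G K θ)]

theorem sortedEigenvalue_eq_eigenvalues₀ {A : Matrix (Fin ν) (Fin ν) ℂ} (hA : A.IsHermitian)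
    (k : Fin ν) : ∃ j, sortedEigenvalue hA ((k : ℕ) + 1) = hA.eigenvalues₀ j := by
  have : 1 ≤ (k : ℕ) + 1 ∧ (k : ℕ) + 1 ≤ Fintype.card (Fin ν) := by
    rw [Fintype.card_fin]; omega
  rw [sortedEigenvalue, dif_pos this]
  exact ⟨_, rfl⟩

theorem eigenvalues₀_eq_sortedEigenvalue {A : Matrix (Fin ν) (Fin ν) ℂ} (hA : A.IsHermitian)
    (j : Fin (Fintype.card (Fin ν))) :
    ∃ k : Fin ν, hA.eigenvalues₀ j = sortedEigenvalue hA ((k : ℕ) + 1) := by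
  have hj : (j : ℕ) < ν := by simpa using j.2
  refine ⟨⟨ν - 1 - j, by omega⟩, ?_⟩
  have : 1 ≤ ν - 1 - (j : ℕ) + 1 ∧ ν - 1 - (j : ℕ) + 1 ≤ Fintype.card (Fin ν) := by
    have := Fintype.card_fin ν
    omega
  rw [sortedEigenvalue, dif_pos this]
  congr 1
  ext
  simp only [Fintype.card_fin]
  omega

theorem exists_unit_eigenvector_branch (c : ℝ) (k : Fin ν) (θ : ℝ) :
    ∃ v : Fin ν → ℂ, normSq v = 1 ∧
      (c • symbol G K θ).mulVec v = ((branch G K c k θ : ℝ) : ℂ) • v := by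
  obtain ⟨j, hj⟩ := sortedEigenvalue_eq_eigenvalues₀ (symbol_isHermitian G K θ) k
  obtain ⟨v, hv, hv'⟩ := exists_unit_mulVec_eq (symbol_isHermitian G K θ) j
  refine ⟨v, hv, ?_⟩
  rw [Matrix.smul_mulVec, hv', branch, hj]
  ext i
  simp [mul_assoc]

/-- The largest eigenvalue of `c f`. -/
noncomputable def topBranch [NeZero ν] (c : ℝ) (θ : ℝ) : ℝ :=
  -- For c < 0 the order of the branches is reversed; a maximum over all of them handles both signs.
  Finset.univ.sup' Finset.univ_nonempty fun k => branch G K c k θ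

variable [NeZero ν] (c : ℝ)

theorem branch_le_topBranch (k : Fin ν) (θ : ℝ) : branch G K c k θ ≤ topBranch G K c θ :=
  Finset.le_sup' (fun k => branch G K c k θ) (Finset.mem_univ k)

theorem exists_branch_eq_topBranch (θ : ℝ) : ∃ k, branch G K c k θ = topBranch G K c θ := by
  obtain ⟨k, -, hk⟩ := Finset.exists_mem_eq_sup' Finset.univ_nonempty fun k => branch G K c k θ
  exact ⟨k, hk.symm⟩

theorem continuous_topBranch : Continuous (topBranch G K c) :=
  Continuous.finset_sup'_apply Finset.univ_nonempty fun k _ => continuous_branch G K c k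

theorem topBranch_periodic : Function.Periodic (topBranch G K c) (2 * Real.pi) := fun θ => by
  simp only [topBranch, branch_periodic G K c _ θ]

/-- In an eigenbasis of the symbol the form is a combination of branch values whose nonnegative
weights add up to the squared norm. -/
theorem quadForm_symbol_le (θ : ℝ) (v : Fin ν → ℂ) :
    quadForm (c • symbol G K θ) v ≤ topBranch G K c θ * normSq v := by
  obtain ⟨w, hw, hw1, hw2⟩ := exists_quadForm_eq_sum (symbol_isHermitian G K θ) v
  rw [quadForm_smul, hw2, ← hw1, Finset.mul_sum, Finset.mul_sum]
  refine Finset.sum_le_sum fun j _ => ?_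
  obtain ⟨k, hk⟩ := eigenvalues₀_eq_sortedEigenvalue (symbol_isHermitian G K θ) j
  rw [hk, ← mul_assoc]
  exact mul_le_mul_of_nonneg_right (branch_le_topBranch G K c k θ) (hw j)

theorem exists_unit_quadForm_eq_topBranch (θ : ℝ) :
    ∃ v : Fin ν → ℂ, normSq v = 1 ∧ quadForm (c • symbol G K θ) v = topBranch G K c θ := by
  obtain ⟨k, hk⟩ := exists_branch_eq_topBranch G K c θ
  obtain ⟨v, hv, hv'⟩ := exists_unit_eigenvector_branch G K c k θ
  exact ⟨v, hv, (quadForm_of_mulVec_eq hv hv').trans hk⟩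

/-- The maximum of the largest eigenvalue is attained. -/
theorem exists_topBranch_max : ∃ θ ∈ Icc (-Real.pi) Real.pi, ∀ x,
    topBranch G K c x ≤ topBranch G K c θ := by
  obtain ⟨θ, hθ, hmax⟩ := isCompact_Icc.exists_isMaxOn (nonempty_Icc.2 (by linarith [Real.pi_pos]))
    (continuous_topBranch G K c).continuousOn (s := Icc (-Real.pi) Real.pi)
  refine ⟨θ, hθ, fun x => ?_⟩
  obtain ⟨y, hy, hxy⟩ := (topBranch_periodic G K c).exists_mem_Ico Real.two_pi_pos x (-Real.pi)
  rw [hxy]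
  exact hmax ⟨hy.1, by linarith [hy.2]⟩

/-- The top eigenvalue need not be smooth where eigenvalues cross. But the Rayleigh quotient of a
unit top eigenvector taken at x touches it from below at x, with a remainder that is quadratic
uniformly in x and the vector. Landau's inequality for M minus this quotient therefore bounds √(M -
ψ), with a constant independent of x. -/
theorem exists_lipschitz_sqrt_sub_topBranch {M : ℝ} (hM : ∀ x, topBranch G K c x ≤ M) :
    ∃ L : NNReal, 0 < L ∧ LipschitzWith L fun x => √(M - topBranch G K c x) := by
  obtain ⟨C, hC⟩ := exists_quadForm_remainder (A := fun θ => c • symbol G K θ) fun i j => by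
    simpa using (hasQuadraticRemainder_symbol G K i j).const_mul (c : ℂ)
  set L : ℝ := |C| + 1
  have hL : 0 < L := by positivity
  have hCL : C ≤ L ^ 2 := by
    have := le_abs_self C
    nlinarith [abs_nonneg C]
  have key : ∀ x y, √(M - topBranch G K c y) ≤ √(M - topBranch G K c x) + L * |y - x| := by
    intro x y
    obtain ⟨v, hv, hvx⟩ := exists_unit_quadForm_eq_topBranch G K c x
    have hle : ∀ z, quadForm (c • symbol G K z) v ≤ topBranch G K c z := fun z => by
      simpa [hv] using quadForm_symbol_le G K c z v
    obtain ⟨D, hD⟩ := hC v hv x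
    have := sqrt_le_sqrt_add_of_quadratic (h := fun z => M - quadForm (c • symbol G K z) v) hL
      (fun z => by linarith [hle z, hM z]) (x := x) (D := -D) (fun z => by
        have h1 := (abs_le.1 (hD z)).1
        have h2 := mul_le_mul_of_nonneg_right hCL (sq_nonneg (z - x))
        linarith) y
    rw [hvx] at this
    exact (Real.sqrt_le_sqrt (by linarith [hle y])).trans this
  refine ⟨⟨L, hL.le⟩, hL, LipschitzWith.of_dist_le_mul fun x y => ?_⟩
  rw [Real.dist_eq, Real.dist_eq, abs_sub_le_iff]
  change _ ≤ L * |x - y| ∧ _ ≤ L * |x - y|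
  have h1 := key x y
  have h2 := key y x
  rw [abs_sub_comm] at h1
  constructor <;> linarith

end Symbol

/-! ### The characteristic polynomial in z = e^{iθ} and the level. -/

section CharacteristicPolynomial

variable {ν m : ℕ} (G : WeightedGraph (Fin ν)) (K : Links ν m) (c : ℝ)

open Polynomial in
/-- The characteristic polynomial of `c f`, cleared of negative powers of `e^{iθ}`. -/
noncomputable def charBivariate : ℂ[X][X] :=
  Matrix.det (Matrix.of fun r s : Fin ν =>
    X ^ (∑ k, K.t k) * C ((if r = s then X else 0) - C ((c * G.weight r s : ℝ) : ℂ)) -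
      ∑ k, (C (C ((c * K.L k r s : ℝ) : ℂ)) * X ^ (∑ k, K.t k + K.t k) +
        C (C ((c * K.L k s r : ℝ) : ℂ)) * X ^ (∑ k, K.t k - K.t k)))

-- Every entry is multiplied by z to the power ∑ t_k, which is at least each single t_k and so
-- clears all negative powers; the determinant collects this factor `ν` times.
open Polynomial in
theorem eval_charBivariate (θ : ℝ) (t : ℂ) :
    ((charBivariate G K c).map (evalRingHom t)).eval (Complex.exp (θ * Complex.I)) =
      Complex.exp (θ * Complex.I) ^ ((∑ k, K.t k) * ν) *
        (Matrix.scalar (Fin ν) t - c • symbol G K θ).det := by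
  set z := Complex.exp (θ * Complex.I) with hz
  have h1 : ((charBivariate G K c).map (evalRingHom t)).eval z =
      ((evalRingHom z).comp (mapRingHom (evalRingHom t))) (charBivariate G K c) := rfl
  rw [h1, charBivariate, RingHom.map_det, pow_mul]
  have h2 : (z ^ (∑ k, K.t k)) ^ ν = (z ^ (∑ k, K.t k)) ^ Fintype.card (Fin ν) := by
    rw [Fintype.card_fin]
  rw [h2, ← Matrix.det_smul]
  congr 1
  ext r s
  have hexp : ∀ k, Complex.exp ((K.t k * θ : ℝ) * Complex.I) = z ^ K.t k := fun k => by
    rw [hz, ← Complex.exp_nat_mul]; congr 1; push_cast; ring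
  have hexp' : ∀ k, z ^ (∑ k, K.t k) * Complex.exp (((-K.t k : ℝ) * θ : ℝ) * Complex.I) =
      z ^ (∑ k, K.t k - K.t k) := fun k => by
    have hle : K.t k ≤ ∑ k, K.t k :=
      Finset.single_le_sum (f := K.t) (fun _ _ => Nat.zero_le _) (Finset.mem_univ k)
    have h3 : z ^ K.t k * Complex.exp (((-K.t k : ℝ) * θ : ℝ) * Complex.I) = 1 := by
      rw [← hexp, ← Complex.exp_add, Complex.exp_eq_one_iff]
      exact ⟨0, by push_cast; ring⟩
    calc _ = z ^ (∑ k, K.t k - K.t k) *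
          (z ^ K.t k * Complex.exp (((-K.t k : ℝ) * θ : ℝ) * Complex.I)) := by
          rw [← mul_assoc, ← pow_add, Nat.sub_add_cancel hle]
      _ = _ := by rw [h3, mul_one]
  simp only [RingHom.mapMatrix_apply, Matrix.map_apply, Matrix.of_apply, Matrix.smul_apply,
    Matrix.sub_apply, Matrix.scalar_apply, Matrix.diagonal_apply, symbol_apply_eq_exp, hexp,
    RingHom.comp_apply, map_sub, map_mul, map_pow, map_sum, map_add, coe_mapRingHom,
    Polynomial.map_X, Polynomial.map_C, coe_evalRingHom, eval_X, eval_C, smul_eq_mul,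
    Complex.real_smul, apply_ite]
  simp only [mul_sub, mul_add, Finset.mul_sum]
  rw [← sub_sub]
  congr 1
  · split_ifs <;> simp
  · refine Finset.sum_congr rfl fun k _ => ?_
    rw [← hexp' k, pow_add]
    push_cast
    ring

-- At θ = 0, a level above the largest eigenvalue cannot be an eigenvalue, so the determinant is
-- nonzero there.
open Polynomial in
theorem charBivariate_ne_zero [NeZero ν] : charBivariate G K c ≠ 0 := by
  intro h0
  set t : ℝ := topBranch G K c 0 + 1 with ht
  have h1 := eval_charBivariate G K c 0 (t : ℂ)
  rw [h0] at h1
  simp only [Polynomial.map_zero, eval_zero, Complex.ofReal_zero, zero_mul, Complex.exp_zero,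
    one_pow, one_mul] at h1
  obtain ⟨v, hv0, hv⟩ := Matrix.exists_mulVec_eq_zero_iff.2 h1.symm
  have h2 : (c • symbol G K 0).mulVec v = (t : ℂ) • v := by
    rw [Matrix.sub_mulVec, sub_eq_zero] at hv
    rw [← hv, Matrix.scalar_apply, ← Matrix.smul_one_eq_diagonal, Matrix.smul_mulVec,
      Matrix.one_mulVec]
  have h3 : quadForm (c • symbol G K 0) v = t * normSq v := by
    rw [quadForm, h2, dotProduct_smul, smul_eq_mul]
    have : star v ⬝ᵥ v = ((normSq v : ℝ) : ℂ) := by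
      simp [dotProduct, normSq, Complex.conj_mul']
    rw [this, ← Complex.ofReal_mul]
    rfl
  have h4 := quadForm_symbol_le G K c 0 v
  have h5 : 0 < normSq v := by
    obtain ⟨i, hi⟩ := Function.ne_iff.1 hv0
    exact Finset.sum_pos' (fun i _ => by positivity)
      ⟨i, Finset.mem_univ i, by have := norm_pos_iff.2 hi; positivity⟩
  rw [h3, ht] at h4
  linarith

open Polynomial in
theorem eval_charBivariate_branch (k : Fin ν) (θ : ℝ) :
    ((charBivariate G K c).map (evalRingHom ((branch G K c k θ : ℝ) : ℂ))).eval
      (Complex.exp (θ * Complex.I)) = 0 := by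
  rw [eval_charBivariate, mul_eq_zero]
  right
  obtain ⟨v, hv1, hv⟩ := exists_unit_eigenvector_branch G K c k θ
  refine Matrix.exists_mulVec_eq_zero_iff.1 ⟨v, ?_, ?_⟩
  · rintro rfl
    simp [normSq] at hv1
  · rw [Matrix.sub_mulVec, hv, Matrix.scalar_apply, ← Matrix.smul_one_eq_diagonal,
      Matrix.smul_mulVec, Matrix.one_mulVec, sub_self]

open Polynomial in
/-- The measure of the sublevel sets of the eigenvalue functions is differentiable away from
finitely many levels. -/
theorem exists_finite_differentiableAt_volume_branch [NeZero ν] :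
    ∃ B : Set ℝ, B.Finite ∧ ∀ t ∉ B, ∀ k, DifferentiableAt ℝ
      (fun t => volume.real (Icc (-Real.pi) Real.pi ∩ {x | branch G K c k x ≤ t})) t := by
  obtain ⟨Q, r, hr, hQ⟩ := exists_separable_bivariate _ (charBivariate_ne_zero G K c)
  -- The exceptional levels are the real zeros of the nonzero polynomial `r`. The value of a
  -- constant branch is necessarily among them.
  refine ⟨{t : ℝ | r.eval (t : ℂ) = 0}, ?_, fun t₀ ht₀ k => ?_⟩
  · have h1 : {z : ℂ | r.eval z = 0}.Finite :=
      (r.roots.toFinset.finite_toSet).subset fun z hz => by simpa [hr] using hz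
    exact h1.preimage (f := fun t : ℝ => (t : ℂ)) Complex.ofReal_injective.injOn
  have hpi : Real.pi = -Real.pi + 2 * Real.pi := by ring
  have := differentiableAt_volume_sublevel (continuous_branch G K c k) Real.two_pi_pos
    (branch_periodic G K c k) (-Real.pi) t₀ ?_
  · rwa [← hpi] at this
  rintro x₀ rfl
  have hev : ∀ᶠ x in 𝓝 x₀, r.eval ((branch G K c k x : ℝ) : ℂ) ≠ 0 := by
    have hc : Continuous fun x => r.eval ((branch G K c k x : ℝ) : ℂ) :=
      r.continuous.comp (Complex.continuous_ofReal.comp (continuous_branch G K c k))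
    exact hc.continuousAt.eventually_ne ht₀
  have hzero : ∀ᶠ x in 𝓝 x₀, (Q.map (evalRingHom ((branch G K c k x : ℝ) : ℂ))).eval
      (Complex.exp (x * Complex.I)) = 0 :=
    hev.mono fun x hx => (hQ _ hx _).1 (eval_charBivariate_branch G K c k x)
  exact exists_injOn_isLittleO_of_polynomial (continuous_branch G K c k) Q hzero
    ((hQ _ ht₀ _).2 hzero.self_of_nhds)

end CharacteristicPolynomial

/-! ### The subdivision of the angle interval and its unfolding. -/

section Cells

variable {ν : ℕ}

theorem cell_subset_Icc (k : Fin ν) : cell ν k ⊆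
    Icc ((2 * (k : ℝ) - ν) * Real.pi / ν) ((2 * ((k : ℝ) + 1) - ν) * Real.pi / ν) := by
  unfold cell
  split_ifs
  · exact Subset.rfl
  · exact Ico_subset_Icc_self

theorem Ico_subset_cell (k : Fin ν) :
    Ico ((2 * (k : ℝ) - ν) * Real.pi / ν) ((2 * ((k : ℝ) + 1) - ν) * Real.pi / ν) ⊆ cell ν k := by
  unfold cell
  split_ifs
  · exact Ico_subset_Icc_self
  · exact Subset.rfl

theorem cell_ae_eq (k : Fin ν) : cell ν k =ᵐ[volume]
    Icc ((2 * (k : ℝ) - ν) * Real.pi / ν) ((2 * ((k : ℝ) + 1) - ν) * Real.pi / ν) := by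
  unfold cell
  split_ifs
  · rfl
  · exact Ico_ae_eq_Icc

theorem measurableSet_cell (k : Fin ν) : MeasurableSet (cell ν k) := by
  unfold cell
  split_ifs
  · exact measurableSet_Icc
  · exact measurableSet_Ico

/-- The affine map of the cell `I_k` onto `[-π, π]`. -/
noncomputable def unfoldCell (ν : ℕ) (k : Fin ν) (θ : ℝ) : ℝ :=
  ν * θ - (2 * ((k : ℝ) + 1) - 1 - ν) * Real.pi

theorem unfoldCell_preimage_Icc (k : Fin ν) :
    unfoldCell ν k ⁻¹' Icc (-Real.pi) Real.pi =
      Icc ((2 * (k : ℝ) - ν) * Real.pi / ν) ((2 * ((k : ℝ) + 1) - ν) * Real.pi / ν) := by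
  have hν : (0 : ℝ) < ν := Nat.cast_pos.2 k.pos
  ext θ
  simp only [unfoldCell, mem_preimage, mem_Icc, div_le_iff₀ hν, le_div_iff₀ hν]
  constructor <;> rintro ⟨h1, h2⟩ <;> constructor <;> linarith

theorem disjoint_cell_of_lt {k l : Fin ν} (h : k < l) : Disjoint (cell ν k) (cell ν l) := by
  have hν : (0 : ℝ) < ν := Nat.cast_pos.2 k.pos
  rw [Set.disjoint_left]
  intro θ hk hl
  have hne : (k : ℕ) + 1 ≠ ν := by have := l.2; have := Fin.lt_def.1 h; omega
  rw [cell, if_neg hne] at hk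
  have h1 := hk.2
  have h2 := (cell_subset_Icc l hl).1
  have h3 : ((k : ℝ) + 1) ≤ l := by exact_mod_cast Fin.lt_def.1 h
  have h4 := h2.trans_lt h1
  rw [div_lt_div_iff_of_pos_right hν, mul_lt_mul_iff_left₀ Real.pi_pos] at h4
  linarith

theorem pairwise_disjoint_cell : Pairwise fun k l : Fin ν => Disjoint (cell ν k) (cell ν l) := by
  intro k l h
  rcases lt_or_gt_of_ne h with h | h
  · exact disjoint_cell_of_lt h
  · exact (disjoint_cell_of_lt h).symm

theorem iUnion_cell [NeZero ν] : ⋃ k, cell ν k = Icc (-Real.pi) Real.pi := by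
  have hν : (0 : ℝ) < ν := Nat.cast_pos.2 (NeZero.pos ν)
  have hπ := Real.pi_pos
  refine Subset.antisymm (iUnion_subset fun k θ hθ => ?_) fun θ hθ => ?_
  · obtain ⟨h1, h2⟩ := cell_subset_Icc k hθ
    have h3 : (k : ℝ) + 1 ≤ ν := by exact_mod_cast k.2
    have h4 : (0 : ℝ) ≤ k := Nat.cast_nonneg _
    rw [div_le_iff₀ hν] at h1
    rw [le_div_iff₀ hν] at h2
    constructor
    · nlinarith
    · nlinarith
  · rw [mem_iUnion]
    -- `u` is the position of `θ` measured in cells, so its floor is the zero-based cell index,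
    -- except at θ = π, where u = ν and the closed last cell is used.
    set u := (θ / Real.pi + 1) / 2 * ν with hu
    have hθu : θ = (2 * u - ν) * Real.pi / ν := by rw [hu]; field_simp; ring
    have hu0 : 0 ≤ u := by
      have : -1 ≤ θ / Real.pi := by rw [le_div_iff₀ hπ]; linarith [hθ.1]
      have : 0 ≤ (θ / Real.pi + 1) / 2 := by linarith
      positivity
    have huν : u ≤ ν := by
      have : θ / Real.pi ≤ 1 := by rw [div_le_iff₀ hπ]; linarith [hθ.2]
      have : (θ / Real.pi + 1) / 2 ≤ 1 := by linarith
      nlinarith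
    rcases eq_or_lt_of_le huν with h | h
    · refine ⟨⟨ν - 1, Nat.sub_one_lt (NeZero.ne ν)⟩, ?_⟩
      have hc : ((ν - 1 : ℕ) : ℝ) = ν - 1 := by rw [Nat.cast_sub (NeZero.one_le), Nat.cast_one]
      rw [cell, if_pos (Nat.sub_add_cancel NeZero.one_le), hθu, h]
      simp only [hc]
      constructor <;> (gcongr; linarith)
    · refine ⟨⟨⌊u⌋₊, (Nat.floor_lt hu0).2 h⟩, Ico_subset_cell _ ?_⟩
      have h1 := Nat.floor_le hu0
      have h2 := Nat.lt_floor_add_one u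
      rw [hθu]
      constructor
      · simp only; gcongr
      · simp only; gcongr

theorem volume_unfoldCell_preimage (k : Fin ν) (s : Set ℝ) :
    volume (unfoldCell ν k ⁻¹' s) = ENNReal.ofReal ((ν : ℝ)⁻¹) * volume s := by
  have hν : (0 : ℝ) < ν := Nat.cast_pos.2 k.pos
  have h1 : unfoldCell ν k ⁻¹' s = (fun θ => (ν : ℝ) * θ) ⁻¹'
      ((fun θ => θ + -((2 * ((k : ℝ) + 1) - 1 - ν) * Real.pi)) ⁻¹' s) := by
    ext θ; simp [unfoldCell, sub_eq_add_neg]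
  rw [h1, Real.volume_preimage_mul_left hν.ne', measure_preimage_add_right,
    abs_of_pos (inv_pos.2 hν)]

end Cells

/-! ### The distribution function and the rearrangement. -/

section Distribution

variable {ν m : ℕ} (G : WeightedGraph (Fin ν)) (K : Links ν m) (c : ℝ)

theorem scalarSymbol_of_mem_cell {k : Fin ν} {z : ℝ × ℝ} (hz : z.2 ∈ cell ν k) :
    scalarSymbol G K (fun _ => c) z = branch G K c k (unfoldCell ν k z.2) := by
  rw [scalarSymbol, Finset.sum_eq_single k]
  · rw [indicator_of_mem hz]; rfl
  · intro l _ hl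
    exact indicator_of_notMem (fun h => Set.disjoint_left.1 (pairwise_disjoint_cell hl) h hz) _
  · simp

/-- Even without its right endpoint a cell unfolds onto a full period of its branch, so the
assignment of common endpoints loses no value. -/
theorem symbolRange_eq [NeZero ν] {Ω : Set ℝ} (hΩ : Ω.Nonempty) :
    symbolRange G K (fun _ => c) Ω = ⋃ k, range (branch G K c k) := by
  have hν : (0 : ℝ) < ν := Nat.cast_pos.2 (NeZero.pos ν)
  obtain ⟨x, hx⟩ := hΩ
  refine Subset.antisymm ?_ (iUnion_subset fun k => ?_)
  · rintro _ ⟨z, ⟨-, hz⟩, rfl⟩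
    rw [← iUnion_cell (ν := ν), mem_iUnion] at hz
    obtain ⟨k, hk⟩ := hz
    rw [scalarSymbol_of_mem_cell G K c hk]
    exact mem_iUnion.2 ⟨k, mem_range_self _⟩
  · rintro _ ⟨θ, rfl⟩
    obtain ⟨y, hy, hxy⟩ := (branch_periodic G K c k).exists_mem_Ico Real.two_pi_pos θ (-Real.pi)
    rw [hxy]
    set w := (y + (2 * ((k : ℝ) + 1) - 1 - ν) * Real.pi) / ν with hw
    have hwy : unfoldCell ν k w = y := by rw [unfoldCell, hw]; field_simp; ring
    have hwc : w ∈ cell ν k := by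
      refine Ico_subset_cell k ⟨?_, ?_⟩
      · rw [hw]; gcongr; linarith [hy.1]
      · rw [hw]; gcongr; linarith [hy.2]
    refine ⟨(x, w), ⟨subset_closure hx, ?_⟩, ?_⟩
    · rw [← iUnion_cell (ν := ν)]; exact mem_iUnion.2 ⟨k, hwc⟩
    · rw [scalarSymbol_of_mem_cell G K c hwc, hwy]

theorem isCompact_symbolRange [NeZero ν] {Ω : Set ℝ} (hΩ : Ω.Nonempty) :
    IsCompact (symbolRange G K (fun _ => c) Ω) := by
  rw [symbolRange_eq G K c hΩ]
  exact isCompact_iUnion fun k =>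
    (branch_periodic G K c k).compact_of_continuous Real.two_pi_pos.ne' (continuous_branch G K c k)

theorem sSup_symbolRange [NeZero ν] {Ω : Set ℝ} (hΩ : Ω.Nonempty) {x : ℝ}
    (hx : ∀ y, topBranch G K c y ≤ topBranch G K c x) :
    sSup (symbolRange G K (fun _ => c) Ω) = topBranch G K c x := by
  rw [symbolRange_eq G K c hΩ]
  refine IsGreatest.csSup_eq ⟨?_, ?_⟩
  · obtain ⟨k, hk⟩ := exists_branch_eq_topBranch G K c x
    exact mem_iUnion.2 ⟨k, x, hk⟩
  · intro t ht
    obtain ⟨k, y, rfl⟩ := mem_iUnion.1 ht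
    exact (branch_le_topBranch G K c k y).trans (hx y)

theorem sInf_symbolRange_le [NeZero ν] {Ω : Set ℝ} (hΩ : Ω.Nonempty) (x : ℝ) :
    sInf (symbolRange G K (fun _ => c) Ω) ≤ topBranch G K c x := by
  refine csInf_le (isCompact_symbolRange G K c hΩ).bddBelow ?_
  obtain ⟨k, hk⟩ := exists_branch_eq_topBranch G K c x
  rw [symbolRange_eq G K c hΩ]
  exact mem_iUnion.2 ⟨k, x, hk⟩

/-- The sum over the eigenvalue functions of the measures of the sublevel sets. -/
noncomputable def sublevelVolume (t : ℝ) : ℝ :=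
  ∑ k, volume.real (Icc (-Real.pi) Real.pi ∩ {x | branch G K c k x ≤ t})

/-- The condition does not involve x, so the set is a product and the measure of Ω cancels. Each
cell unfolds onto the whole period with scaling 1/ν, which puts `ν` into the denominator. -/
theorem distribution_eq [NeZero ν] {Ω : Set ℝ} (h0 : volume Ω ≠ 0) (hΩ : volume Ω ≠ ⊤) (t : ℝ) :
    distribution G K (fun _ => c) Ω t = sublevelVolume G K c t / (2 * Real.pi * ν) := by
  have hν : (0 : ℝ) < ν := Nat.cast_pos.2 (NeZero.pos ν)
  set E : Fin ν → Set ℝ := fun k => cell ν k ∩ {θ | branch G K c k (unfoldCell ν k θ) ≤ t} with hE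
  have hset : {z : ℝ × ℝ | z ∈ Ω ×ˢ Icc (-Real.pi) Real.pi ∧ scalarSymbol G K (fun _ => c) z ≤ t} =
      Ω ×ˢ ⋃ k, E k := by
    ext ⟨x, θ⟩
    simp only [mem_ofPred_eq, mem_prod, and_assoc, mem_iUnion, ← iUnion_cell (ν := ν), hE,
      mem_inter_iff]
    refine and_congr_right fun _ => ⟨?_, ?_⟩
    · rintro ⟨⟨k, hk⟩, h⟩
      exact ⟨k, hk, by rwa [← scalarSymbol_of_mem_cell G K c (z := (x, θ)) hk]⟩
    · rintro ⟨k, hk, h⟩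
      exact ⟨⟨k, hk⟩, by rwa [scalarSymbol_of_mem_cell G K c (z := (x, θ)) hk]⟩
  have hvolE : ∀ k, volume (E k) = ENNReal.ofReal ((ν : ℝ)⁻¹) *
      volume (Icc (-Real.pi) Real.pi ∩ {x | branch G K c k x ≤ t}) := by
    intro k
    rw [← volume_unfoldCell_preimage k, preimage_inter, unfoldCell_preimage_Icc]
    exact measure_congr ((cell_ae_eq k).inter (ae_eq_refl _))
  have hcont : ∀ k : Fin ν, Continuous (unfoldCell ν k) := fun k => by
    unfold unfoldCell; fun_prop
  have hvol : volume (⋃ k, E k) = ∑ k, volume (E k) := by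
    rw [measure_iUnion _ _, tsum_fintype]
    · intro k l hkl
      exact (pairwise_disjoint_cell hkl).mono inter_subset_left inter_subset_left
    · exact fun k => (measurableSet_cell k).inter (measurableSet_le
        ((continuous_branch G K c k).comp (hcont k)).measurable measurable_const)
  have hne : (volume Ω).toReal ≠ 0 := ENNReal.toReal_ne_zero.2 ⟨h0, hΩ⟩
  have hfin : ∀ k, volume (E k) ≠ ⊤ := fun k =>
    measure_ne_top_of_subset (inter_subset_left.trans (cell_subset_Icc k)) (by simp)
  rw [distribution, hset, Measure.volume_eq_prod, Measure.prod_prod, Measure.prod_prod,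
    ENNReal.toReal_mul, ENNReal.toReal_mul, mul_div_mul_left _ _ hne, hvol,
    ENNReal.toReal_sum fun k _ => hfin k, Real.volume_Icc]
  simp_rw [hvolE, ENNReal.toReal_mul]
  rw [← Finset.mul_sum, ENNReal.toReal_ofReal (by positivity),
    ENNReal.toReal_ofReal (by linarith [Real.pi_pos]), sublevelVolume]
  simp only [measureReal_def]
  field_simp
  ring

theorem sublevelVolume_mono : Monotone (sublevelVolume G K c) := fun s t hst =>
  Finset.sum_le_sum fun k _ => measureReal_mono
    (inter_subset_inter_right _ fun _ hx => le_trans hx hst)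
    (measure_ne_top_of_subset inter_subset_left (by simp))

theorem sublevelVolume_of_ge [NeZero ν] {t : ℝ} (ht : ∀ x, topBranch G K c x ≤ t) :
    sublevelVolume G K c t = 2 * Real.pi * ν := by
  have h1 : ∀ k, Icc (-Real.pi) Real.pi ∩ {x | branch G K c k x ≤ t} = Icc (-Real.pi) Real.pi :=
    fun k => inter_eq_left.2 fun x _ => (branch_le_topBranch G K c k x).trans (ht x)
  simp only [sublevelVolume, h1, Real.volume_real_Icc_of_le (by linarith [Real.pi_pos] :
    -Real.pi ≤ Real.pi), Finset.sum_const, Finset.card_univ, Fintype.card_fin, nsmul_eq_mul]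
  ring

/-- Where the top value lies in (s, t], a branch attaining it lies there too, so the point belongs
to the increment of that branch's sublevel set. -/
theorem volume_topBranch_le [NeZero ν] {s t : ℝ} (hst : s ≤ t) :
    volume.real (Icc (-Real.pi) Real.pi ∩ {x | s < topBranch G K c x ∧ topBranch G K c x ≤ t}) ≤
      sublevelVolume G K c t - sublevelVolume G K c s := by
  have hms : ∀ k r, MeasurableSet {x | branch G K c k x ≤ r} := fun k r =>
    measurableSet_le (continuous_branch G K c k).measurable measurable_const
  have h1 : ∀ k, volume.real (Icc (-Real.pi) Real.pi ∩ {x | branch G K c k x ≤ t}) -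
      volume.real (Icc (-Real.pi) Real.pi ∩ {x | branch G K c k x ≤ s}) =
      volume.real ((Icc (-Real.pi) Real.pi ∩ {x | branch G K c k x ≤ t}) \
        (Icc (-Real.pi) Real.pi ∩ {x | branch G K c k x ≤ s})) := fun k =>
    (measureReal_sdiff (inter_subset_inter_right _ fun _ hx => le_trans hx hst)
      (measurableSet_Icc.inter (hms k s))
      (measure_ne_top_of_subset inter_subset_left (by simp))).symm
  rw [sublevelVolume, sublevelVolume, ← Finset.sum_sub_distrib]
  simp_rw [h1]
  refine le_trans (measureReal_mono ?_ ?_) (measureReal_iUnion_fintype_le _)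
  · rintro x ⟨hx, h2, h3⟩
    obtain ⟨k, hk⟩ := exists_branch_eq_topBranch G K c x
    rw [← hk] at h2 h3
    exact mem_iUnion.2 ⟨k, ⟨hx, h3⟩, fun h => absurd h.2 (not_le.2 h2)⟩
  · exact measure_ne_top_of_subset (iUnion_subset fun k => sdiff_subset.trans inter_subset_left)
      (by simp : volume (Icc (-Real.pi) Real.pi) ≠ ⊤)

/-- The measure of the band `{s < ψ ≤ t}` is bounded below through the Lipschitz function
`√(M - ψ)`. -/
theorem sqrt_sub_sqrt_le_volume [NeZero ν] {M : ℝ} {L : NNReal}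
    (hL : LipschitzWith L fun x => √(M - topBranch G K c x)) {x₀ x₁ s t : ℝ}
    (hx₀ : x₀ ∈ Icc (-Real.pi) Real.pi) (hx₁ : x₁ ∈ Icc (-Real.pi) Real.pi)
    (h₀ : topBranch G K c x₀ = M) (h₁ : topBranch G K c x₁ ≤ s) (hM : ∀ x, topBranch G K c x ≤ M) :
    √(M - s) - √(M - t) ≤ L * volume.real
      (Icc (-Real.pi) Real.pi ∩ {x | s < topBranch G K c x ∧ topBranch G K c x ≤ t}) := by
  set u := fun x => √(M - topBranch G K c x) with hu
  set E := Icc (-Real.pi) Real.pi ∩ {x | s < topBranch G K c x ∧ topBranch G K c x ≤ t} with hE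
  have hfin : volume E ≠ ⊤ := measure_ne_top_of_subset inter_subset_left (by simp)
  -- `u` is 0 at `x₀` and at least √(M - s) at `x₁`, so it takes every intermediate value; the two
  -- square roots delimit exactly the band `E`.
  have hsub : Ico √(M - t) √(M - s) ⊆ u '' E := by
    intro y hy
    have hy0 : 0 ≤ y := (Real.sqrt_nonneg _).trans hy.1
    have hus : √(M - s) ≤ u x₁ := Real.sqrt_le_sqrt (by linarith)
    obtain ⟨x, hx, hxy⟩ := (isPreconnected_Icc.intermediate_value hx₀ hx₁ hL.continuous.continuousOn)
      (show y ∈ Icc (u x₀) (u x₁) from ⟨by simpa [hu, h₀] using hy0, hy.2.le.trans hus⟩)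
    have hxM := hM x
    have h1 : u x < √(M - s) := by rw [hxy]; exact hy.2
    have h2 : √(M - t) ≤ u x := by rw [hxy]; exact hy.1
    refine ⟨x, ⟨hx, ?_, ?_⟩, hxy⟩
    · have := (Real.sqrt_lt_sqrt_iff (by linarith)).1 h1
      linarith
    · by_contra! h
      rcases le_or_gt (M - t) 0 with h3 | h3
      · linarith
      · have := (Real.sqrt_lt_sqrt_iff_of_pos h3).2 (show M - topBranch G K c x < M - t by linarith)
        exact absurd h2 (not_le.2 this)
  -- On the line, length is one-dimensional Hausdorff measure, which an `L`-Lipschitz map enlarges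
  -- at most by the factor `L`.
  have h2 : volume (u '' E) ≤ L * volume E := by
    have := hL.hausdorffMeasure_image_le (d := 1) zero_le_one E
    simpa [hausdorffMeasure_real] using this
  have h3 := (measure_mono hsub).trans h2
  rw [Real.volume_Ico] at h3
  have h4 := ENNReal.toReal_mono (ENNReal.mul_ne_top ENNReal.coe_ne_top hfin) h3
  rw [ENNReal.toReal_mul, ENNReal.coe_toReal] at h4
  exact ((le_max_left _ _).trans_eq ENNReal.toReal_ofReal'.symm).trans h4

/-- The regularity of the monotone rearrangement at its right end. -/
theorem rearrangement_regular [NeZero ν] {Ω : Set ℝ} (hΩ : IsRegularDomain Ω) :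
    DifferentiableWithinAt ℝ (rearrangement G K (fun _ => c) Ω) (Icc 0 1) 1 ∧
      (∀ᶠ x in 𝓝[<] (1 : ℝ), DifferentiableAt ℝ (rearrangement G K (fun _ => c) Ω) x) ∧
      Tendsto (deriv (rearrangement G K (fun _ => c) Ω)) (𝓝[<] 1) (𝓝 0) := by
  have hne : Ω.Nonempty := nonempty_of_measure_ne_zero hΩ.pos.ne'
  have hfin : volume Ω ≠ ⊤ := measure_ne_top_of_subset hΩ.subset (by simp)
  have hν : (0 : ℝ) < ν := Nat.cast_pos.2 (NeZero.pos ν)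
  have hπ := Real.pi_pos
  have hA : 0 < 2 * Real.pi * ν := by positivity
  obtain ⟨x₀, hx₀, hmax⟩ := exists_topBranch_max G K c
  set M := topBranch G K c x₀ with hM
  set φ := distribution G K (fun _ => c) Ω with hφ
  have hφeq : φ = fun t => sublevelVolume G K c t / (2 * Real.pi * ν) :=
    funext fun t => distribution_eq G K c hΩ.pos.ne' hfin t
  have hR : rearrangement G K (fun _ => c) Ω =
      genInverse φ (sInf (symbolRange G K (fun _ => c) Ω)) M := by
    rw [hM, ← sSup_symbolRange G K c hne hmax]; rfl
  have hmM := sInf_symbolRange_le G K c hne x₀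
  have hφM : φ M = 1 := by
    rw [hφeq]
    simp only [sublevelVolume_of_ge G K c hmax]
    exact div_self hA.ne'
  have hmono : Monotone φ := by
    rw [hφeq]
    exact fun s t hst => div_le_div_of_nonneg_right (sublevelVolume_mono G K c hst) hA.le
  have hinc : ∀ s t, s ≤ t → volume.real (Icc (-Real.pi) Real.pi ∩
      {x | s < topBranch G K c x ∧ topBranch G K c x ≤ t}) / (2 * Real.pi * ν) ≤ φ t - φ s := by
    intro s t hst
    simp only [hφeq]
    rw [← sub_div]
    exact div_le_div_of_nonneg_right (volume_topBranch_le G K c hst) hA.le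
  rw [hR]
  by_cases hgap : ∃ κ > 0, ∀ t < M, φ t ≤ 1 - κ
  · obtain ⟨κ, hκ, h⟩ := hgap
    exact genInverse_of_gap hmM hφM hκ h
  push Not at hgap
  have hsup : ∀ x < 1, ∃ t < M, x < φ t := fun x hx => by
    obtain ⟨t, ht, h⟩ := hgap (1 - x) (by linarith)
    exact ⟨t, ht, by linarith⟩
  -- A constant top branch would put a jump of at least 1/ν into the distribution at `M`, which the
  -- present case excludes.
  obtain ⟨x₁, hx₁, hlt⟩ : ∃ x ∈ Icc (-Real.pi) Real.pi, topBranch G K c x < M := by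
    by_contra! hall
    obtain ⟨t, ht, h⟩ := hsup (1 - (ν : ℝ)⁻¹) (by have := inv_pos.2 hν; linarith)
    have h1 := hinc t M ht.le
    have h2 : Icc (-Real.pi) Real.pi ∩ {x | t < topBranch G K c x ∧ topBranch G K c x ≤ M} =
        Icc (-Real.pi) Real.pi :=
      inter_eq_left.2 fun x hx => ⟨ht.trans_le (hall x hx), hmax x⟩
    rw [h2, Real.volume_real_Icc_of_le (by linarith), hφM] at h1
    have h3 : (Real.pi - -Real.pi) / (2 * Real.pi * ν) = (ν : ℝ)⁻¹ := by field_simp; ring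
    rw [h3] at h1
    linarith
  obtain ⟨L, hL, hLip⟩ := exists_lipschitz_sqrt_sub_topBranch G K c hmax
  obtain ⟨B, hB, hBd⟩ := exists_finite_differentiableAt_volume_branch G K c
  obtain ⟨ε, hε, hεB⟩ : ∃ ε > 0, ∀ t ∈ Ioo (M - ε) M, t ∉ B := by
    -- `M` may itself be an exceptional level; only the levels just below it have to be regular.
    have h1 : (B \ {M})ᶜ ∈ 𝓝 M := (hB.subset sdiff_subset).isClosed.isOpen_compl.mem_nhds
      (fun h => h.2 rfl)
    obtain ⟨ε, hε, hball⟩ := Metric.mem_nhds_iff.1 h1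
    refine ⟨ε, hε, fun t ht htB => hball (a := t) ?_ ⟨htB, ht.2.ne⟩⟩
    rw [Metric.mem_ball, Real.dist_eq, abs_lt]
    constructor <;> linarith [ht.1, ht.2]
  -- The second entry makes ψ(x₁) ≤ s for every `s` in the window, as the band estimate requires,
  -- and keeps the window above the minimum of the symbol.
  set e := min ε (M - topBranch G K c x₁) with he
  have he0 : 0 < e := lt_min hε (by linarith)
  have he1 : e ≤ ε := min_le_left _ _
  have he2 : e ≤ M - topBranch G K c x₁ := min_le_right _ _
  have hL' : (0 : ℝ) < L := hL
  refine genInverse_of_sqrt_le (ε := e) (K := (L * (2 * Real.pi * ν))⁻¹) hmono hφM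
    (by positivity) he0 ?_ ?_ ?_ hsup
  · have := sInf_symbolRange_le G K c hne x₁
    linarith
  · intro t ht
    rw [hφeq]
    refine DifferentiableAt.div_const (DifferentiableAt.fun_sum fun k _ => ?_) _
    exact hBd t (hεB t ⟨by linarith [ht.1], ht.2⟩) k
  · intro s hs t ht hst
    refine le_trans ?_ (hinc s t hst)
    have := sqrt_sub_sqrt_le_volume G K c hLip (t := t) hx₀ hx₁ rfl
      (show topBranch G K c x₁ ≤ s by linarith [hs.1]) hmax
    rw [mul_inv, mul_comm ((L : ℝ)⁻¹), mul_assoc, inv_mul_eq_div]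
    refine div_le_div_of_nonneg_right ?_ hA.le
    rw [inv_mul_le_iff₀ hL']
    exact this

end Distribution

/-! ### Fourier coefficients of the symbol. -/

section Coefficients

variable {ν m : ℕ} (G : WeightedGraph (Fin ν)) (K : Links ν m)

/-- The Fourier coefficients of the symbol, which are the blocks of the adjacency matrix. -/
noncomputable def coef (d : ℤ) (r s : Fin ν) : ℝ :=
  (if d = 0 then G.weight r s else 0) +
    ∑ k, ((if d = (K.t k : ℤ) then K.L k r s else 0) +
      (if d = -(K.t k : ℤ) then K.L k s r else 0))

theorem diamondGraph_weight_eq_coef (n : ℕ) (u v : Fin n × Fin ν) :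
    (diamondGraph G K n).weight u v = coef G K ((u.1 : ℤ) - (v.1 : ℤ)) u.2 v.2 := by
  simp only [diamondGraph, coef]
  congr 1
  refine if_congr ?_ rfl rfl
  rw [sub_eq_zero, Fin.ext_iff, Nat.cast_inj]

/-- A bound for the bandwidth. -/
def bandwidth (K : Links ν m) : ℤ := ∑ k, (K.t k : ℤ)

theorem le_bandwidth (k : Fin m) : (K.t k : ℤ) ≤ bandwidth K :=
  Finset.single_le_sum (f := fun k => (K.t k : ℤ)) (fun _ _ => by positivity) (Finset.mem_univ k)

theorem bandwidth_nonneg : 0 ≤ bandwidth K := Finset.sum_nonneg fun _ _ => by positivity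

theorem coef_eq_zero {d : ℤ} (hd : d ∉ Finset.Icc (-bandwidth K) (bandwidth K)) (r s : Fin ν) :
    coef G K d r s = 0 := by
  rw [Finset.mem_Icc] at hd
  have h0 := bandwidth_nonneg K
  have h1 : ∀ k, d ≠ K.t k ∧ d ≠ -(K.t k : ℤ) := fun k => by
    have := le_bandwidth K k
    constructor <;> omega
  rw [coef, if_neg (by omega), zero_add]
  exact Finset.sum_eq_zero fun k _ => by rw [if_neg (h1 k).1, if_neg (h1 k).2, add_zero]

theorem symbol_eq_sum_coef (θ : ℝ) (r s : Fin ν) :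
    symbol G K θ r s = ∑ d ∈ Finset.Icc (-bandwidth K) (bandwidth K),
      (coef G K d r s : ℂ) * Complex.exp ((d * θ : ℝ) * Complex.I) := by
  have h0 := bandwidth_nonneg K
  have hm0 : (0 : ℤ) ∈ Finset.Icc (-bandwidth K) (bandwidth K) := by
    rw [Finset.mem_Icc]; omega
  have hm1 : ∀ k, (K.t k : ℤ) ∈ Finset.Icc (-bandwidth K) (bandwidth K) := fun k => by
    have := le_bandwidth K k
    rw [Finset.mem_Icc]; omega
  have hm2 : ∀ k, -(K.t k : ℤ) ∈ Finset.Icc (-bandwidth K) (bandwidth K) := fun k => by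
    have := le_bandwidth K k
    rw [Finset.mem_Icc]; omega
  rw [symbol_apply_eq_exp]
  simp only [coef, Complex.ofReal_add, Complex.ofReal_sum, add_mul, Finset.sum_mul,
    Finset.sum_add_distrib]
  congr 1
  · rw [Finset.sum_eq_single_of_mem 0 hm0 fun d _ hd => by rw [if_neg hd]; simp]
    simp
  congr 1
  · rw [Finset.sum_comm]
    refine Finset.sum_congr rfl fun k _ => ?_
    rw [Finset.sum_eq_single_of_mem _ (hm1 k) fun d _ hd => by rw [if_neg hd]; simp]
    simp
  · rw [Finset.sum_comm]
    refine Finset.sum_congr rfl fun k _ => ?_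
    rw [Finset.sum_eq_single_of_mem _ (hm2 k) fun d _ hd => by rw [if_neg hd]; simp]
    simp

theorem integral_exp_int (d : ℤ) :
    ∫ θ in (-Real.pi)..Real.pi, Complex.exp ((d * θ : ℝ) * Complex.I) =
      if d = 0 then 2 * (Real.pi : ℂ) else 0 := by
  split_ifs with hd
  · subst hd
    simp only [Int.cast_zero, zero_mul, Complex.ofReal_zero, Complex.exp_zero,
      intervalIntegral.integral_const, sub_neg_eq_add, Complex.real_smul, mul_one]
    push_cast; ring
  · have h1 : ∀ θ : ℝ, ((d * θ : ℝ) : ℂ) * Complex.I = (d * Complex.I) * θ := fun θ => by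
      push_cast; ring
    simp_rw [h1]
    rw [integral_exp_mul_complex (mul_ne_zero (by exact_mod_cast hd) Complex.I_ne_zero)]
    have h2 : Complex.exp (d * Complex.I * (Real.pi : ℂ)) =
        Complex.exp (d * Complex.I * ((-Real.pi : ℝ) : ℂ)) := by
      rw [Complex.exp_eq_exp_iff_exists_int]
      exact ⟨d, by push_cast; ring⟩
    rw [h2, sub_self, zero_div]

theorem integral_symbol (d : ℤ) (r s : Fin ν) :
    ∫ θ in (-Real.pi)..Real.pi, Complex.exp (((-d : ℤ) * θ : ℝ) * Complex.I) * symbol G K θ r s =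
      2 * Real.pi * (coef G K d r s : ℂ) := by
  have h1 : ∀ θ : ℝ, Complex.exp (((-d : ℤ) * θ : ℝ) * Complex.I) * symbol G K θ r s =
      ∑ e ∈ Finset.Icc (-bandwidth K) (bandwidth K),
        (coef G K e r s : ℂ) * Complex.exp (((e - d : ℤ) * θ : ℝ) * Complex.I) := by
    intro θ
    rw [symbol_eq_sum_coef, Finset.mul_sum]
    refine Finset.sum_congr rfl fun e _ => ?_
    rw [mul_left_comm, ← Complex.exp_add]
    congr 2
    push_cast; ring
  simp_rw [h1]
  rw [intervalIntegral.integral_finsetSum fun e _ =>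
    (Continuous.intervalIntegrable (by fun_prop) _ _)]
  simp_rw [intervalIntegral.integral_const_mul, integral_exp_int, sub_eq_zero]
  by_cases hd : d ∈ Finset.Icc (-bandwidth K) (bandwidth K)
  · rw [Finset.sum_eq_single_of_mem d hd fun e _ he => by rw [if_neg he, mul_zero], if_pos rfl]
    ring
  · rw [coef_eq_zero G K hd, Complex.ofReal_zero, mul_zero]
    refine Finset.sum_eq_zero fun e he => ?_
    rw [if_neg (by rintro rfl; exact hd he), mul_zero]

end Coefficients

/-! ### Positivity of finite Toeplitz sections and the upper spectral bound. -/

/-- A finite section of a block Toeplitz operator with nonnegative symbol has a nonnegative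
quadratic form. The rows are indexed by a finite type through a block index `p` and an inner
index `q`. -/
theorem toeplitz_form_nonneg {V I : Type} [Fintype V] [Fintype I] [DecidableEq I]
    (p : V → ℤ) (q : V → I) {A : ℝ → Matrix I I ℂ} {b : ℤ → I → I → ℝ}
    (hc : ∀ r s, Continuous fun θ => A θ r s)
    (hb : ∀ d r s, ∫ θ in (-Real.pi)..Real.pi,
      Complex.exp (((-d : ℤ) * θ : ℝ) * Complex.I) * A θ r s = 2 * Real.pi * (b d r s : ℂ))
    (hA : ∀ θ v, 0 ≤ quadForm (A θ) v) (x : V → ℝ) :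
    0 ≤ ∑ u, ∑ v, x u * b (p u - p v) (q u) (q v) * x v := by
  -- `x` is read as a vector of trigonometric polynomials. Integrating the form of A(θ) on it over a
  -- period picks out the Fourier coefficients with index p u - p v, hence 2π times the finite
  -- section.
  set y : ℝ → I → ℂ := fun θ r =>
    ∑ u, if q u = r then (x u : ℂ) * Complex.exp ((p u * θ : ℝ) * Complex.I) else 0 with hy
  set F : ℝ → ℂ := fun θ => ∑ u, ∑ v, (x u * x v : ℂ) *
    (Complex.exp (((-(p u - p v) : ℤ) * θ : ℝ) * Complex.I) * A θ (q u) (q v)) with hF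
  have hFc : ∀ u v, Continuous fun θ : ℝ => (x u * x v : ℂ) *
      (Complex.exp (((-(p u - p v) : ℤ) * θ : ℝ) * Complex.I) * A θ (q u) (q v)) := fun u v => by
    have := hc (q u) (q v)
    fun_prop
  have hFre : ∀ θ, (F θ).re = quadForm (A θ) (y θ) := by
    intro θ
    have hsum : ∀ (g : I → ℂ) (w : V → ℂ),
        ∑ r, (∑ u, if q u = r then w u else 0) * g r = ∑ u, w u * g (q u) := by
      intro g w
      simp_rw [Finset.sum_mul]
      rw [Finset.sum_comm]
      refine Finset.sum_congr rfl fun u _ => ?_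
      simp [ite_mul]
    have h1 : star (y θ) = fun r => ∑ u, if q u = r then
        (x u : ℂ) * Complex.exp (-((p u * θ : ℝ) * Complex.I)) else 0 := by
      ext r
      simp only [hy, Pi.star_apply, star_sum]
      refine Finset.sum_congr rfl fun u _ => ?_
      split_ifs
      · rw [star_mul', RCLike.star_def, Complex.conj_ofReal, ← Complex.exp_conj,
          map_mul, Complex.conj_ofReal, Complex.conj_I, mul_neg]
      · simp
    have h2 : ∀ r, (A θ).mulVec (y θ) r =
        ∑ v, ((x v : ℂ) * Complex.exp ((p v * θ : ℝ) * Complex.I)) * A θ r (q v) := by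
      intro r
      rw [← hsum (fun s => A θ r s)]
      simp only [Matrix.mulVec, dotProduct, hy]
      exact Finset.sum_congr rfl fun s _ => mul_comm _ _
    rw [quadForm, h1, dotProduct, hsum]
    change _ = Complex.re _
    congr 1
    refine Finset.sum_congr rfl fun u _ => ?_
    rw [h2, Finset.mul_sum]
    refine Finset.sum_congr rfl fun v _ => ?_
    have : Complex.exp (((-(p u - p v) : ℤ) * θ : ℝ) * Complex.I) =
        Complex.exp (-((p u * θ : ℝ) * Complex.I)) * Complex.exp ((p v * θ : ℝ) * Complex.I) := by
      rw [← Complex.exp_add]; congr 1; push_cast; ring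
    rw [this]
    ring
  have hint : ∫ θ in (-Real.pi)..Real.pi, F θ =
      ((2 * Real.pi * ∑ u, ∑ v, x u * b (p u - p v) (q u) (q v) * x v : ℝ) : ℂ) := by
    simp only [hF]
    rw [intervalIntegral.integral_finsetSum fun u _ =>
      (continuous_finsetSum _ fun v _ => hFc u v).intervalIntegrable _ _]
    rw [Complex.ofReal_mul, Complex.ofReal_sum, Finset.mul_sum]
    refine Finset.sum_congr rfl fun u _ => ?_
    rw [intervalIntegral.integral_finsetSum fun v _ => (hFc u v).intervalIntegrable _ _,
      Complex.ofReal_sum, Finset.mul_sum]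
    refine Finset.sum_congr rfl fun v _ => ?_
    rw [intervalIntegral.integral_const_mul, hb]
    push_cast
    ring
  have hFcont : Continuous F :=
    continuous_finsetSum _ fun u _ => continuous_finsetSum _ fun v _ => hFc u v
  have hre : ∫ θ in (-Real.pi)..Real.pi, (F θ).re = (∫ θ in (-Real.pi)..Real.pi, F θ).re :=
    Complex.reCLM.intervalIntegral_comp_comm (hFcont.intervalIntegrable _ _)
  have hpos : 0 ≤ ∫ θ in (-Real.pi)..Real.pi, (F θ).re :=
    intervalIntegral.integral_nonneg (by linarith [Real.pi_pos]) fun θ _ => by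
      rw [hFre]; exact hA _ _
  rw [hre, hint, Complex.ofReal_re] at hpos
  exact nonneg_of_mul_nonneg_right hpos (by linarith [Real.pi_pos])

section GridGraph

variable {ν m : ℕ} (G : WeightedGraph (Fin ν)) (K : Links ν m) (c : ℝ) (Ω : Set ℝ) (n : ℕ)

theorem quadForm_gridGraph (x : Node ν n Ω → ℝ) :
    quadForm (gridGraph G K (fun _ => c) Ω n).adjMatrix x =
      ∑ u, ∑ v, x u * (c * coef G K ((u.1.1 : ℤ) - (v.1.1 : ℤ)) u.1.2 v.1.2) * x v := by
  simp [quadForm, dotProduct, Matrix.mulVec, WeightedGraph.adjMatrix, gridGraph,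
    diamondGraph_weight_eq_coef, Finset.mul_sum, mul_assoc]

/-- M - c f(θ) is positive semidefinite for every θ, hence so are its finite Toeplitz sections. The
domain Ω merely selects the indices of the section. -/
theorem quadForm_gridGraph_le [NeZero ν] {M : ℝ} (hM : ∀ θ, topBranch G K c θ ≤ M)
    (x : Node ν n Ω → ℝ) :
    quadForm (gridGraph G K (fun _ => c) Ω n).adjMatrix x ≤ M * normSq x := by
  have key := toeplitz_form_nonneg (V := Node ν n Ω) (fun u => (u.1.1 : ℤ)) (fun u => u.1.2)
    (A := fun θ => Matrix.scalar (Fin ν) (M : ℂ) - c • symbol G K θ)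
    (b := fun d r s => (if d = 0 then if r = s then M else 0 else 0) - c * coef G K d r s)
    ?_ ?_ ?_ x
  · rw [quadForm_gridGraph]
    have h1 : ∑ u : Node ν n Ω, ∑ v : Node ν n Ω,
        x u * (if (u.1.1 : ℤ) - (v.1.1 : ℤ) = 0 then if u.1.2 = v.1.2 then M else 0 else 0) * x v =
        M * normSq x := by
      rw [normSq, Finset.mul_sum]
      refine Finset.sum_congr rfl fun u _ => ?_
      rw [Finset.sum_eq_single u]
      · rw [sub_self, if_pos rfl, if_pos rfl, Real.norm_eq_abs, sq_abs]; ring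
      · intro v _ hv
        by_cases h : (u.1.1 : ℤ) - (v.1.1 : ℤ) = 0
        · rw [if_pos h, if_neg, mul_zero, zero_mul]
          intro h'
          refine hv (Subtype.ext (Prod.ext (Fin.ext ?_) h'.symm))
          omega
        · rw [if_neg h, mul_zero, zero_mul]
      · simp
    rw [← h1, ← sub_nonneg, ← Finset.sum_sub_distrib]
    refine key.trans_eq (Finset.sum_congr rfl fun u _ => ?_)
    rw [← Finset.sum_sub_distrib]
    exact Finset.sum_congr rfl fun v _ => by ring
  · intro r s
    have := continuous_symbol_apply G K r s
    simp only [Matrix.sub_apply, Matrix.smul_apply]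
    fun_prop
  · intro d r s
    have hc1 : Continuous fun θ : ℝ => Complex.exp (((-d : ℤ) * θ : ℝ) * Complex.I) := by fun_prop
    have hc2 := continuous_symbol_apply G K r s
    have h1 : ∀ θ : ℝ, Complex.exp (((-d : ℤ) * θ : ℝ) * Complex.I) *
        (Matrix.scalar (Fin ν) (M : ℂ) - c • symbol G K θ) r s =
        (if r = s then (M : ℂ) else 0) * Complex.exp (((-d : ℤ) * θ : ℝ) * Complex.I) -
          c * (Complex.exp (((-d : ℤ) * θ : ℝ) * Complex.I) * symbol G K θ r s) := fun θ => by
      simp only [Matrix.sub_apply, Matrix.scalar_apply, Matrix.diagonal_apply, Matrix.smul_apply,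
        Complex.real_smul]
      ring
    simp_rw [h1]
    rw [intervalIntegral.integral_sub (Continuous.intervalIntegrable (by fun_prop) _ _)
      (Continuous.intervalIntegrable (by fun_prop) _ _), intervalIntegral.integral_const_mul,
      intervalIntegral.integral_const_mul, integral_symbol, integral_exp_int]
    simp only [neg_eq_zero]
    split_ifs <;> push_cast <;> ring
  · intro θ v
    have h1 : quadForm (Matrix.scalar (Fin ν) (M : ℂ) - c • symbol G K θ) v =
        M * normSq v - quadForm (c • symbol G K θ) v := by
      have : star v ⬝ᵥ v = ((normSq v : ℝ) : ℂ) := by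
        simp [dotProduct, normSq, Complex.conj_mul']
      rw [quadForm, Matrix.sub_mulVec, dotProduct_sub, map_sub, Matrix.scalar_apply,
        ← Matrix.smul_one_eq_diagonal, Matrix.smul_mulVec, Matrix.one_mulVec, dotProduct_smul,
        this, smul_eq_mul, ← Complex.ofReal_mul]
      rfl
    rw [h1, sub_nonneg]
    refine (quadForm_symbol_le G K c θ v).trans (mul_le_mul_of_nonneg_right (hM θ) ?_)
    exact Finset.sum_nonneg fun i _ => by positivity

end GridGraph

/-! ### Tent functions and their autocorrelation. -/

section Tent

/-- The tent function of height and half-width `q` with centre `a`. -/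
noncomputable def tent (q : ℕ) (a j : ℤ) : ℝ := max ((q : ℝ) - |(j : ℝ) - a|) 0

theorem tent_eq_zero {q : ℕ} {a j : ℤ} (h : j ∉ Finset.Icc (a - q) (a + q)) : tent q a j = 0 := by
  refine max_eq_right ?_
  have h1 : (q : ℤ) ≤ |j - a| := by
    rw [Finset.mem_Icc, not_and_or] at h
    rw [le_abs]
    omega
  have h2 : (q : ℝ) ≤ |(j : ℝ) - a| := by exact_mod_cast h1
  linarith

theorem abs_tent_sub_le (q : ℕ) (a i j : ℤ) : |tent q a i - tent q a j| ≤ |(i : ℝ) - j| := by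
  refine (abs_max_sub_max_le_abs _ _ _).trans ?_
  have : (q : ℝ) - |(i : ℝ) - a| - (q - |(j : ℝ) - a|) = |(j : ℝ) - a| - |(i : ℝ) - a| := by ring
  rw [this]
  refine (abs_abs_sub_abs_le_abs_sub _ _).trans_eq ?_
  rw [abs_sub_comm]; congr 1; ring

/-- On the middle half, |i - a| ≤ ⌊q/2⌋, the tent is at least q/2, and there are at least `q` such
integers. -/
theorem le_sum_tent_sq (q : ℕ) (a : ℤ) :
    (q : ℝ) ^ 3 / 4 ≤ ∑ i ∈ Finset.Icc (a - q) (a + q), tent q a i ^ 2 := by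
  have h1 : ∑ i ∈ Finset.Icc (a - (q / 2 : ℕ)) (a + (q / 2 : ℕ)), ((q : ℝ) / 2) ^ 2 ≤
      ∑ i ∈ Finset.Icc (a - (q / 2 : ℕ)) (a + (q / 2 : ℕ)), tent q a i ^ 2 := by
    refine Finset.sum_le_sum fun i hi => ?_
    rw [Finset.mem_Icc] at hi
    have h2 : |i - a| ≤ (q / 2 : ℕ) := by rw [abs_le]; omega
    have h3 : |(i : ℝ) - a| ≤ ((q / 2 : ℕ) : ℝ) := by
      have := (Int.cast_le (R := ℝ)).2 h2
      rwa [Int.cast_abs, Int.cast_sub, Int.cast_natCast] at this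
    have h4 : ((q / 2 : ℕ) : ℝ) ≤ (q : ℝ) / 2 := Nat.cast_div_le
    gcongr
    exact le_max_of_le_left (by linarith)
  have h5 : ∑ i ∈ Finset.Icc (a - (q / 2 : ℕ)) (a + (q / 2 : ℕ)), tent q a i ^ 2 ≤
      ∑ i ∈ Finset.Icc (a - q) (a + q), tent q a i ^ 2 :=
    Finset.sum_le_sum_of_subset_of_nonneg (Finset.Icc_subset_Icc (by omega) (by omega))
      fun i _ _ => sq_nonneg _
  refine le_trans ?_ (h1.trans h5)
  rw [Finset.sum_const, nsmul_eq_mul, Int.card_Icc]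
  have h6 : (q : ℝ) ≤ ((a + (q / 2 : ℕ) + 1 - (a - (q / 2 : ℕ))).toNat : ℝ) := by
    exact_mod_cast (by omega : q ≤ (a + (q / 2 : ℕ) + 1 - (a - (q / 2 : ℕ))).toNat)
  calc (q : ℝ) ^ 3 / 4 = q * ((q : ℝ) / 2) ^ 2 := by ring
    _ ≤ _ := by gcongr

/-- The autocorrelation of a finitely supported `1`-Lipschitz function. -/
theorem abs_sum_sq_sub_autocorrelation_le {η : ℤ → ℝ} {lo hi : ℤ} (hlh : lo ≤ hi)
    (h0 : ∀ j ∉ Finset.Icc lo hi, η j = 0) (hL : ∀ i j, |η i - η j| ≤ |(i : ℝ) - j|) (d : ℤ) :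
    |∑ i ∈ Finset.Icc lo hi, η i ^ 2 -
      ∑ i ∈ Finset.Icc lo hi, ∑ j ∈ Finset.Icc lo hi, if i - j = d then η i * η j else 0| ≤
      (d : ℝ) ^ 2 * ((hi : ℝ) - lo + 1 + 2 * |(d : ℝ)|) := by
  set S := Finset.Icc lo hi with hS
  set N := ∑ i ∈ S, η i ^ 2 with hN
  have hin : ∀ i, (∑ j ∈ S, if i - j = d then η i * η j else 0) = η i * η (i - d) := by
    intro i
    by_cases hi : i - d ∈ S
    · rw [Finset.sum_eq_single_of_mem _ hi fun j _ hj => if_neg (by omega), if_pos (by omega)]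
    · rw [h0 _ hi, mul_zero]
      exact Finset.sum_eq_zero fun j hj => if_neg fun h => hi (by
        rwa [show i - d = j by omega])
  simp_rw [hin]
  set C := ∑ i ∈ S, η i * η (i - d) with hC
  -- Sums over all integers are shift invariant without boundary terms, so 2 (N - C) is the sum of
  -- (η i - η (i - d))²: each term is at most d², and nonzero ones occur only in the window enlarged
  -- by |d| on both sides.
  have hsN : HasSum (fun i => η i ^ 2) N :=
    hasSum_sum_of_ne_finset_zero fun j hj => by rw [h0 j hj]; ring
  have hsN' : HasSum (fun i => η (i - d) ^ 2) N := (Equiv.subRight d).hasSum_iff.2 hsN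
  have hsC : HasSum (fun i => η i * η (i - d)) C :=
    hasSum_sum_of_ne_finset_zero fun j hj => by rw [h0 j hj]; ring
  have hs : HasSum (fun i => (η i - η (i - d)) ^ 2) (2 * (N - C)) := by
    have := (hsN.add hsN').sub (hsC.mul_left 2)
    rw [show 2 * (N - C) = N + N - 2 * C by ring]
    refine HasSum.congr_fun this fun i => ?_
    ring
  have hs' : HasSum (fun i => (η i - η (i - d)) ^ 2)
      (∑ i ∈ Finset.Icc (lo - |d|) (hi + |d|), (η i - η (i - d)) ^ 2) :=
    hasSum_sum_of_ne_finset_zero fun j hj => by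
      have h1 := le_abs_self d
      have h2 := neg_abs_le d
      rw [Finset.mem_Icc] at hj
      rw [h0 j (by rw [hS, Finset.mem_Icc]; omega), h0 (j - d) (by rw [hS, Finset.mem_Icc]; omega)]
      ring
  have heq := hs.unique hs'
  have hnn : 0 ≤ ∑ i ∈ Finset.Icc (lo - |d|) (hi + |d|), (η i - η (i - d)) ^ 2 :=
    Finset.sum_nonneg fun _ _ => sq_nonneg _
  have hle : ∑ i ∈ Finset.Icc (lo - |d|) (hi + |d|), (η i - η (i - d)) ^ 2 ≤
      ((hi : ℝ) - lo + 1 + 2 * |(d : ℝ)|) * (d : ℝ) ^ 2 := by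
    have h1 : ∀ i ∈ Finset.Icc (lo - |d|) (hi + |d|), (η i - η (i - d)) ^ 2 ≤ (d : ℝ) ^ 2 := by
      intro i _
      have h2 := hL i (i - d)
      rw [← sq_abs, ← sq_abs (d : ℝ)]
      have h3 : (i : ℝ) - ((i - d : ℤ) : ℝ) = d := by push_cast; ring
      rw [h3] at h2
      gcongr
    refine (Finset.sum_le_card_nsmul _ _ _ h1).trans_eq ?_
    rw [nsmul_eq_mul, Int.card_Icc]
    congr 1
    have h4 : 0 ≤ hi + |d| + 1 - (lo - |d|) := by have := abs_nonneg d; omega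
    have h5 : (((hi + |d| + 1 - (lo - |d|)).toNat : ℤ) : ℝ) = ((hi + |d| + 1 - (lo - |d|) : ℤ) : ℝ) := by
      rw [Int.toNat_of_nonneg h4]
    rw [Int.cast_natCast] at h5
    rw [h5]
    push_cast
    ring
  rw [abs_of_nonneg (by linarith)]
  nlinarith

end Tent

/-! ### Wave packets with nearly maximal Rayleigh quotient. -/

section TestVector

variable {ν m : ℕ} (G : WeightedGraph (Fin ν)) (K : Links ν m) (c : ℝ)

/-- A function supported on copies of the mold graph that lie entirely in Ω does not see the shape
of Ω, so node sums split into a sum over copies and a sum inside a copy. -/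
theorem sum_node_eq {Ω : Set ℝ} {n : ℕ} {S : Finset ℤ}
    (hS : ∀ j ∈ S, ∀ r, ∃ u : Node ν n Ω, (u.1.1 : ℤ) = j ∧ u.1.2 = r) (g : ℤ → Fin ν → ℝ)
    (hg : ∀ j ∉ S, ∀ r, g j r = 0) :
    ∑ u : Node ν n Ω, g (u.1.1 : ℤ) u.1.2 = ∑ j ∈ S, ∑ r, g j r := by
  classical
  let e : Node ν n Ω → ℤ × Fin ν := fun u => ((u.1.1 : ℤ), u.1.2)
  have he : Function.Injective e := fun u v h => by
    simp only [e, Prod.mk.injEq] at h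
    exact Subtype.ext (Prod.ext (Fin.ext (by omega)) h.2)
  rw [← Finset.sum_product', ← Finset.sum_image (s := Finset.univ) (g := e)
    (f := fun z => g z.1 z.2) he.injOn]
  symm
  refine Finset.sum_subset (fun z hz => ?_) fun z _ hz => ?_
  · rw [Finset.mem_product] at hz
    obtain ⟨u, hu1, hu2⟩ := hS z.1 hz.1 z.2
    exact Finset.mem_image.2 ⟨u, Finset.mem_univ u, Prod.ext hu1 hu2⟩
  · exact hg _ (fun h => hz (Finset.mem_product.2 ⟨h, Finset.mem_univ _⟩)) _

/-- The coefficients of the scalar Toeplitz form obtained by testing with `e^{-ijθ} v`. -/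
noncomputable def scalarCoef (θ : ℝ) (v : Fin ν → ℂ) (d : ℤ) : ℝ :=
  ∑ r, ∑ s, c * coef G K d r s * (Complex.exp ((d * θ : ℝ) * Complex.I) * (star (v r) * v s)).re

theorem scalarCoef_eq_zero (θ : ℝ) (v : Fin ν → ℂ) {d : ℤ}
    (hd : d ∉ Finset.Icc (-bandwidth K) (bandwidth K)) : scalarCoef G K c θ v d = 0 := by
  simp [scalarCoef, coef_eq_zero G K hd]

theorem sum_scalarCoef (θ : ℝ) (v : Fin ν → ℂ) :
    ∑ d ∈ Finset.Icc (-bandwidth K) (bandwidth K), scalarCoef G K c θ v d =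
      quadForm (c • symbol G K θ) v := by
  have h1 : quadForm (c • symbol G K θ) v =
      ∑ r, ∑ s, (star (v r) * ((c : ℂ) * symbol G K θ r s * v s)).re := by
    simp [quadForm, dotProduct, Matrix.mulVec, Finset.mul_sum]
  rw [h1]
  simp only [scalarCoef]
  rw [Finset.sum_comm]
  refine Finset.sum_congr rfl fun r _ => ?_
  rw [Finset.sum_comm]
  refine Finset.sum_congr rfl fun s _ => ?_
  rw [symbol_eq_sum_coef, Finset.mul_sum, Finset.sum_mul, Finset.mul_sum, Complex.re_sum]
  refine Finset.sum_congr rfl fun d _ => ?_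
  rw [← Complex.re_ofReal_mul]
  congr 1
  push_cast
  ring

/-- A real test vector, supported on `2q + 1` consecutive copies of the mold graph, with Rayleigh
quotient at least `M - C / q²`. -/
theorem exists_test_vector {θ M : ℝ} {v : Fin ν → ℂ} (hv : normSq v = 1)
    (hM : quadForm (c • symbol G K θ) v = M) :
    ∃ C : ℝ, 0 ≤ C ∧ ∀ (n : ℕ) (Ω : Set ℝ) (q : ℕ) (a : ℤ), 1 ≤ q →
      (∀ j ∈ Finset.Icc (a - q) (a + q), ∀ r, ∃ u : Node ν n Ω, (u.1.1 : ℤ) = j ∧ u.1.2 = r) →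
      ∃ x : Node ν n Ω → ℝ, x ≠ 0 ∧
        (∀ u, x u ≠ 0 → (u.1.1 : ℤ) ∈ Finset.Icc (a - q) (a + q)) ∧
        (M - C / (q : ℝ) ^ 2) * normSq x ≤
          quadForm (gridGraph G K (fun _ => c) Ω n).adjMatrix x := by
  set D := Finset.Icc (-bandwidth K) (bandwidth K) with hD
  set b := scalarCoef G K c θ v with hb
  set C₀ : ℝ := ∑ d ∈ D, |b d| * ((d : ℝ) ^ 2 * (3 + 2 * |(d : ℝ)|)) with hC₀
  have hC₀0 : 0 ≤ C₀ := Finset.sum_nonneg fun d _ => by positivity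
  -- The defect of the form is at most C₀ q, since the support has 2q + 1 ≤ 3q copies, while the
  -- squared norm is at least q³/4.
  refine ⟨4 * C₀, by positivity, fun n Ω q a hq hS => ?_⟩
  set S := Finset.Icc (a - (q : ℤ)) (a + q) with hSdef
  set η := tent q a with hη
  have hη0 : ∀ j ∉ S, η j = 0 := fun j hj => tent_eq_zero hj
  set N := ∑ i ∈ S, η i ^ 2 with hN
  have hqr : (1 : ℝ) ≤ q := by exact_mod_cast hq
  have hNq : (q : ℝ) ^ 3 / 4 ≤ N := le_sum_tent_sq q a
  have hNpos : 0 < N := lt_of_lt_of_le (by positivity) hNq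
  -- The wave e^{-ijθ} v is cut off by the tent. The negative sign in the exponent makes products of
  -- conj(y u) and y w carry e^{i(i-j)θ}, matching the Fourier series of the symbol. The matrix
  -- being real symmetric, the complex form is the sum of the forms of the real and imaginary parts.
  set y : Node ν n Ω → ℂ := fun u =>
    (η (u.1.1 : ℤ) : ℂ) * (Complex.exp ((-((u.1.1 : ℤ) * θ) : ℝ) * Complex.I) * v u.1.2) with hy
  set x₁ : Node ν n Ω → ℝ := fun u => (y u).re with hx₁
  set x₂ : Node ν n Ω → ℝ := fun u => (y u).im with hx₂
  have hy0 : ∀ u : Node ν n Ω, (u.1.1 : ℤ) ∉ S → y u = 0 := fun u hu => by simp [hy, hη0 _ hu]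
  have hnorm : normSq x₁ + normSq x₂ = N := by
    have h1 : normSq x₁ + normSq x₂ = ∑ u : Node ν n Ω, η (u.1.1 : ℤ) ^ 2 * ‖v u.1.2‖ ^ 2 := by
      rw [normSq, normSq, ← Finset.sum_add_distrib]
      refine Finset.sum_congr rfl fun u _ => ?_
      have h2 : ‖y u‖ ^ 2 = η (u.1.1 : ℤ) ^ 2 * ‖v u.1.2‖ ^ 2 := by
        simp only [hy]
        rw [norm_mul, norm_mul, Complex.norm_exp_ofReal_mul_I, Complex.norm_real, one_mul, mul_pow,
          Real.norm_eq_abs, sq_abs]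
      rw [← h2, Complex.sq_norm, Complex.normSq_apply, Real.norm_eq_abs, Real.norm_eq_abs, sq_abs,
        sq_abs]
      ring
    rw [h1, sum_node_eq hS (fun j r => η j ^ 2 * ‖v r‖ ^ 2) fun j hj r => by simp [hη0 j hj]]
    simp_rw [← Finset.mul_sum]
    rw [← Finset.sum_mul]
    have : ∑ r, ‖v r‖ ^ 2 = 1 := hv
    rw [this, mul_one]
  have hform : quadForm (gridGraph G K (fun _ => c) Ω n).adjMatrix x₁ +
      quadForm (gridGraph G K (fun _ => c) Ω n).adjMatrix x₂ =
      ∑ i ∈ S, ∑ j ∈ S, η i * η j * b (i - j) := by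
    set H : ℤ → Fin ν → ℤ → Fin ν → ℝ := fun i r j s => η i * η j * (c * coef G K (i - j) r s *
      (Complex.exp (((i - j : ℤ) * θ : ℝ) * Complex.I) * (star (v r) * v s)).re) with hH
    have h1 : quadForm (gridGraph G K (fun _ => c) Ω n).adjMatrix x₁ +
        quadForm (gridGraph G K (fun _ => c) Ω n).adjMatrix x₂ =
        ∑ u : Node ν n Ω, ∑ w : Node ν n Ω, H (u.1.1 : ℤ) u.1.2 (w.1.1 : ℤ) w.1.2 := by
      rw [quadForm_gridGraph, quadForm_gridGraph, ← Finset.sum_add_distrib]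
      refine Finset.sum_congr rfl fun u _ => ?_
      rw [← Finset.sum_add_distrib]
      refine Finset.sum_congr rfl fun w _ => ?_
      have h2 : x₁ u * x₁ w + x₂ u * x₂ w = η (u.1.1 : ℤ) * η (w.1.1 : ℤ) *
          (Complex.exp ((((u.1.1 : ℤ) - (w.1.1 : ℤ) : ℤ) * θ : ℝ) * Complex.I) *
            (star (v u.1.2) * v w.1.2)).re := by
        have h3 : x₁ u * x₁ w + x₂ u * x₂ w = (star (y u) * y w).re := by
          simp [hx₁, hx₂, Complex.mul_re]
        have h4 : star (Complex.exp ((-((u.1.1 : ℤ) * θ) : ℝ) * Complex.I)) =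
            Complex.exp (((u.1.1 : ℤ) * θ : ℝ) * Complex.I) := by
          rw [RCLike.star_def, ← Complex.exp_conj, map_mul, Complex.conj_ofReal, Complex.conj_I]
          congr 1; push_cast; ring
        have h5 : Complex.exp ((((u.1.1 : ℤ) - (w.1.1 : ℤ) : ℤ) * θ : ℝ) * Complex.I) =
            Complex.exp (((u.1.1 : ℤ) * θ : ℝ) * Complex.I) *
              Complex.exp ((-((w.1.1 : ℤ) * θ) : ℝ) * Complex.I) := by
          rw [← Complex.exp_add]; congr 1; push_cast; ring
        rw [h3, ← Complex.re_ofReal_mul]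
        simp only [hy]
        rw [star_mul', star_mul', h4, h5, RCLike.star_def, Complex.conj_ofReal]
        congr 1
        push_cast
        ring
      simp only [hH]
      linear_combination (c * coef G K ((u.1.1 : ℤ) - (w.1.1 : ℤ)) u.1.2 w.1.2) * h2
    rw [h1, sum_node_eq hS (fun i r => ∑ w : Node ν n Ω, H i r (w.1.1 : ℤ) w.1.2)
      fun j hj r => Finset.sum_eq_zero fun w _ => by simp [hH, hη0 j hj]]
    refine Finset.sum_congr rfl fun i _ => ?_
    have h6 : ∀ r, ∑ w : Node ν n Ω, H i r (w.1.1 : ℤ) w.1.2 = ∑ j ∈ S, ∑ s, H i r j s := fun r =>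
      sum_node_eq hS (fun j s => H i r j s) fun j hj s => by simp [hH, hη0 j hj]
    simp_rw [h6]
    rw [Finset.sum_comm]
    refine Finset.sum_congr rfl fun j _ => ?_
    simp only [hb, scalarCoef, hH, Finset.mul_sum]
  have hcorr : ∑ i ∈ S, ∑ j ∈ S, η i * η j * b (i - j) =
      ∑ d ∈ D, b d * ∑ i ∈ S, ∑ j ∈ S, if i - j = d then η i * η j else 0 := by
    simp_rw [Finset.mul_sum]
    symm
    rw [Finset.sum_comm]
    refine Finset.sum_congr rfl fun i _ => ?_
    rw [Finset.sum_comm]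
    refine Finset.sum_congr rfl fun j _ => ?_
    by_cases h : i - j ∈ D
    · rw [Finset.sum_eq_single_of_mem _ h fun d _ hd => by rw [if_neg (Ne.symm hd), mul_zero],
        if_pos rfl, mul_comm]
    · rw [hb, scalarCoef_eq_zero G K c θ v h, mul_zero]
      exact Finset.sum_eq_zero fun d hd => by
        rw [if_neg (by rintro rfl; exact h hd), mul_zero]
  have hlow : M * N - C₀ * q ≤ ∑ i ∈ S, ∑ j ∈ S, η i * η j * b (i - j) := by
    rw [hcorr, ← hM, ← sum_scalarCoef, Finset.sum_mul, hC₀, Finset.sum_mul,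
      ← Finset.sum_sub_distrib]
    refine Finset.sum_le_sum fun d _ => ?_
    have h1 := abs_sum_sq_sub_autocorrelation_le (η := η) (lo := a - q) (hi := a + q) (by omega)
      hη0 (abs_tent_sub_le q a) d
    have h2 : (d : ℝ) ^ 2 * (((a + q : ℤ) : ℝ) - ((a - q : ℤ) : ℝ) + 1 + 2 * |(d : ℝ)|) ≤
        (d : ℝ) ^ 2 * (3 + 2 * |(d : ℝ)|) * q := by
      rw [mul_assoc]
      gcongr
      push_cast
      nlinarith [abs_nonneg (d : ℝ)]
    have h3 := h1.trans h2
    have h4 := abs_mul (b d) (N - ∑ i ∈ S, ∑ j ∈ S, if i - j = d then η i * η j else 0)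
    have h5 := mul_le_mul_of_nonneg_left h3 (abs_nonneg (b d))
    have h6 := le_abs_self (b d * (N - ∑ i ∈ S, ∑ j ∈ S, if i - j = d then η i * η j else 0))
    change b d * N - _ ≤ _
    linarith
  have hε : C₀ * q ≤ 4 * C₀ / (q : ℝ) ^ 2 * N := by
    calc C₀ * q = 4 * C₀ / (q : ℝ) ^ 2 * ((q : ℝ) ^ 3 / 4) := by field_simp
      _ ≤ _ := by gcongr
  have htot : (M - 4 * C₀ / (q : ℝ) ^ 2) * normSq x₁ + (M - 4 * C₀ / (q : ℝ) ^ 2) * normSq x₂ ≤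
      quadForm (gridGraph G K (fun _ => c) Ω n).adjMatrix x₁ +
      quadForm (gridGraph G K (fun _ => c) Ω n).adjMatrix x₂ := by
    rw [← mul_add, hnorm, hform, sub_mul]
    linarith
  have hsupp₁ : ∀ u, x₁ u ≠ 0 → (u.1.1 : ℤ) ∈ S := fun u hu => by
    by_contra h
    exact hu (by simp [hx₁, hy0 u h])
  have hsupp₂ : ∀ u, x₂ u ≠ 0 → (u.1.1 : ℤ) ∈ S := fun u hu => by
    by_contra h
    exact hu (by simp [hx₂, hy0 u h])
  have hzero : ∀ x : Node ν n Ω → ℝ, x = 0 →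
      normSq x = 0 ∧ quadForm (gridGraph G K (fun _ => c) Ω n).adjMatrix x = 0 := by
    rintro x rfl
    simp [normSq, quadForm]
  -- The bound holds for the sum of the two parts, and they do not both vanish. If the real part is
  -- zero or violates the bound, the imaginary part is nonzero and satisfies it.
  by_cases h1 : x₁ ≠ 0 ∧ (M - 4 * C₀ / (q : ℝ) ^ 2) * normSq x₁ ≤
      quadForm (gridGraph G K (fun _ => c) Ω n).adjMatrix x₁
  · exact ⟨x₁, h1.1, hsupp₁, h1.2⟩
  · refine ⟨x₂, ?_, hsupp₂, ?_⟩
    · intro h2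
      obtain ⟨h3, h4⟩ := hzero x₂ h2
      refine h1 ⟨fun h5 => ?_, by rw [h3, h4] at htot; linarith⟩
      rw [(hzero x₁ h5).1, h3] at hnorm
      linarith
    · by_cases h5 : x₁ = 0
      · rw [(hzero x₁ h5).1, (hzero x₁ h5).2] at htot
        linarith
      · have h6 : ¬ _ := fun h => h1 ⟨h5, h⟩
        rw [not_le] at h6
        linarith

end TestVector

/-! ### The gap between the two largest eigenvalues. -/

section Gap

variable {ν m : ℕ} (G : WeightedGraph (Fin ν)) (K : Links ν m) (c : ℝ)

/-- A regular domain contains an open interval. -/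
theorem IsRegularDomain.exists_Ioo_subset {Ω : Set ℝ} (hΩ : IsRegularDomain Ω) :
    ∃ α β : ℝ, 0 ≤ α ∧ α < β ∧ β ≤ 1 ∧ Ioo α β ⊆ Ω := by
  have hne : (interior Ω).Nonempty := by
    by_contra h
    rw [not_nonempty_iff_eq_empty] at h
    have h1 : Ω ⊆ frontier Ω := by
      rw [frontier, h, sdiff_empty]; exact subset_closure
    exact hΩ.pos.ne' (measure_mono_null h1 hΩ.frontier_null)
  obtain ⟨x, hx⟩ := hne
  obtain ⟨ε, hε, hball⟩ := Metric.isOpen_iff.1 isOpen_interior x hx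
  rw [Real.ball_eq_Ioo] at hball
  have hsub := hball.trans interior_subset
  have h2 : Icc (x - ε / 2) (x + ε / 2) ⊆ Icc 0 1 := fun y hy =>
    hΩ.subset (hsub ⟨by linarith [hy.1], by linarith [hy.2]⟩)
  have h3 := h2 ⟨le_rfl, by linarith⟩
  have h4 := h2 ⟨by linarith, le_rfl⟩
  exact ⟨x - ε / 2, x + ε / 2, h3.1, by linarith, h4.2, fun y hy =>
    hsub ⟨by linarith [hy.1], by linarith [hy.2]⟩⟩

/-- The copies of the mold graph that lie in an interval contained in `Ω`. -/
theorem exists_node {Ω : Set ℝ} {α β : ℝ} (hα : 0 ≤ α) (hαβ : α < β) (hβ : β ≤ 1)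
    (hsub : Ioo α β ⊆ Ω) (n : ℕ) {j : ℤ} (h1 : α * n ≤ j) (h2 : (j : ℝ) + 1 ≤ β * n)
    (r : Fin ν) : ∃ u : Node ν n Ω, (u.1.1 : ℤ) = j ∧ u.1.2 = r := by
  have hν : (0 : ℝ) < ν := Nat.cast_pos.2 r.pos
  have hn0 : (0 : ℝ) ≤ n := Nat.cast_nonneg n
  have hj0 : 0 ≤ j := by
    have : (0 : ℝ) ≤ j := (mul_nonneg hα hn0).trans h1
    exact_mod_cast this
  have hjn : j < n := by
    have : (j : ℝ) + 1 ≤ n := h2.trans (by nlinarith)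
    have : j + 1 ≤ (n : ℤ) := by exact_mod_cast this
    omega
  lift j to ℕ using hj0
  have hjn' : j < n := by exact_mod_cast hjn
  rw [Int.cast_natCast] at h1 h2
  have hr : (r : ℝ) + 1 ≤ ν := by exact_mod_cast r.2
  have hr0 : (0 : ℝ) ≤ r := Nat.cast_nonneg _
  have hden : (0 : ℝ) < ν * n + 1 := by positivity
  refine ⟨⟨(⟨j, hjn'⟩, r), hsub ?_⟩, rfl, rfl⟩
  simp only [immersion]
  -- The summand 1 in the denominator is absorbed by α < 1 on the left and by β > 0 on the right.
  constructor
  · rw [lt_div_iff₀ hden]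
    nlinarith
  · rw [div_lt_iff₀ hden]
    nlinarith

theorem coef_eq_zero_of_separated {d : ℤ} (hd : bandwidth K < |d|) (r s : Fin ν) :
    coef G K d r s = 0 := by
  refine coef_eq_zero G K (fun h => ?_) r s
  rw [Finset.mem_Icc] at h
  exact absurd (abs_le.2 h) (not_le.2 hd)

/-- Two test vectors with separated supports bound the two largest eigenvalues from below. -/
theorem le_second_eigenvalue {Ω : Set ℝ} {n : ℕ} {x₁ x₂ : Node ν n Ω → ℝ} {a : ℝ}
    (h₁ : x₁ ≠ 0) (h₂ : x₂ ≠ 0)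
    (hsep : ∀ u v, x₁ u ≠ 0 → x₂ v ≠ 0 → bandwidth K < (v.1.1 : ℤ) - (u.1.1 : ℤ))
    (hq₁ : a * normSq x₁ ≤ quadForm (gridGraph G K (fun _ => c) Ω n).adjMatrix x₁)
    (hq₂ : a * normSq x₂ ≤ quadForm (gridGraph G K (fun _ => c) Ω n).adjMatrix x₂) :
    ∃ h : 1 < Fintype.card (Node ν n Ω),
      a ≤ (gridGraph G K (fun _ => c) Ω n).adjMatrix_isHermitian.eigenvalues₀ ⟨1, h⟩ := by
  obtain ⟨u₁, hu₁⟩ := Function.ne_iff.1 h₁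
  obtain ⟨u₂, hu₂⟩ := Function.ne_iff.1 h₂
  rw [Pi.zero_apply] at hu₁ hu₂
  have hb := bandwidth_nonneg K
  have hdisj : ∀ u, x₁ u * x₂ u = 0 := fun u => by
    by_contra h
    have := hsep u u (left_ne_zero_of_mul h) (right_ne_zero_of_mul h)
    omega
  have hne : u₁ ≠ u₂ := by
    rintro rfl
    exact mul_ne_zero hu₁ hu₂ (hdisj u₁)
  refine ⟨Fintype.one_lt_card_iff.2 ⟨u₁, u₂, hne⟩, ?_⟩
  let l : (Fin 2 → ℝ) →ₗ[ℝ] (Node ν n Ω → ℝ) := Fintype.linearCombination ℝ ![x₁, x₂]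
  have hl : ∀ y, l y = fun u => y 0 * x₁ u + y 1 * x₂ u := fun y => by
    ext u
    simp [l, Fintype.linearCombination_apply, Fin.sum_univ_two]
  refine le_eigenvalues₀_of_le_on_range _ _ l ?_ (by simp) a fun y => ?_
  · rw [← LinearMap.ker_eq_bot, LinearMap.ker_eq_bot']
    intro y hy
    rw [hl] at hy
    have e1 := congrFun hy u₁
    have e2 := congrFun hy u₂
    have e3 : x₂ u₁ = 0 := (mul_eq_zero.1 (hdisj u₁)).resolve_left hu₁
    have e4 : x₁ u₂ = 0 := (mul_eq_zero.1 (hdisj u₂)).resolve_right hu₂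
    simp only [e3, mul_zero, add_zero, Pi.zero_apply, mul_eq_zero, hu₁, or_false] at e1
    simp only [e4, mul_zero, zero_add, Pi.zero_apply, mul_eq_zero, hu₂, or_false] at e2
    ext i
    fin_cases i <;> simp [e1, e2]
  · have hn : normSq (l y) = y 0 ^ 2 * normSq x₁ + y 1 ^ 2 * normSq x₂ := by
      simp only [normSq, hl, Finset.mul_sum, ← Finset.sum_add_distrib, Real.norm_eq_abs, sq_abs]
      refine Finset.sum_congr rfl fun u _ => ?_
      linear_combination (2 * y 0 * y 1) * hdisj u
    -- Supports further apart than the bandwidth are not coupled by the matrix, so the mixed terms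
    -- vanish and the lower bound extends to the whole plane spanned by the two vectors.
    have hqf : quadForm (gridGraph G K (fun _ => c) Ω n).adjMatrix (l y) =
        y 0 ^ 2 * quadForm (gridGraph G K (fun _ => c) Ω n).adjMatrix x₁ +
          y 1 ^ 2 * quadForm (gridGraph G K (fun _ => c) Ω n).adjMatrix x₂ := by
      simp only [quadForm_gridGraph, hl, Finset.mul_sum, ← Finset.sum_add_distrib]
      refine Finset.sum_congr rfl fun u _ => Finset.sum_congr rfl fun v _ => ?_
      have c1 : x₁ u * coef G K ((u.1.1 : ℤ) - (v.1.1 : ℤ)) u.1.2 v.1.2 * x₂ v = 0 := by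
        by_cases e1 : x₁ u = 0
        · simp [e1]
        by_cases e2 : x₂ v = 0
        · simp [e2]
        have := hsep u v e1 e2
        rw [coef_eq_zero_of_separated G K (by rw [abs_sub_comm]; exact this.trans_le (le_abs_self _)),
          mul_zero, zero_mul]
      have c2 : x₂ u * coef G K ((u.1.1 : ℤ) - (v.1.1 : ℤ)) u.1.2 v.1.2 * x₁ v = 0 := by
        by_cases e1 : x₂ u = 0
        · simp [e1]
        by_cases e2 : x₁ v = 0
        · simp [e2]
        have := hsep v u e2 e1
        rw [coef_eq_zero_of_separated G K (this.trans_le (le_abs_self _)), mul_zero, zero_mul]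
      linear_combination (y 0 * y 1 * c) * c1 + (y 0 * y 1 * c) * c2
    rw [hn, hqf]
    nlinarith [mul_le_mul_of_nonneg_left hq₁ (sq_nonneg (y 0)),
      mul_le_mul_of_nonneg_left hq₂ (sq_nonneg (y 1))]

theorem numNodes_le (Ω : Set ℝ) (n : ℕ) : numNodes ν n Ω ≤ ν * n := by
  have h : Function.Injective (fun u : Node ν n Ω => u.1) := Subtype.val_injective
  have := Fintype.card_le_of_injective _ h
  rwa [Fintype.card_prod, Fintype.card_fin, Fintype.card_fin, mul_comm] at this

/-- The gap of the two largest eigenvalues is of the order `n⁻²`. -/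
theorem exists_gap_le [NeZero ν] {Ω : Set ℝ} (hΩ : IsRegularDomain Ω) :
    ∃ C : ℝ, ∀ᶠ n : ℕ in atTop,
      0 ≤ gridEigenvalue G K (fun _ => c) Ω n (numNodes ν n Ω) -
        gridEigenvalue G K (fun _ => c) Ω n (numNodes ν n Ω - 1) ∧
      gridEigenvalue G K (fun _ => c) Ω n (numNodes ν n Ω) -
        gridEigenvalue G K (fun _ => c) Ω n (numNodes ν n Ω - 1) ≤ C / (n : ℝ) ^ 2 := by
  obtain ⟨α, β, hα, hαβ, hβ, hsub⟩ := hΩ.exists_Ioo_subset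
  obtain ⟨θ, -, hmax⟩ := exists_topBranch_max G K c
  obtain ⟨v, hv, hvM⟩ := exists_unit_quadForm_eq_topBranch G K c θ
  obtain ⟨C, hC, htest⟩ := exists_test_vector G K c hv hvM
  set M := topBranch G K c θ
  set δ := β - α with hδ
  have hδ0 : 0 < δ := sub_pos.2 hαβ
  -- The 16 gives δn/8 - 1 ≥ δn/16, hence a lower bound for `q`. The other term makes room for 4q +
  -- bandwidth + 3 copies in the interval: 4q takes at most half of δn, the rest the other half.
  have hlarge : ∀ᶠ n : ℕ in atTop, 16 + 2 * ((bandwidth K : ℝ) + 3) ≤ δ * n :=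
    (tendsto_natCast_atTop_atTop.const_mul_atTop hδ0).eventually_ge_atTop _
  refine ⟨C * (16 / δ) ^ 2, ?_⟩
  filter_upwards [hlarge] with n hn
  have hB : (0 : ℝ) ≤ bandwidth K := by exact_mod_cast bandwidth_nonneg K
  have hn0 : (0 : ℝ) < n := by
    by_contra! h
    nlinarith
  set q := ⌊δ * n / 8⌋₊ with hq
  have hq1 : (q : ℝ) ≤ δ * n / 8 := Nat.floor_le (by positivity)
  have hq2 : δ * n / 8 < q + 1 := Nat.lt_floor_add_one _
  have hq3 : δ * n / 16 ≤ q := by linarith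
  have hq4 : 1 ≤ q := by
    have : (0 : ℝ) < q := by linarith
    exact_mod_cast this
  set a₁ : ℤ := ⌈α * n⌉ + q with ha₁
  -- The nearest copies in the two supports differ by bandwidth + 1, the smallest distance without
  -- coupling.
  set a₂ : ℤ := a₁ + 2 * q + bandwidth K + 1 with ha₂
  have hceil1 := Int.le_ceil (α * n)
  have hceil2 := Int.ceil_lt_add_one (α * n)
  have hblock : ∀ j : ℤ, ⌈α * n⌉ ≤ j → j ≤ a₂ + q → ∀ r, ∃ u : Node ν n Ω,
      (u.1.1 : ℤ) = j ∧ u.1.2 = r := by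
    intro j hj1 hj2 r
    have h1 : ((⌈α * n⌉ : ℤ) : ℝ) ≤ j := by exact_mod_cast hj1
    have h2 : (j : ℝ) ≤ ((a₂ + q : ℤ) : ℝ) := by exact_mod_cast hj2
    refine exists_node hα hαβ hβ hsub n (hceil1.trans h1) ?_ r
    rw [ha₂, ha₁] at h2
    push_cast at h2
    have h3 : β * n = α * n + δ * n := by rw [hδ]; ring
    linarith
  have hb := bandwidth_nonneg K
  obtain ⟨x₁, hx₁, hs₁, hq₁⟩ := htest n Ω q a₁ hq4 fun j hj => by
    rw [Finset.mem_Icc] at hj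
    exact hblock j (by omega) (by omega)
  obtain ⟨x₂, hx₂, hs₂, hq₂⟩ := htest n Ω q a₂ hq4 fun j hj => by
    rw [Finset.mem_Icc] at hj
    exact hblock j (by omega) (by omega)
  obtain ⟨hcard, hlow⟩ := le_second_eigenvalue G K c hx₁ hx₂ (fun u w hu hw => by
    have h1 := Finset.mem_Icc.1 (hs₁ u hu)
    have h2 := Finset.mem_Icc.1 (hs₂ w hw)
    omega) hq₁ hq₂
  set hA := (gridGraph G K (fun _ => c) Ω n).adjMatrix_isHermitian
  have htop : hA.eigenvalues₀ ⟨0, by omega⟩ ≤ M := by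
    obtain ⟨x, hx, hx'⟩ := exists_unit_mulVec_eq hA ⟨0, by omega⟩
    have h1 := quadForm_gridGraph_le G K c Ω n hmax x
    rwa [quadForm_of_mulVec_eq hx hx', hx, mul_one] at h1
  -- There are at least two nodes, so neither index falls under the default value 0 of
  -- `sortedEigenvalue`; the two largest eigenvalues are at positions 0 and 1 of the non-increasing
  -- list.
  have e1 : gridEigenvalue G K (fun _ => c) Ω n (numNodes ν n Ω) =
      hA.eigenvalues₀ ⟨0, by omega⟩ := by
    rw [gridEigenvalue, sortedEigenvalue, dif_pos ⟨by rw [numNodes]; omega, le_rfl⟩]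
    congr 2
    rw [numNodes]; omega
  have e2 : gridEigenvalue G K (fun _ => c) Ω n (numNodes ν n Ω - 1) =
      hA.eigenvalues₀ ⟨1, hcard⟩ := by
    rw [gridEigenvalue, sortedEigenvalue, dif_pos ⟨by rw [numNodes]; omega, Nat.sub_le _ _⟩]
    congr 2
    rw [numNodes]; omega
  rw [e1, e2]
  have hmono : hA.eigenvalues₀ ⟨1, hcard⟩ ≤ hA.eigenvalues₀ ⟨0, by omega⟩ :=
    hA.eigenvalues₀_antitone (Fin.mk_le_mk.2 zero_le_one)
  refine ⟨by linarith, ?_⟩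
  have h5 : C / (q : ℝ) ^ 2 ≤ C * (16 / δ) ^ 2 / (n : ℝ) ^ 2 := by
    calc C / (q : ℝ) ^ 2 ≤ C / (δ * n / 16) ^ 2 := by gcongr
      _ = _ := by field_simp
  linarith

/-- Each copy inside an interval contained in Ω contributes its first node, and the number of such
copies grows linearly in n. -/
theorem tendsto_numNodes [NeZero ν] {Ω : Set ℝ} (hΩ : IsRegularDomain Ω) :
    Tendsto (fun n => numNodes ν n Ω) atTop atTop := by
  obtain ⟨α, β, hα, hαβ, hβ, hsub⟩ := hΩ.exists_Ioo_subset
  have hlim : Tendsto (fun n : ℕ => (β - α) * n - 2) atTop atTop :=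
    tendsto_atTop_add_const_right _ _
      (tendsto_natCast_atTop_atTop.const_mul_atTop (sub_pos.2 hαβ))
  refine tendsto_natCast_atTop_iff.1 (tendsto_atTop_mono (fun n => ?_) hlim)
  have hnode : ∀ i : Finset.Icc ⌈α * n⌉ (⌊β * n⌋ - 1), ∃ u : Node ν n Ω,
      (u.1.1 : ℤ) = i ∧ u.1.2 = 0 := fun ⟨i, hi⟩ => by
    rw [Finset.mem_Icc] at hi
    refine exists_node hα hαβ hβ hsub n (Int.ceil_le.1 hi.1) ?_ 0
    have : ((i + 1 : ℤ) : ℝ) ≤ β * n := Int.le_floor.1 (by omega)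
    simpa using this
  choose g hg using hnode
  have hinj : Function.Injective g := fun i j hij => Subtype.ext (by
    rw [← (hg i).1, ← (hg j).1, hij])
  have h1 := Fintype.card_le_of_injective g hinj
  rw [Fintype.card_coe, Int.card_Icc] at h1
  have h2 : ((⌊β * n⌋ - 1 + 1 - ⌈α * n⌉ : ℤ) : ℝ) ≤ (numNodes ν n Ω : ℝ) := by
    have : (⌊β * n⌋ - 1 + 1 - ⌈α * n⌉ : ℤ) ≤ (numNodes ν n Ω : ℤ) := by
      rw [numNodes]; omega
    exact_mod_cast this
  push_cast at h2
  have h3 := Int.lt_floor_add_one (β * n)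
  have h4 := Int.ceil_lt_add_one (α * n)
  linarith

end Gap

end DiamondToeplitz

/-! ### The main theorem. -/

theorem corollary5p3 (ν m : ℕ) (hν : 1 ≤ ν)
    (G : DiamondToeplitz.WeightedGraph (Fin ν)) (K : DiamondToeplitz.Links ν m)
    (Ω : Set ℝ) (hΩ : DiamondToeplitz.IsRegularDomain Ω) (c : ℝ) :
    DifferentiableWithinAt ℝ
        (DiamondToeplitz.rearrangement G K (fun _ => c) Ω) (Icc 0 1) 1 ∧
      ∀ N : ℕ → ℕ,
        ((N = fun n => ν * n) ∨ (N = fun n => DiamondToeplitz.numNodes ν n Ω)) →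
        (∀ᶠ n in atTop, DifferentiableAt ℝ
          (DiamondToeplitz.rearrangement G K (fun _ => c) Ω) (1 - 1 / (N n : ℝ))) ∧
        Tendsto (fun n => deriv
          (DiamondToeplitz.rearrangement G K (fun _ => c) Ω) (1 - 1 / (N n : ℝ))) atTop (𝓝 0) ∧
        Tendsto (fun n => (N n : ℝ) *
          (DiamondToeplitz.gridEigenvalue G K (fun _ => c) Ω n (DiamondToeplitz.numNodes ν n Ω) -
            DiamondToeplitz.gridEigenvalue G K (fun _ => c) Ω n
              (DiamondToeplitz.numNodes ν n Ω - 1))) atTop (𝓝 0) := by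
  have : NeZero ν := ⟨by omega⟩
  obtain ⟨h1, h2, h3⟩ := DiamondToeplitz.rearrangement_regular G K c hΩ
  refine ⟨h1, fun N hN => ?_⟩
  have hNtop : Tendsto N atTop atTop := by
    rcases hN with rfl | rfl
    · exact tendsto_id.const_mul_atTop' hν
    · exact DiamondToeplitz.tendsto_numNodes hΩ
  have hNle : ∀ n, N n ≤ ν * n := by
    rcases hN with rfl | rfl
    · exact fun n => le_rfl
    · exact DiamondToeplitz.numNodes_le Ω
  -- The sample points approach 1 strictly from the left, so the one-sided limit statements apply to
  -- both choices of `N`.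
  have hx : Tendsto (fun n => 1 - 1 / (N n : ℝ)) atTop (𝓝[<] 1) := by
    refine tendsto_nhdsWithin_iff.2 ⟨?_, ?_⟩
    · simpa using (tendsto_const_nhds (x := (1 : ℝ))).sub
        (tendsto_one_div_atTop_nhds_zero_nat.comp hNtop)
    · filter_upwards [hNtop.eventually_gt_atTop 0] with n hn
      have : (0 : ℝ) < 1 / (N n : ℝ) := by positivity
      rw [mem_Iio]
      linarith
  refine ⟨hx.eventually h2, h3.comp hx, ?_⟩
  obtain ⟨C, hC⟩ := DiamondToeplitz.exists_gap_le G K c hΩ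
  have hlim : Tendsto (fun n : ℕ => (ν : ℝ) * C * (1 / (n : ℝ))) atTop (𝓝 0) := by
    simpa using (tendsto_one_div_atTop_nhds_zero_nat (𝕜 := ℝ)).const_mul ((ν : ℝ) * C)
  refine squeeze_zero' ?_ ?_ hlim
  · filter_upwards [hC] with n hn using mul_nonneg (Nat.cast_nonneg _) hn.1
  · filter_upwards [hC, eventually_gt_atTop 0] with n hn hn0
    have hn0' : (0 : ℝ) < n := Nat.cast_pos.2 hn0
    have hNr : (N n : ℝ) ≤ ν * n := by exact_mod_cast hNle n
    calc _ ≤ (ν * n : ℝ) * (C / (n : ℝ) ^ 2) :=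
          mul_le_mul hNr hn.2 hn.1 (by positivity)
      _ = _ := by field_simp
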